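/- **Theorem (existence and regularity of the blow-up curve).** Let $\mu>0$ and $1<p<1+\frac2\mu$ be such that $s\mapsto s^p$ is of class $\mathcal C^4$ on $[0,\infty)$, let $R^*,T^*>0$, and let $\gamma_1,\gamma_2>0$ satisfy $\gamma_1+\gamma_2>\max\bigl(1,(\mu p2^p)^{1/(p-1)}\bigr)$. Put $B_r=\{x\in\mathbb R:|x|<r\}$, $D_\pm=\partial_t\pm\partial_x$ and $K_-(x_0,t_0)=\{(x,t):t>0,\ |x-x_0|<t_0-t\}$. Let $f,g:\mathbb R\to\mathbb R$ be such that - (A1) $T_1<T^*$, where $T_1>0$ is the time at which the solution of $\hat\phi'=\hat\psi'=2^{-p}|\hat\phi+\hat\psi|^p-\frac\mu2(\hat\phi+\hat\psi)$, $\hat\phi(0)=\gamma_1$, $\hat\psi(0)=\gamma_2$, blows up: $\hat\phi(t)+\hat\psi(t)\to\infty$ as $t\nearrow T_1$; - (A2) $f\ge\gamma_1$ and $g\ge\gamma_2$ in $B_{R^*+T^*}$; - (A3) $f,g\in\mathcal C^4(\overline{B_{R^*+T^*}})$; - (A4) there is $\varepsilon_0>0$ with $2^{-p}(\gamma_1+\gamma_2)^p-\frac\mu2(\gamma_1+\gamma_2)\ge(2+\varepsilon_0)\bigl(|f'(x)|+|g'(x)|\bigr)$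 for all $x\in B_{R^*+T^*}$; - (A5) there is $\varepsilon_1\ne-1$ with $2^{-p}(2p-1)\bigl(1+\frac{\varepsilon_1}{2(1+\varepsilon_1)}\bigr)\bigl(1-\frac1{2p}\bigr)-2^{-p+1}p-\mu>0$ and $2^{-p}(\gamma_1+\gamma_2)^p-\frac\mu2(\gamma_1+\gamma_2)\ge(2+\varepsilon_1)\bigl(|f'(x)|+|g'(x)|\bigr)$ for all $x\in B_{R^*+T^*}$. For a function $T:B_{R^*}\to(0,\infty)$ let $\Omega_T=\{(x,t):x\in B_{R^*},\ 0<t<T(x)\}$, and let $\mathcal D_T=\bigcup_{z\in\Omega_T}K_-(z)\supset\Omega_T$ be its domain of dependence. Then there exist a unique function $T\in\mathcal C^1(B_{R^*})$ with $0<T(x)<T^*$ for all $x\in B_{R^*}$ and a unique pair $(\phi,\psi)$ of functions of class $\mathcal C^{3,1}$ in $\mathcal D_T$ (that is, $\mathcal C^3$ with locally Lipschitz third derivatives), continuous up to the part of the line $t=0$ below $\mathcal D_T$, namely $\{(x,0):|x-x_0|<t_0\text{ for some }(x_0,t_0)\in\Omega_T\}$, such that $$ D_-\phi=D_+\psi=2^{-p}|\phi+\psi|^p-\frac{\mu}{1+t}\,\frac{\phi+\psi}2\quad\text{in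 }\mathcal D_T, $$ $\phi(x,0)=f(x)$ and $\psi(x,0)=g(x)$ at the points $(x,0)$ of that part of the line, and $$ \phi(x,t)\to\infty,\quad\psi(x,t)\to\infty\qquad\text{as }t\nearrow T(x),\quad\text{for each }x\in B_{R^*}. $$ Uniqueness holds for the triple: any other triple $(T',\phi',\psi')$ with these properties satisfies $T'=T$ on $B_{R^*}$ and $(\phi',\psi')=(\phi,\psi)$ on $\mathcal D_T$ and on that part of the line. Moreover, for this solution the third derivatives of $\phi$ and $\psi$ are Lipschitz continuous in each cone $K_-(z)$, $z\in\Omega_T$. -/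

import Mathlib

open Set Filter Topology

namespace BlowupCurve

noncomputable section

/-- The right-hand side `2^{-p} |w|^p - (μ / (1 + t)) (w / 2)` of both equations of the system,
where `w = φ + ψ`. -/
def source (p μ t w : ℝ) : ℝ :=
  (2 : ℝ) ^ (-p) * |w| ^ p - μ / (1 + t) * (w / 2)

/-- The right-hand side `2^{-p} |w|^p - (μ / 2) w` of the comparison ODE system. -/
def odeSource (p μ w : ℝ) : ℝ :=
  (2 : ℝ) ^ (-p) * |w| ^ p - μ / 2 * w

/-- `T₁` is the blow-up time of the ODE system
`a' = b' = 2^{-p} |a + b|^p - (μ / 2) (a + b)`, `a 0 = γ₁`, `b 0 = γ₂`: the system has a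
solution on `[0, T₁)` whose sum `a + b` tends to `∞` at `T₁`. -/
def IsODEBlowupTime (p μ γ₁ γ₂ T₁ : ℝ) : Prop :=
  0 < T₁ ∧ ∃ a b : ℝ → ℝ,
    ContinuousOn a (Ico 0 T₁) ∧ ContinuousOn b (Ico 0 T₁) ∧
    a 0 = γ₁ ∧ b 0 = γ₂ ∧
    (∀ t ∈ Ioo 0 T₁, HasDerivAt a (odeSource p μ (a t + b t)) t ∧
      HasDerivAt b (odeSource p μ (a t + b t)) t) ∧
    Tendsto (fun t => a t + b t) (𝓝[<] T₁) atTop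

/-- The open backward cone `K₋(x₀, t₀) = {(x, t) : t > 0, |x - x₀| < t₀ - t}` with vertex
`z = (x₀, t₀)`. Points of the plane are pairs `(x, t)`. -/
def backwardCone (z : ℝ × ℝ) : Set (ℝ × ℝ) :=
  {w | 0 < w.2 ∧ |w.1 - z.1| < z.2 - w.2}

/-- The backward cone together with its (open) base on the initial line `t = 0`. -/
def backwardConeWithBase (z : ℝ × ℝ) : Set (ℝ × ℝ) :=
  {w | 0 ≤ w.2 ∧ |w.1 - z.1| < z.2 - w.2}

/-- `Ω = {(x, t) : |x| < R, 0 < t < T x}`. -/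
def region (R : ℝ) (T : ℝ → ℝ) : Set (ℝ × ℝ) :=
  {z | |z.1| < R ∧ 0 < z.2 ∧ z.2 < T z.1}

/-- The domain of dependence of `Ω`: the union of the open backward cones with vertex in `Ω`.
It is open and contains `Ω`. -/
def depDomain (R : ℝ) (T : ℝ → ℝ) : Set (ℝ × ℝ) :=
  ⋃ z ∈ region R T, backwardCone z

/-- The domain of dependence of `Ω` together with its base on the initial line `t = 0`. -/
def depDomainWithBase (R : ℝ) (T : ℝ → ℝ) : Set (ℝ × ℝ) :=
  ⋃ z ∈ region R T, backwardConeWithBase z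

/-- `h` is of class `C^{3,1}` in the open set `U`: it is `C^3` there and its derivative of order
three is locally Lipschitz. -/
def IsC31On (h : ℝ × ℝ → ℝ) (U : Set (ℝ × ℝ)) : Prop :=
  ContDiffOn ℝ 3 h U ∧ LocallyLipschitzOn U (iteratedFDeriv ℝ 3 h)

/-- The characteristic derivative `D₋ = ∂ₜ - ∂ₓ`. -/
def Dminus (h : ℝ × ℝ → ℝ) (z : ℝ × ℝ) : ℝ := fderiv ℝ h z (-1, 1)

/-- The characteristic derivative `D₊ = ∂ₜ + ∂ₓ`. -/
def Dplus (h : ℝ × ℝ → ℝ) (z : ℝ × ℝ) : ℝ := fderiv ℝ h z (1, 1)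

/-- `(φ, ψ)` is a `C^{3,1}` solution of the system, with initial data `(f, g)`, in the domain of
dependence of `Ω = {(x, t) : |x| < R, 0 < t < T x}`; it is continuous up to the initial line. -/
structure IsSolution (p μ R : ℝ) (f g : ℝ → ℝ) (T : ℝ → ℝ) (φ ψ : ℝ × ℝ → ℝ) : Prop where
  regular_left : IsC31On φ (depDomain R T)
  regular_right : IsC31On ψ (depDomain R T)
  continuous_left : ContinuousOn φ (depDomainWithBase R T)
  continuous_right : ContinuousOn ψ (depDomainWithBase R T)
  eq_left : ∀ z ∈ depDomain R T, Dminus φ z = source p μ z.2 (φ z + ψ z)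
  eq_right : ∀ z ∈ depDomain R T, Dplus ψ z = source p μ z.2 (φ z + ψ z)
  init_left : ∀ x : ℝ, (x, (0 : ℝ)) ∈ depDomainWithBase R T → φ (x, 0) = f x
  init_right : ∀ x : ℝ, (x, (0 : ℝ)) ∈ depDomainWithBase R T → ψ (x, 0) = g x

/-- `T` is a `C^1` function on `B_R` with `0 < T < Tstar`, and `(φ, ψ)` is a `C^{3,1}` solution of
the system below the graph of `T` both components of which tend to `∞` at this graph. -/
structure IsBlowupSolution (p μ R Tstar : ℝ) (f g : ℝ → ℝ) (T : ℝ → ℝ) (φ ψ : ℝ × ℝ → ℝ) :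
    Prop where
  contDiffOn_time : ContDiffOn ℝ 1 T (Metric.ball 0 R)
  time_mem : ∀ x ∈ Metric.ball (0 : ℝ) R, 0 < T x ∧ T x < Tstar
  isSolution : IsSolution p μ R f g T φ ψ
  blowup_left : ∀ x ∈ Metric.ball (0 : ℝ) R,
    Tendsto (fun t => φ (x, t)) (𝓝[<] (T x)) atTop
  blowup_right : ∀ x ∈ Metric.ball (0 : ℝ) R,
    Tendsto (fun t => ψ (x, t)) (𝓝[<] (T x)) atTop

end

end BlowupCurve

namespace BlowupCurve

section Transport

variable {E : Type*} [NormedAddCommGroup E] [NormedSpace ℝ E]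

/-- Mild form of the transport equation `∂ₜ φ - c ∂ₓ φ = S` with initial value `f`. -/
def Transport (c : ℝ) (f : ℝ → E) (S φ : ℝ × ℝ → E) : Prop :=
  ∀ x t : ℝ, φ (x, t) = f (x + c * t) + ∫ s in (0 : ℝ)..t, S (x + c * (t - s), s)

theorem norm_integral_le_exp {K C t : ℝ} (hK : 0 < K) (hC : 0 ≤ C) {g : ℝ → E}
    (hg : ∀ s ∈ uIcc 0 t, ‖g s‖ ≤ C * Real.exp (K * |s|)) :
    ‖∫ s in (0 : ℝ)..t, g s‖ ≤ C * Real.exp (K * |t|) / K := by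
  have key : ∀ (t : ℝ) (g : ℝ → E), 0 ≤ t → (∀ s ∈ Icc 0 t, ‖g s‖ ≤ C * Real.exp (K * s)) →
      ‖∫ s in (0 : ℝ)..t, g s‖ ≤ C * Real.exp (K * t) / K := by
    intro t g ht hg
    have h1 : ‖∫ s in (0 : ℝ)..t, g s‖ ≤ ∫ s in (0 : ℝ)..t, C * Real.exp (K * s) := by
      apply intervalIntegral.norm_integral_le_of_norm_le ht
      · exact Eventually.of_forall fun s hs => hg s ⟨hs.1.le, hs.2⟩
      · exact Continuous.intervalIntegrable (by fun_prop) _ _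
    have h2 : ∫ s in (0 : ℝ)..t, C * Real.exp (K * s) =
        C * Real.exp (K * t) / K - C * Real.exp (K * 0) / K := by
      apply intervalIntegral.integral_eq_sub_of_hasDerivAt
      · intro s _
        have : HasDerivAt (fun s => Real.exp (K * s)) (Real.exp (K * s) * (K * 1)) s :=
          ((hasDerivAt_id s).const_mul K).exp
        refine ((this.const_mul C).div_const K).congr_deriv ?_
        rw [mul_one, mul_div_assoc, mul_div_assoc, div_self hK.ne', mul_one]
      · exact Continuous.intervalIntegrable (by fun_prop) _ _
    rw [h2] at h1
    have : 0 ≤ C * Real.exp (K * 0) / K := by positivity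
    linarith
  rcases le_total 0 t with ht | ht
  · rw [abs_of_nonneg ht]
    refine key t g ht fun s hs => ?_
    have := hg s (by rwa [uIcc_of_le ht])
    rwa [abs_of_nonneg hs.1] at this
  · rw [abs_of_nonpos ht]
    have h := key (-t) (fun s => g (-s)) (by linarith) fun s hs => ?_
    · rw [intervalIntegral.integral_comp_neg, neg_neg, neg_zero,
        intervalIntegral.integral_symm, norm_neg] at h
      exact h
    · have := hg (-s) (by rw [uIcc_of_ge ht]; exact ⟨by linarith [hs.2], by linarith [hs.1]⟩)
      rwa [abs_neg, abs_of_nonneg hs.1] at this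

/-- The closed two-sided cone `|x - x₀| + |t| ≤ r`. -/
def doubleCone (x₀ r : ℝ) : Set (ℝ × ℝ) := {z | |z.1 - x₀| + |z.2| ≤ r}

theorem isCompact_doubleCone (x₀ r : ℝ) : IsCompact (doubleCone x₀ r) := by
  refine (isCompact_Icc (a := x₀ - r) (b := x₀ + r)).prod (isCompact_Icc (a := -r) (b := r))
    |>.of_isClosed_subset ?_ ?_
  · exact isClosed_le (by fun_prop) continuous_const
  · rintro ⟨x, t⟩ h
    simp only [doubleCone, mem_ofPred_eq] at h
    have h1 := abs_nonneg (x - x₀)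
    have h2 := abs_nonneg t
    have h3 := abs_le.1 (by linarith : |x - x₀| ≤ r)
    have h4 := abs_le.1 (by linarith : |t| ≤ r)
    exact ⟨⟨by linarith, by linarith⟩, ⟨by linarith, by linarith⟩⟩

theorem abs_sub_add_abs_of_mem_uIcc {s t : ℝ} (hs : s ∈ uIcc 0 t) : |t - s| + |s| = |t| := by
  rcases le_total 0 t with ht | ht
  · rw [uIcc_of_le ht] at hs
    rw [abs_of_nonneg ht, abs_of_nonneg hs.1, abs_of_nonneg (by linarith [hs.2])]; ring
  · rw [uIcc_of_ge ht] at hs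
    rw [abs_of_nonpos ht, abs_of_nonpos hs.2, abs_of_nonpos (by linarith [hs.1])]; ring

theorem mem_doubleCone_char {c x₀ r x t s : ℝ} (hc : |c| ≤ 1) (h : (x, t) ∈ doubleCone x₀ r)
    (hs : s ∈ uIcc 0 t) : (x + c * (t - s), s) ∈ doubleCone x₀ r := by
  simp only [doubleCone, mem_ofPred_eq] at h ⊢
  have h1 := abs_sub_add_abs_of_mem_uIcc hs
  have h2 : |x + c * (t - s) - x₀| ≤ |x - x₀| + |c * (t - s)| := by
    rw [add_sub_right_comm]; exact abs_add_le _ _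
  have h3 : |c * (t - s)| ≤ |t - s| := by
    rw [abs_mul]; exact mul_le_of_le_one_left (abs_nonneg _) hc
  linarith

theorem mem_base_of_mem_doubleCone {c x₀ r x t : ℝ} (hc : |c| ≤ 1)
    (h : (x, t) ∈ doubleCone x₀ r) : |x + c * t - x₀| ≤ r := by
  have := mem_doubleCone_char hc h (left_mem_uIcc (a := 0) (b := t))
  simpa [doubleCone] using this

/-- Gronwall's inequality in a two-sided cone. -/
theorem transport_gronwall {f g : ℝ → E} {S R φ ψ : ℝ × ℝ → E} (hφ : Continuous φ)
    (hψ : Continuous ψ) (h1 : Transport 1 f S φ) (h2 : Transport (-1) g R ψ) {x₀ r L c : ℝ}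
    (hL : 0 ≤ L) (hc : 0 ≤ c)
    (hf : ∀ y, |y - x₀| ≤ r → ‖f y‖ ≤ c) (hg : ∀ y, |y - x₀| ≤ r → ‖g y‖ ≤ c)
    (hS : ∀ z ∈ doubleCone x₀ r, ‖S z‖ ≤ L * (‖φ z‖ + ‖ψ z‖) + c)
    (hR : ∀ z ∈ doubleCone x₀ r, ‖R z‖ ≤ L * (‖φ z‖ + ‖ψ z‖) + c)
    {z : ℝ × ℝ} (hz : z ∈ doubleCone x₀ r) :
    ‖φ z‖ ≤ 4 * Real.exp ((4 * L + 4) * r) * c ∧ ‖ψ z‖ ≤ 4 * Real.exp ((4 * L + 4) * r) * c := by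
  set K := 4 * L + 4 with hKdef
  have hK : 0 < K := by positivity
  obtain ⟨z₁, hz₁, hmax⟩ := (isCompact_doubleCone x₀ r).exists_isMaxOn ⟨z, hz⟩
    (f := fun z => Real.exp (-(K * |z.2|)) * max ‖φ z‖ ‖ψ z‖)
    (Continuous.continuousOn (by fun_prop))
  set M := Real.exp (-(K * |z₁.2|)) * max ‖φ z₁‖ ‖ψ z₁‖ with hM
  have hM0 : 0 ≤ M := by positivity
  have hle : ∀ z ∈ doubleCone x₀ r, max ‖φ z‖ ‖ψ z‖ ≤ M * Real.exp (K * |z.2|) := by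
    intro z hz
    have h : Real.exp (-(K * |z.2|)) * max ‖φ z‖ ‖ψ z‖ ≤ M := hmax hz
    have h3 := mul_le_mul_of_nonneg_right h (Real.exp_pos (K * |z.2|)).le
    rwa [mul_comm (Real.exp (-(K * |z.2|))), mul_assoc, ← Real.exp_add, neg_add_cancel,
      Real.exp_zero, mul_one] at h3
  have est : ∀ (e : ℝ) (f : ℝ → E) (S φ : ℝ × ℝ → E), |e| ≤ 1 → Transport e f S φ →
      (∀ y, |y - x₀| ≤ r → ‖f y‖ ≤ c) → (∀ z ∈ doubleCone x₀ r, ‖S z‖ ≤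
        (2 * L * M + c) * Real.exp (K * |z.2|)) → ∀ z ∈ doubleCone x₀ r,
        ‖φ z‖ ≤ (c + (2 * L * M + c) / K) * Real.exp (K * |z.2|) := by
    rintro e f S φ he h hf hS ⟨x, t⟩ hz
    rw [h x t]
    have h3 := norm_integral_le_exp (t := t) hK (by positivity : 0 ≤ 2 * L * M + c)
      (g := fun s => S (x + e * (t - s), s)) fun s hs => hS _ (mem_doubleCone_char he hz hs)
    have h4 := hf _ (mem_base_of_mem_doubleCone he hz)
    have h5 : 1 ≤ Real.exp (K * |t|) := Real.one_le_exp (by positivity)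
    calc _ ≤ _ := norm_add_le _ _
      _ ≤ c * Real.exp (K * |t|) + (2 * L * M + c) * Real.exp (K * |t|) / K := by
        gcongr; nlinarith
      _ = _ := by ring
  have src : ∀ S : ℝ × ℝ → E, (∀ z ∈ doubleCone x₀ r, ‖S z‖ ≤ L * (‖φ z‖ + ‖ψ z‖) + c) →
      ∀ z ∈ doubleCone x₀ r, ‖S z‖ ≤ (2 * L * M + c) * Real.exp (K * |z.2|) := by
    intro S hS z hz
    have h3 := hle z hz
    have h4 := (le_max_left _ _).trans h3
    have h5 := (le_max_right _ _).trans h3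
    have h6 : 1 ≤ Real.exp (K * |z.2|) := Real.one_le_exp (by positivity)
    have := hS z hz
    nlinarith [mul_le_mul_of_nonneg_left h4 hL, mul_le_mul_of_nonneg_left h5 hL]
  have e1 := est 1 f S φ (by simp) h1 hf (src S hS)
  have e2 := est (-1) g R ψ (by simp) h2 hg (src R hR)
  have hMle : M ≤ c + (2 * L * M + c) / K := by
    have h3 := max_le (e1 z₁ hz₁) (e2 z₁ hz₁)
    have h4 := mul_le_mul_of_nonneg_left h3 (Real.exp_pos (-(K * |z₁.2|))).le
    rwa [← hM, mul_comm, mul_assoc, ← Real.exp_add, add_neg_cancel, Real.exp_zero, mul_one] at h4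
  have hM4 : M ≤ 4 * c := by
    have h3 : (2 * L * M + c) / K ≤ M / 2 + c / 4 := by
      rw [div_le_iff₀ hK, hKdef]; nlinarith [mul_nonneg hL hc]
    linarith
  have hzr : |z.2| ≤ r := by
    have := abs_nonneg (z.1 - x₀); have : |z.1 - x₀| + |z.2| ≤ r := hz; linarith
  have hfin : M * Real.exp (K * |z.2|) ≤ 4 * Real.exp (K * r) * c := by
    have : Real.exp (K * |z.2|) ≤ Real.exp (K * r) := by gcongr
    calc _ ≤ 4 * c * Real.exp (K * r) := by gcongr
      _ = _ := by ring
  exact ⟨(le_max_left _ _).trans ((hle z hz).trans hfin),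
    (le_max_right _ _).trans ((hle z hz).trans hfin)⟩

theorem Transport.sub {c : ℝ} {f g : ℝ → E} {S R φ ψ : ℝ × ℝ → E} (h1 : Transport c f S φ)
    (h2 : Transport c g R ψ) (hS : Continuous S) (hR : Continuous R) :
    Transport c (f - g) (S - R) (φ - ψ) := by
  intro x t
  simp only [Pi.sub_apply]
  rw [h1 x t, h2 x t, intervalIntegral.integral_sub]
  · abel
  · exact Continuous.intervalIntegrable (by fun_prop) _ _
  · exact Continuous.intervalIntegrable (by fun_prop) _ _

theorem Transport.smul {c : ℝ} {f : ℝ → E} {S φ : ℝ × ℝ → E} (h1 : Transport c f S φ) (k : ℝ) :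
    Transport c (k • f) (k • S) (k • φ) := by
  intro x t
  simp only [Pi.smul_apply]
  rw [h1 x t, intervalIntegral.integral_smul, smul_add]

theorem Transport.shift {c : ℝ} {f : ℝ → E} {S φ : ℝ × ℝ → E} (h1 : Transport c f S φ) (h : ℝ) :
    Transport c (fun y => f (y + h)) (fun z => S (z.1 + h, z.2)) (fun z => φ (z.1 + h, z.2)) := by
  intro x t
  simp only
  rw [h1 (x + h) t]
  congr 2
  · ring
  · simp only [add_right_comm]

/-- Derivative along characteristics. -/
theorem Transport.hasDerivAt_char [CompleteSpace E] {c : ℝ} {f : ℝ → E} {S φ : ℝ × ℝ → E}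
    (h : Transport c f S φ) (hS : Continuous S) (y t : ℝ) :
    HasDerivAt (fun t => φ (y - c * t, t)) (S (y - c * t, t)) t := by
  have h1 : (fun t => φ (y - c * t, t)) =
      fun t => f y + ∫ s in (0 : ℝ)..t, S (y - c * s, s) := by
    ext t
    rw [h]
    congr 2
    · ring
    · ext s; congr 2; ring
  rw [h1]
  have h2 : Continuous fun s => S (y - c * s, s) := by fun_prop
  exact (h2.integral_hasStrictDerivAt 0 t).hasDerivAt.const_add _

/-- A transported function whose space derivative is continuous is differentiable. -/
theorem Transport.hasFDerivAt [CompleteSpace E] {c : ℝ} {f : ℝ → E} {S φ P : ℝ × ℝ → E}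
    (h : Transport c f S φ) (hS : Continuous S) (hP : Continuous P)
    (hφ : ∀ x t, HasDerivAt (fun y => φ (y, t)) (P (x, t)) x) (z : ℝ × ℝ) :
    HasFDerivAt φ ((ContinuousLinearMap.fst ℝ ℝ ℝ + c • ContinuousLinearMap.snd ℝ ℝ ℝ).smulRight
      (P z) + (ContinuousLinearMap.snd ℝ ℝ ℝ).smulRight (S z)) z := by
  have key : ∀ u : ℝ × ℝ, HasFDerivAt (fun v : ℝ × ℝ => φ (v.1 - c * v.2, v.2))
      ((ContinuousLinearMap.toSpanSingleton ℝ (P (u.1 - c * u.2, u.2))).coprod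
        (ContinuousLinearMap.toSpanSingleton ℝ (S (u.1 - c * u.2, u.2)))) u := by
    intro u
    refine (hasStrictFDerivAt_uncurry_coprod (𝕜 := ℝ) (f := fun y t => φ (y - c * t, t))
      (f₁ := fun y t => ContinuousLinearMap.toSpanSingleton ℝ (P (y - c * t, t)))
      (f₂ := fun y t => ContinuousLinearMap.toSpanSingleton ℝ (S (y - c * t, t)))
      (u := u) ?_ ?_ ?_ ?_).hasFDerivAt
    · refine Eventually.of_forall fun v => ?_
      have := (hφ (v.1 - c * v.2) v.2).comp_sub_const v.1 (c * v.2)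
      exact this.hasFDerivAt
    · exact Eventually.of_forall fun v => (h.hasDerivAt_char hS v.1 v.2).hasFDerivAt
    · refine Continuous.continuousAt ?_
      have : Continuous fun v : ℝ × ℝ => ContinuousLinearMap.toSpanSingletonCLE (𝕜 := ℝ) (E := E)
        (P (v.1 - c * v.2, v.2)) := by fun_prop
      exact this
    · refine Continuous.continuousAt ?_
      have : Continuous fun v : ℝ × ℝ => ContinuousLinearMap.toSpanSingletonCLE (𝕜 := ℝ) (E := E)
        (S (v.1 - c * v.2, v.2)) := by fun_prop
      exact this
  have h1 := key (z.1 + c * z.2, z.2)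
  have h2 : HasFDerivAt (fun z : ℝ × ℝ => (z.1 + c * z.2, z.2))
      ((ContinuousLinearMap.fst ℝ ℝ ℝ + c • ContinuousLinearMap.snd ℝ ℝ ℝ).prod
        (ContinuousLinearMap.snd ℝ ℝ ℝ)) z :=
    (hasFDerivAt_fst.add (hasFDerivAt_snd.const_mul c)).prodMk hasFDerivAt_snd
  have h3 := h1.comp z h2
  have h4 : ((fun v : ℝ × ℝ => φ (v.1 - c * v.2, v.2)) ∘ fun z : ℝ × ℝ => (z.1 + c * z.2, z.2))
      = φ := by
    ext v; simp
  rw [h4] at h3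
  exact h3.congr_fderiv (by ext <;> simp)

theorem hasDerivAt_integral_char [CompleteSpace E] {c : ℝ} {S S' : ℝ × ℝ → E} (hS : Continuous S)
    (hS' : Continuous S') (h : ∀ x t, HasDerivAt (fun y => S (y, t)) (S' (x, t)) x) (x t : ℝ) :
    HasDerivAt (fun x => ∫ s in (0 : ℝ)..t, S (x + c * (t - s), s))
      (∫ s in (0 : ℝ)..t, S' (x + c * (t - s), s)) x := by
  have hc : Continuous fun p : ℝ × ℝ => S' (p.1 + c * (t - p.2), p.2) := by fun_prop
  obtain ⟨C, hC⟩ := ((isCompact_Icc (a := x - 1) (b := x + 1)).prod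
    (isCompact_uIcc (a := 0) (b := t))).exists_bound_of_continuousOn hc.continuousOn
  refine (intervalIntegral.hasDerivAt_integral_of_dominated_loc_of_deriv_le
    (F := fun x s => S (x + c * (t - s), s)) (F' := fun x s => S' (x + c * (t - s), s))
    (bound := fun _ => C) (Icc_mem_nhds (by linarith : x - 1 < x) (by linarith : x < x + 1))
    ?_ ?_ ?_ ?_ ?_ ?_).2
  · exact Eventually.of_forall fun y => Continuous.aestronglyMeasurable (by fun_prop)
  · exact Continuous.intervalIntegrable (by fun_prop) _ _
  · exact Continuous.aestronglyMeasurable (by fun_prop)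
  · exact Eventually.of_forall fun s hs y hy => hC (y, s) ⟨hy, uIoc_subset_uIcc hs⟩
  · exact intervalIntegrable_const
  · exact Eventually.of_forall fun s hs y hy => (h (y + c * (t - s)) s).comp_add_const y _

theorem Transport.space_deriv [CompleteSpace E] {c : ℝ} {f f' : ℝ → E} {S S' φ P : ℝ × ℝ → E}
    (hT : Transport c f S φ) (hf : ∀ x, HasDerivAt f (f' x) x) (hS : Continuous S)
    (hS' : Continuous S') (h : ∀ x t, HasDerivAt (fun y => S (y, t)) (S' (x, t)) x)
    (hφ : ∀ x t, HasDerivAt (fun y => φ (y, t)) (P (x, t)) x) : Transport c f' S' P := by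
  intro x t
  have h1 := ((hf (x + c * t)).comp_add_const x (c * t)).add
    (hasDerivAt_integral_char (c := c) hS hS' h x t)
  refine (hφ x t).unique (h1.congr_of_eventuallyEq (Eventually.of_forall fun y => ?_))
  exact hT y t

end Transport
end BlowupCurve

namespace BlowupCurve

section Regularity

theorem exists_lipschitz_const {F G : Type*} [NormedAddCommGroup F] [NormedSpace ℝ F]
    [NormedAddCommGroup G] [NormedSpace ℝ G] {A : F → G} (hA : ContDiff ℝ 1 A) {K : Set F}
    (hK : IsCompact K) : ∃ L : ℝ, 0 ≤ L ∧ ∀ u ∈ K, ∀ v ∈ K, ‖A u - A v‖ ≤ L * ‖u - v‖ := by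
  obtain ⟨L, hL⟩ := (hA.locallyLipschitz.locallyLipschitzOn (s := K)).exists_lipschitzOnWith_of_compact hK
  exact ⟨L, L.2, fun u hu v hv => by simpa [dist_eq_norm] using hL.dist_le_mul u hu v hv⟩

theorem exists_uniform_fderiv {F G : Type*} [NormedAddCommGroup F] [NormedSpace ℝ F]
    [NormedAddCommGroup G] [NormedSpace ℝ G] {A : F → G} (hA : ContDiff ℝ 1 A) {K : Set F}
    (hK : IsCompact K) {ε : ℝ} (hε : 0 < ε) : ∃ η > 0, ∀ u ∈ K, ∀ v, ‖v - u‖ < η →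
      ‖A v - A u - fderiv ℝ A u (v - u)‖ ≤ ε * ‖v - u‖ := by
  have hc : Continuous (fderiv ℝ A) := hA.continuous_fderiv one_ne_zero
  have h1 := hK.uniformContinuousAt_of_continuousAt (fderiv ℝ A)
    (fun u _ => hc.continuousAt) (Metric.dist_mem_uniformity hε)
  obtain ⟨η, hη, h2⟩ := Metric.mem_uniformity_dist.1 h1
  refine ⟨η, hη, fun u hu v hv => ?_⟩
  refine (convex_ball u η).norm_image_sub_le_of_norm_fderiv_le' (f := A) (φ := fderiv ℝ A u)
    (fun w _ => (hA.differentiable one_ne_zero) w) (fun w hw => ?_) (Metric.mem_ball_self hη)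
    (by simpa [dist_eq_norm] using hv)
  have h3 : dist (fderiv ℝ A u) (fderiv ℝ A w) < ε := h2 (by simpa [dist_comm] using hw) hu
  rw [← dist_eq_norm, dist_comm]; exact h3.le

theorem norm_triple_le {E : Type*} [NormedAddCommGroup E] (a b : E) : ‖((0 : ℝ), a, b)‖ ≤ ‖a‖ + ‖b‖ := by
  have h1 := norm_nonneg a
  have h2 := norm_nonneg b
  simp only [Prod.norm_def, norm_zero]
  exact max_le (by positivity) (max_le (by linarith) (by linarith))

variable {E : Type*} [NormedAddCommGroup E] [NormedSpace ℝ E]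

/-- Difference quotient in the space variable. -/
noncomputable def diffQuot (h : ℝ) (φ : ℝ × ℝ → E) (z : ℝ × ℝ) : E := h⁻¹ • (φ (z.1 + h, z.2) - φ z)

theorem Transport.diffQuot {c : ℝ} {f : ℝ → E} {S φ : ℝ × ℝ → E} (hT : Transport c f S φ)
    (hS : Continuous S) (h : ℝ) : Transport c (fun y => h⁻¹ • (f (y + h) - f y))
      (diffQuot h S) (BlowupCurve.diffQuot h φ) :=
  ((hT.shift h).sub hT (by fun_prop) hS).smul h⁻¹

theorem continuous_diffQuot {φ : ℝ × ℝ → E} (hφ : Continuous φ) (h : ℝ) :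
    Continuous (diffQuot h φ) := by
  unfold diffQuot; fun_prop

/-- Mild solutions of a semilinear system with the two characteristic speeds `∓1`. -/
structure IsMild (A B : ℝ × E × E → E) (f g : ℝ → E) (φ ψ : ℝ × ℝ → E) : Prop where
  cont_left : Continuous φ
  cont_right : Continuous ψ
  left : Transport 1 f (fun z => A (z.2, φ z, ψ z)) φ
  right : Transport (-1) g (fun z => B (z.2, φ z, ψ z)) ψ

variable {A B : ℝ × E × E → E} {f g : ℝ → E} {φ ψ : ℝ × ℝ → E}

theorem shift_mem_doubleCone {x₀ r h : ℝ} (hh : |h| ≤ 1) {z : ℝ × ℝ} (hz : z ∈ doubleCone x₀ r) :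
    (z.1 + h, z.2) ∈ doubleCone x₀ (r + 1) := by
  have h1 : |z.1 - x₀| + |z.2| ≤ r := hz
  have h2 : |z.1 + h - x₀| ≤ |z.1 - x₀| + |h| := by
    rw [add_sub_right_comm]; exact abs_add_le _ _
  change |z.1 + h - x₀| + |z.2| ≤ r + 1
  linarith

theorem doubleCone_mono (x₀ : ℝ) {r r' : ℝ} (h : r ≤ r') : doubleCone x₀ r ⊆ doubleCone x₀ r' :=
  fun _ hz => le_trans hz h

theorem IsMild.exists_shift_bound (hA : ContDiff ℝ 1 A) (hB : ContDiff ℝ 1 B)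
    (hf : ContDiff ℝ 1 f) (hg : ContDiff ℝ 1 g) (h : IsMild A B f g φ ψ) (x₀ r : ℝ) :
    ∃ C : ℝ, 0 ≤ C ∧ ∀ k : ℝ, |k| ≤ 1 → ∀ z ∈ doubleCone x₀ r,
      ‖φ (z.1 + k, z.2) - φ z‖ ≤ C * |k| ∧ ‖ψ (z.1 + k, z.2) - ψ z‖ ≤ C * |k| := by
  have hφ := h.cont_left
  have hψ := h.cont_right
  have hU : Continuous fun z : ℝ × ℝ => (z.2, φ z, ψ z) := by fun_prop
  have hK := (isCompact_doubleCone x₀ (r + 1)).image hU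
  obtain ⟨LA, hLA0, hLA⟩ := exists_lipschitz_const hA hK
  obtain ⟨LB, hLB0, hLB⟩ := exists_lipschitz_const hB hK
  have hKf := isCompact_Icc (a := x₀ - r - 1) (b := x₀ + r + 1)
  obtain ⟨Lf, hLf0, hLf⟩ := exists_lipschitz_const hf hKf
  obtain ⟨Lg, hLg0, hLg⟩ := exists_lipschitz_const hg hKf
  have hcA : Continuous fun z : ℝ × ℝ => A (z.2, φ z, ψ z) := hA.continuous.comp hU
  have hcB : Continuous fun z : ℝ × ℝ => B (z.2, φ z, ψ z) := hB.continuous.comp hU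
  refine ⟨4 * Real.exp ((4 * (LA + LB) + 4) * r) * (Lf + Lg), by positivity, ?_⟩
  intro k hk z hz
  have hdata : ∀ (f : ℝ → E) (L : ℝ), L ≤ Lf + Lg → (∀ u ∈ Icc (x₀ - r - 1) (x₀ + r + 1),
      ∀ v ∈ Icc (x₀ - r - 1) (x₀ + r + 1), ‖f u - f v‖ ≤ L * ‖u - v‖) →
      ∀ y, |y - x₀| ≤ r → ‖f (y + k) - f y‖ ≤ (Lf + Lg) * |k| := by
    intro f L hL hf y hy
    have h1 := abs_le.1 hy
    have h2 := abs_le.1 hk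
    refine (hf (y + k) ⟨by linarith, by linarith⟩ y ⟨by linarith, by linarith⟩).trans ?_
    rw [add_sub_cancel_left, Real.norm_eq_abs]
    gcongr
  have hsrc : ∀ (A : ℝ × E × E → E) (L : ℝ), 0 ≤ L → L ≤ LA + LB →
      (∀ u ∈ (fun z : ℝ × ℝ => (z.2, φ z, ψ z)) '' doubleCone x₀ (r + 1),
        ∀ v ∈ (fun z : ℝ × ℝ => (z.2, φ z, ψ z)) '' doubleCone x₀ (r + 1),
        ‖A u - A v‖ ≤ L * ‖u - v‖) → ∀ z ∈ doubleCone x₀ r,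
      ‖A (z.2, φ (z.1 + k, z.2), ψ (z.1 + k, z.2)) - A (z.2, φ z, ψ z)‖ ≤
        (LA + LB) * (‖φ (z.1 + k, z.2) - φ z‖ + ‖ψ (z.1 + k, z.2) - ψ z‖) + (Lf + Lg) * |k| := by
    intro A L hL0 hL hA z hz
    have h1 := hA (z.2, φ (z.1 + k, z.2), ψ (z.1 + k, z.2)) ⟨_, shift_mem_doubleCone hk hz, rfl⟩
      (z.2, φ z, ψ z) ⟨_, doubleCone_mono x₀ (by linarith) hz, rfl⟩
    refine h1.trans ?_
    simp only [Prod.mk_sub_mk, sub_self]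
    have h2 := norm_triple_le (φ (z.1 + k, z.2) - φ z) (ψ (z.1 + k, z.2) - ψ z)
    have h3 : 0 ≤ (Lf + Lg) * |k| := by positivity
    refine le_trans (b := (LA + LB) * (‖φ (z.1 + k, z.2) - φ z‖ + ‖ψ (z.1 + k, z.2) - ψ z‖))
      ?_ (by linarith)
    gcongr
  have := transport_gronwall (x₀ := x₀) (r := r) (L := LA + LB) (c := (Lf + Lg) * |k|)
    (φ := fun z => φ (z.1 + k, z.2) - φ z) (ψ := fun z => ψ (z.1 + k, z.2) - ψ z)
    (by fun_prop) (by fun_prop) ((h.left.shift k).sub h.left (by fun_prop) hcA)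
    ((h.right.shift k).sub h.right (by fun_prop) hcB) (by positivity) (by positivity)
    (hdata f Lf (by linarith) hLf) (hdata g Lg (by linarith) hLg)
    (hsrc A LA hLA0 (by linarith) hLA) (hsrc B LB hLB0 (by linarith) hLB) hz
  simpa only [mul_assoc] using this

theorem IsMild.diffQuot_cauchy (hA : ContDiff ℝ 1 A) (hB : ContDiff ℝ 1 B)
    (hf : ContDiff ℝ 1 f) (hg : ContDiff ℝ 1 g) (h : IsMild A B f g φ ψ) (x₀ r : ℝ) {ε : ℝ}
    (hε : 0 < ε) : ∃ η > 0, ∀ k l : ℝ, k ≠ 0 → l ≠ 0 → |k| < η → |l| < η →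
      ∀ z ∈ doubleCone x₀ r, ‖diffQuot k φ z - diffQuot l φ z‖ ≤ ε ∧
        ‖diffQuot k ψ z - diffQuot l ψ z‖ ≤ ε := by
  have hφ := h.cont_left
  have hψ := h.cont_right
  have hU : Continuous fun z : ℝ × ℝ => (z.2, φ z, ψ z) := by fun_prop
  have hcA : Continuous fun z : ℝ × ℝ => A (z.2, φ z, ψ z) := hA.continuous.comp hU
  have hcB : Continuous fun z : ℝ × ℝ => B (z.2, φ z, ψ z) := hB.continuous.comp hU
  have hK := (isCompact_doubleCone x₀ r).image hU
  have hKf := isCompact_Icc (a := x₀ - r) (b := x₀ + r)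
  obtain ⟨C, hC0, hC⟩ := h.exists_shift_bound hA hB hf hg x₀ r
  have hbound : ∀ A : ℝ × E × E → E, ContDiff ℝ 1 A → ∃ L : ℝ, 0 ≤ L ∧ ∀ z ∈ doubleCone x₀ r,
      ‖fderiv ℝ A (z.2, φ z, ψ z)‖ ≤ L := by
    intro A hA
    obtain ⟨L, hL⟩ := hK.exists_bound_of_continuousOn
      (hA.continuous_fderiv one_ne_zero).continuousOn
    exact ⟨max L 0, le_max_right _ _, fun z hz => (hL _ ⟨z, hz, rfl⟩).trans (le_max_left _ _)⟩
  obtain ⟨LA, hLA0, hLA⟩ := hbound A hA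
  obtain ⟨LB, hLB0, hLB⟩ := hbound B hB
  set M := 4 * Real.exp ((4 * (LA + LB) + 4) * r) with hM
  have hM0 : 0 < M := by positivity
  obtain ⟨e, he0, heε⟩ : ∃ e > 0, M * (2 * e * (1 + 2 * C)) ≤ ε :=
    ⟨ε / (M * (2 * (1 + 2 * C))), by positivity, le_of_eq (by field_simp)⟩
  obtain ⟨η₁, hη₁, hdA⟩ := exists_uniform_fderiv hA hK he0
  obtain ⟨η₂, hη₂, hdB⟩ := exists_uniform_fderiv hB hK he0
  obtain ⟨η₃, hη₃, hdf⟩ := exists_uniform_fderiv hf hKf he0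
  obtain ⟨η₄, hη₄, hdg⟩ := exists_uniform_fderiv hg hKf he0
  have hdata : ∀ (f : ℝ → E) (η : ℝ), (∀ u ∈ Icc (x₀ - r) (x₀ + r), ∀ v, ‖v - u‖ < η →
      ‖f v - f u - fderiv ℝ f u (v - u)‖ ≤ e * ‖v - u‖) → ∀ k : ℝ, k ≠ 0 → |k| < η →
      ∀ y, |y - x₀| ≤ r → ‖k⁻¹ • (f (y + k) - f y) - fderiv ℝ f y 1‖ ≤ e := by
    intro f η hf k hk0 hk y hy
    have h1 := abs_le.1 hy
    have h2 := hf y ⟨by linarith, by linarith⟩ (y + k) (by simpa using hk)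
    rw [add_sub_cancel_left, Real.norm_eq_abs] at h2
    have h3 : k⁻¹ • (f (y + k) - f y) - fderiv ℝ f y 1 =
        k⁻¹ • (f (y + k) - f y - fderiv ℝ f y k) := by
      rw [smul_sub _ (f (y + k) - f y), ← map_smul, smul_eq_mul, inv_mul_cancel₀ hk0]
    rw [h3, norm_smul, norm_inv, Real.norm_eq_abs, inv_mul_le_iff₀ (abs_pos.2 hk0), mul_comm]
    exact h2
  have hsrc : ∀ (A : ℝ × E × E → E) (η : ℝ),
      (∀ u ∈ (fun z : ℝ × ℝ => (z.2, φ z, ψ z)) '' doubleCone x₀ r, ∀ v, ‖v - u‖ < η →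
      ‖A v - A u - fderiv ℝ A u (v - u)‖ ≤ e * ‖v - u‖) → ∀ k : ℝ, k ≠ 0 → |k| ≤ 1 →
      2 * C * |k| < η → ∀ z ∈ doubleCone x₀ r, ‖diffQuot k (fun z => A (z.2, φ z, ψ z)) z -
        fderiv ℝ A (z.2, φ z, ψ z) (0, diffQuot k φ z, diffQuot k ψ z)‖ ≤ e * (2 * C) := by
    intro A η hA k hk0 hk1 hk z hz
    have h1 := norm_triple_le (φ (z.1 + k, z.2) - φ z) (ψ (z.1 + k, z.2) - ψ z)
    have h2 := hC k hk1 z hz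
    have h4 : ‖((0 : ℝ), φ (z.1 + k, z.2) - φ z, ψ (z.1 + k, z.2) - ψ z)‖ ≤ 2 * C * |k| := by
      linarith [h2.1, h2.2]
    have h3 := hA (z.2, φ z, ψ z) ⟨z, hz, rfl⟩ (z.2, φ (z.1 + k, z.2), ψ (z.1 + k, z.2))
    simp only [Prod.mk_sub_mk, sub_self] at h3
    have h5 := h3 (by linarith)
    have h6 : diffQuot k (fun z => A (z.2, φ z, ψ z)) z -
        fderiv ℝ A (z.2, φ z, ψ z) (0, diffQuot k φ z, diffQuot k ψ z) =
        k⁻¹ • (A (z.2, φ (z.1 + k, z.2), ψ (z.1 + k, z.2)) - A (z.2, φ z, ψ z) -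
          fderiv ℝ A (z.2, φ z, ψ z) (0, φ (z.1 + k, z.2) - φ z, ψ (z.1 + k, z.2) - ψ z)) := by
      rw [smul_sub k⁻¹ (_ - _), ← map_smul]
      simp [diffQuot]
    rw [h6, norm_smul, norm_inv, Real.norm_eq_abs, inv_mul_le_iff₀ (abs_pos.2 hk0)]
    refine h5.trans ?_
    calc _ ≤ e * (2 * C * |k|) := by gcongr
      _ = _ := by ring
  refine ⟨min 1 (min (min η₁ η₂ / (2 * C + 1)) (min η₃ η₄)), by positivity, ?_⟩
  intro k l hk0 hl0 hk hl z hz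
  simp only [lt_min_iff] at hk hl
  have hsmall : ∀ k : ℝ, |k| < min η₁ η₂ / (2 * C + 1) → 2 * C * |k| < η₁ ∧ 2 * C * |k| < η₂ := by
    intro k hk
    rw [lt_div_iff₀ (by positivity)] at hk
    have := abs_nonneg k
    exact ⟨by nlinarith [min_le_left η₁ η₂], by nlinarith [min_le_right η₁ η₂]⟩
  have hD : ∀ (f : ℝ → E) (η : ℝ), |k| < η → |l| < η → (∀ k : ℝ, k ≠ 0 → |k| < η →
      ∀ y, |y - x₀| ≤ r → ‖k⁻¹ • (f (y + k) - f y) - fderiv ℝ f y 1‖ ≤ e) →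
      ∀ y, |y - x₀| ≤ r → ‖k⁻¹ • (f (y + k) - f y) - l⁻¹ • (f (y + l) - f y)‖ ≤
        2 * e * (1 + 2 * C) := by
    intro f η hk hl hf y hy
    have h1 := norm_sub_le_of_le (hf k hk0 hk y hy) (hf l hl0 hl y hy)
    rw [sub_sub_sub_cancel_right] at h1
    nlinarith [mul_nonneg he0.le hC0]
  have hE : ∀ (A : ℝ × E × E → E) (L : ℝ), L ≤ LA + LB → (∀ z ∈ doubleCone x₀ r,
      ‖fderiv ℝ A (z.2, φ z, ψ z)‖ ≤ L) →
      (∀ k' : ℝ, k' = k ∨ k' = l → ∀ z ∈ doubleCone x₀ r,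
        ‖diffQuot k' (fun z => A (z.2, φ z, ψ z)) z -
        fderiv ℝ A (z.2, φ z, ψ z) (0, diffQuot k' φ z, diffQuot k' ψ z)‖ ≤ e * (2 * C)) →
      ∀ z ∈ doubleCone x₀ r, ‖(diffQuot k (fun z => A (z.2, φ z, ψ z)) -
        diffQuot l (fun z => A (z.2, φ z, ψ z))) z‖ ≤
        (LA + LB) * (‖(diffQuot k φ - diffQuot l φ) z‖ + ‖(diffQuot k ψ - diffQuot l ψ) z‖) +
          2 * e * (1 + 2 * C) := by
    intro A L hL hLA hq z hz
    have h1 := norm_sub_le_of_le (hq k (Or.inl rfl) z hz) (hq l (Or.inr rfl) z hz)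
    rw [sub_sub_sub_comm, ← map_sub] at h1
    simp only [Prod.mk_sub_mk, sub_self] at h1
    have h2 := (fderiv ℝ A (z.2, φ z, ψ z)).le_opNorm
      (0, diffQuot k φ z - diffQuot l φ z, diffQuot k ψ z - diffQuot l ψ z)
    have h3 := norm_triple_le (diffQuot k φ z - diffQuot l φ z) (diffQuot k ψ z - diffQuot l ψ z)
    have h4 : ‖fderiv ℝ A (z.2, φ z, ψ z)‖ * ‖((0 : ℝ), diffQuot k φ z - diffQuot l φ z,
        diffQuot k ψ z - diffQuot l ψ z)‖ ≤ (LA + LB) *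
        (‖diffQuot k φ z - diffQuot l φ z‖ + ‖diffQuot k ψ z - diffQuot l ψ z‖) := by
      have := (hLA z hz).trans hL
      gcongr
    have h5 := norm_sub_norm_le (diffQuot k (fun z => A (z.2, φ z, ψ z)) z -
        diffQuot l (fun z => A (z.2, φ z, ψ z)) z) (fderiv ℝ A (z.2, φ z, ψ z)
      (0, diffQuot k φ z - diffQuot l φ z, diffQuot k ψ z - diffQuot l ψ z))
    simp only [Pi.sub_apply]
    nlinarith
  have hqA : ∀ k' : ℝ, k' = k ∨ k' = l → ∀ z ∈ doubleCone x₀ r,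
      ‖diffQuot k' (fun z => A (z.2, φ z, ψ z)) z -
      fderiv ℝ A (z.2, φ z, ψ z) (0, diffQuot k' φ z, diffQuot k' ψ z)‖ ≤ e * (2 * C) := by
    rintro k' (rfl | rfl)
    · exact hsrc A η₁ hdA k' hk0 hk.1.le (hsmall k' hk.2.1).1
    · exact hsrc A η₁ hdA k' hl0 hl.1.le (hsmall k' hl.2.1).1
  have hqB : ∀ k' : ℝ, k' = k ∨ k' = l → ∀ z ∈ doubleCone x₀ r,
      ‖diffQuot k' (fun z => B (z.2, φ z, ψ z)) z -
      fderiv ℝ B (z.2, φ z, ψ z) (0, diffQuot k' φ z, diffQuot k' ψ z)‖ ≤ e * (2 * C) := by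
    rintro k' (rfl | rfl)
    · exact hsrc B η₂ hdB k' hk0 hk.1.le (hsmall k' hk.2.1).2
    · exact hsrc B η₂ hdB k' hl0 hl.1.le (hsmall k' hl.2.1).2
  have := transport_gronwall (x₀ := x₀) (r := r) (L := LA + LB) (c := 2 * e * (1 + 2 * C))
    ((continuous_diffQuot hφ k).sub (continuous_diffQuot hφ l))
    ((continuous_diffQuot hψ k).sub (continuous_diffQuot hψ l))
    ((h.left.diffQuot hcA k).sub (h.left.diffQuot hcA l) (continuous_diffQuot hcA k)
      (continuous_diffQuot hcA l))
    ((h.right.diffQuot hcB k).sub (h.right.diffQuot hcB l) (continuous_diffQuot hcB k)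
      (continuous_diffQuot hcB l)) (by positivity) (by positivity)
    (hD f η₃ hk.2.2.1 hl.2.2.1 (hdata f η₃ hdf)) (hD g η₄ hk.2.2.2 hl.2.2.2 (hdata g η₄ hdg))
    (hE A LA (by linarith) hLA hqA) (hE B LB (by linarith) hLB hqB) hz
  exact ⟨this.1.trans heε, this.2.trans heε⟩

/-- If the difference quotients are locally uniformly Cauchy then the space derivative exists
and is continuous. -/
theorem exists_space_deriv [CompleteSpace E] {φ : ℝ × ℝ → E} (hφ : Continuous φ)
    (h : ∀ x₀ r ε : ℝ, 0 < ε → ∃ η > 0, ∀ k l : ℝ, k ≠ 0 → l ≠ 0 → |k| < η → |l| < η →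
      ∀ z ∈ doubleCone x₀ r, ‖diffQuot k φ z - diffQuot l φ z‖ ≤ ε) :
    ∃ P : ℝ × ℝ → E, Continuous P ∧ ∀ x t, HasDerivAt (fun y => φ (y, t)) (P (x, t)) x := by
  have hnhds : ∀ η > (0 : ℝ), {k : ℝ | k ≠ 0 ∧ |k| < η} ∈ 𝓝[≠] (0 : ℝ) := by
    intro η hη
    refine mem_nhdsWithin.2 ⟨Metric.ball 0 η, Metric.isOpen_ball, Metric.mem_ball_self hη, ?_⟩
    rintro k ⟨h1, h2⟩
    exact ⟨h2, by simpa using h1⟩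
  have hlim : ∀ z, ∃ p, Tendsto (fun k => diffQuot k φ z) (𝓝[≠] 0) (𝓝 p) := by
    intro z
    refine cauchy_map_iff_exists_tendsto.1 (Metric.cauchy_iff.2 ⟨inferInstance, fun ε hε => ?_⟩)
    obtain ⟨η, hη, hc⟩ := h z.1 |z.2| (ε / 2) (by positivity)
    refine ⟨(fun k => diffQuot k φ z) '' {k : ℝ | k ≠ 0 ∧ |k| < η},
      image_mem_map (hnhds η hη), ?_⟩
    rintro _ ⟨k, ⟨hk0, hk⟩, rfl⟩ _ ⟨l, ⟨hl0, hl⟩, rfl⟩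
    rw [dist_eq_norm]
    have := hc k l hk0 hl0 hk hl z (by simp [doubleCone])
    linarith
  choose P hP using hlim
  refine ⟨P, ?_, fun x t => hasDerivAt_iff_tendsto_slope_zero.2 (hP (x, t))⟩
  refine continuous_of_locally_uniform_approx_of_continuousAt fun z u hu => ?_
  obtain ⟨ε, hε, hεu⟩ := Metric.mem_uniformity_dist.1 hu
  obtain ⟨η, hη, hc⟩ := h z.1 (|z.2| + 1) (ε / 2) (by positivity)
  refine ⟨doubleCone z.1 (|z.2| + 1), ?_, diffQuot (η / 2) φ,
    (continuous_diffQuot hφ _).continuousAt, ?_⟩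
  · have : IsOpen {y : ℝ × ℝ | |y.1 - z.1| + |y.2| < |z.2| + 1} :=
      isOpen_lt (by fun_prop) continuous_const
    exact mem_of_superset (this.mem_nhds (by simp)) fun y (hy : |y.1 - z.1| + |y.2| < |z.2| + 1) =>
      show |y.1 - z.1| + |y.2| ≤ |z.2| + 1 from hy.le
  · intro y hy
    apply hεu
    rw [dist_eq_norm]
    have h1 : Tendsto (fun k => ‖diffQuot k φ y - diffQuot (η / 2) φ y‖) (𝓝[≠] 0)
        (𝓝 ‖P y - diffQuot (η / 2) φ y‖) := ((hP y).sub_const _).norm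
    have h2 : ‖P y - diffQuot (η / 2) φ y‖ ≤ ε / 2 := by
      refine le_of_tendsto h1 ?_
      filter_upwards [hnhds η hη] with k hk
      exact hc k (η / 2) hk.1 (by positivity) hk.2 (by rw [abs_of_pos] <;> linarith) y hy
    linarith

end Regularity
end BlowupCurve

namespace BlowupCurve

section HigherRegularity

universe u

theorem Transport.prodMk {E F : Type*} [NormedAddCommGroup E] [NormedSpace ℝ E]
    [NormedAddCommGroup F] [NormedSpace ℝ F] [CompleteSpace E] [CompleteSpace F] {c : ℝ}
    {f : ℝ → E} {S φ : ℝ × ℝ → E} {g : ℝ → F} {R ψ : ℝ × ℝ → F} (h1 : Transport c f S φ)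
    (h2 : Transport c g R ψ) (hS : Continuous S) (hR : Continuous R) :
    Transport c (fun y => (f y, g y)) (fun z => (S z, R z)) (fun z => (φ z, ψ z)) := by
  intro x t
  have hi : IntervalIntegrable
      (fun s => (S (x + c * (t - s), s), R (x + c * (t - s), s))) MeasureTheory.volume 0 t :=
    Continuous.intervalIntegrable (by fun_prop) _ _
  have h3 := (ContinuousLinearMap.fst ℝ E F).intervalIntegral_comp_comm hi
  have h4 := (ContinuousLinearMap.snd ℝ E F).intervalIntegral_comp_comm hi
  simp only [ContinuousLinearMap.coe_fst', ContinuousLinearMap.coe_snd'] at h3 h4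
  refine Prod.ext ?_ ?_
  · simp only [Prod.fst_add, ← h3]; exact h1 x t
  · simp only [Prod.snd_add, ← h4]; exact h2 x t

/-- The source of the system satisfied by a solution together with its space derivative. -/
noncomputable def extendedSource {E : Type u} [NormedAddCommGroup E] [NormedSpace ℝ E]
    (A : ℝ × E × E → E) (w : ℝ × (E × E) × (E × E)) : E × E :=
  (A (w.1, w.2.1.1, w.2.2.1), fderiv ℝ A (w.1, w.2.1.1, w.2.2.1) (0, w.2.1.2, w.2.2.2))

theorem contDiff_extendedSource {E : Type u} [NormedAddCommGroup E] [NormedSpace ℝ E] {k : ℕ}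
    {A : ℝ × E × E → E} (hA : ContDiff ℝ (k + 1) A) : ContDiff ℝ k (extendedSource A) := by
  have h1 : ContDiff ℝ k A := hA.of_le (by exact_mod_cast Nat.le_succ k)
  have h2 : ContDiff ℝ k (fderiv ℝ A) := hA.fderiv_right le_rfl
  unfold extendedSource
  have h3 : ContDiff ℝ k fun w : ℝ × (E × E) × (E × E) => (w.1, w.2.1.1, w.2.2.1) := by fun_prop
  have h4 : ContDiff ℝ k fun w : ℝ × (E × E) × (E × E) => ((0 : ℝ), w.2.1.2, w.2.2.2) := by
    fun_prop
  exact (h1.comp h3).prodMk ((h2.comp h3).clm_apply h4)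

theorem Transport.contDiff_succ {E : Type u} [NormedAddCommGroup E] [NormedSpace ℝ E]
    [CompleteSpace E] {c : ℝ} {f : ℝ → E} {S φ P : ℝ × ℝ → E} {k : ℕ} (h : Transport c f S φ)
    (hS : ContDiff ℝ k S) (hP : ContDiff ℝ k P)
    (hφ : ∀ x t, HasDerivAt (fun y => φ (y, t)) (P (x, t)) x) : ContDiff ℝ (k + 1) φ := by
  refine contDiff_succ_iff_hasFDerivAt.2 ⟨_, ?_, h.hasFDerivAt hS.continuous hP.continuous hφ⟩
  exact (contDiff_const.smulRight hP).add (contDiff_const.smulRight hS)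

/-- Regularity of mild solutions. -/
theorem IsMild.contDiff (k : ℕ) : ∀ {E : Type u} [NormedAddCommGroup E] [NormedSpace ℝ E]
    [CompleteSpace E] {A B : ℝ × E × E → E} {f g : ℝ → E} {φ ψ : ℝ × ℝ → E},
    ContDiff ℝ k A → ContDiff ℝ k B → ContDiff ℝ k f → ContDiff ℝ k g → IsMild A B f g φ ψ →
    ContDiff ℝ k φ ∧ ContDiff ℝ k ψ := by
  induction k with
  | zero =>
    intro E _ _ _ A B f g φ ψ _ _ _ _ h
    exact ⟨contDiff_zero.2 h.cont_left, contDiff_zero.2 h.cont_right⟩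
  | succ k ih =>
    intro E _ _ _ A B f g φ ψ hA hB hf hg h
    push_cast at hA hB hf hg ⊢
    have h1k : (1 : WithTop ℕ∞) ≤ k + 1 := by exact_mod_cast Nat.le_add_left 1 k
    have hk1 : (k : WithTop ℕ∞) ≤ k + 1 := by exact_mod_cast Nat.le_succ k
    have hA1 := hA.of_le h1k
    have hB1 := hB.of_le h1k
    have hf1 := hf.of_le h1k
    have hg1 := hg.of_le h1k
    have hφ := h.cont_left
    have hψ := h.cont_right
    have hU : Continuous fun z : ℝ × ℝ => (z.2, φ z, ψ z) := by fun_prop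
    obtain ⟨P, hP, hφP⟩ := exists_space_deriv hφ fun x₀ r ε hε => by
      obtain ⟨η, hη, H⟩ := h.diffQuot_cauchy hA1 hB1 hf1 hg1 x₀ r hε
      exact ⟨η, hη, fun k l a b c d z hz => (H k l a b c d z hz).1⟩
    obtain ⟨Q, hQ, hψQ⟩ := exists_space_deriv hψ fun x₀ r ε hε => by
      obtain ⟨η, hη, H⟩ := h.diffQuot_cauchy hA1 hB1 hf1 hg1 x₀ r hε
      exact ⟨η, hη, fun k l a b c d z hz => (H k l a b c d z hz).2⟩
    have hsrc : ∀ A : ℝ × E × E → E, ContDiff ℝ 1 A →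
        (Continuous fun z : ℝ × ℝ => fderiv ℝ A (z.2, φ z, ψ z) (0, P z, Q z)) ∧
        ∀ x t, HasDerivAt (fun y => A (t, φ (y, t), ψ (y, t)))
          (fderiv ℝ A (t, φ (x, t), ψ (x, t)) (0, P (x, t), Q (x, t))) x := by
      intro A hA
      refine ⟨((hA.continuous_fderiv one_ne_zero).comp hU).clm_apply (by fun_prop), ?_⟩
      intro x t
      exact ((hA.differentiable one_ne_zero) _).hasFDerivAt.comp_hasDerivAt x
        ((hasDerivAt_const x t).prodMk ((hφP x t).prodMk (hψQ x t)))
    have hcA : Continuous fun z : ℝ × ℝ => A (z.2, φ z, ψ z) := hA.continuous.comp hU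
    have hcB : Continuous fun z : ℝ × ℝ => B (z.2, φ z, ψ z) := hB.continuous.comp hU
    have hd : ∀ f : ℝ → E, ContDiff ℝ 1 f → ∀ x, HasDerivAt f (deriv f x) x :=
      fun f hf x => ((hf.differentiable one_ne_zero) x).hasDerivAt
    have hPT := h.left.space_deriv (hd f hf1) hcA (hsrc A hA1).1 (hsrc A hA1).2 hφP
    have hQT := h.right.space_deriv (hd g hg1) hcB (hsrc B hB1).1 (hsrc B hB1).2 hψQ
    have hext : IsMild (extendedSource A) (extendedSource B) (fun y => (f y, deriv f y))
        (fun y => (g y, deriv g y)) (fun z => (φ z, P z)) (fun z => (ψ z, Q z)) :=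
      ⟨by fun_prop, by fun_prop, h.left.prodMk hPT hcA (hsrc A hA1).1,
        h.right.prodMk hQT hcB (hsrc B hB1).1⟩
    have hdf : ∀ f : ℝ → E, ContDiff ℝ (k + 1) f → ContDiff ℝ k fun y => (f y, deriv f y) :=
      fun f hf => (hf.of_le hk1).prodMk (contDiff_succ_iff_deriv.1 hf).2.2
    obtain ⟨h1, h2⟩ := ih (contDiff_extendedSource hA) (contDiff_extendedSource hB) (hdf f hf)
      (hdf g hg) hext
    have hUk : ContDiff ℝ k fun z : ℝ × ℝ => (z.2, φ z, ψ z) :=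
      contDiff_snd.prodMk (h1.fst.prodMk h2.fst)
    exact ⟨h.left.contDiff_succ ((hA.of_le hk1).comp hUk) h1.snd hφP,
      h.right.contDiff_succ ((hB.of_le hk1).comp hUk) h2.snd hψQ⟩

end HigherRegularity
end BlowupCurve

namespace BlowupCurve

section Existence

open BoundedContinuousFunction

theorem exp_neg_mul_norm_integral_le {K C t : ℝ} (hK : 0 < K) (hC : 0 ≤ C) {g : ℝ → ℝ}
    (hg : ∀ s ∈ uIcc 0 t, ‖g s‖ ≤ C * Real.exp (K * |s|)) :
    Real.exp (-(K * |t|)) * ‖∫ s in (0 : ℝ)..t, g s‖ ≤ C / K := by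
  have h := mul_le_mul_of_nonneg_left (norm_integral_le_exp hK hC hg)
    (Real.exp_pos (-(K * |t|))).le
  refine h.trans (le_of_eq ?_)
  rw [mul_div_assoc', mul_left_comm, ← Real.exp_add, neg_add_cancel, Real.exp_zero, mul_one]

/-- One component of the Picard operator, in exponentially weighted form. -/
noncomputable def picardComponent (K c : ℝ) (f : ℝ → ℝ) (G : ℝ × ℝ → ℝ) (U : ℝ × ℝ → ℝ × ℝ)
    (z : ℝ × ℝ) : ℝ :=
  Real.exp (-(K * |z.2|)) * (f (z.1 + c * z.2) + ∫ s in (0 : ℝ)..z.2,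
    G (s, Real.exp (K * |s|) * ((U (z.1 + c * (z.2 - s), s)).1 +
      (U (z.1 + c * (z.2 - s), s)).2)))

theorem continuous_picardComponent {K c : ℝ} {f : ℝ → ℝ} {G : ℝ × ℝ → ℝ} {U : ℝ × ℝ → ℝ × ℝ}
    (hf : Continuous f) (hG : Continuous G) (hU : Continuous U) :
    Continuous (picardComponent K c f G U) := by
  unfold picardComponent
  have : Continuous fun z : ℝ × ℝ => ∫ s in (0 : ℝ)..z.2,
    G (s, Real.exp (K * |s|) * ((U (z.1 + c * (z.2 - s), s)).1 +
      (U (z.1 + c * (z.2 - s), s)).2)) := by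
    refine intervalIntegral.continuous_parametric_intervalIntegral_of_continuous
      (f := fun (z : ℝ × ℝ) s => G (s, Real.exp (K * |s|) *
        ((U (z.1 + c * (z.2 - s), s)).1 + (U (z.1 + c * (z.2 - s), s)).2))) ?_ continuous_snd
    simp only [Function.uncurry_def]
    fun_prop
  fun_prop

theorem abs_picardComponent_le {K c C D : ℝ} (hK : 0 < K) {f : ℝ → ℝ} {G : ℝ × ℝ → ℝ}
    (hf : ∀ y, |f y| ≤ D) (hG : ∀ w, |G w| ≤ C) (U : ℝ × ℝ → ℝ × ℝ) (z : ℝ × ℝ) :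
    |picardComponent K c f G U z| ≤ D + C / K := by
  have hC : 0 ≤ C := (abs_nonneg _).trans (hG 0)
  have h1 : Real.exp (-(K * |z.2|)) ≤ 1 := Real.exp_le_one_iff.2 (by
    have := abs_nonneg z.2; simp only [Left.neg_nonpos_iff]; positivity)
  have h2 := exp_neg_mul_norm_integral_le (t := z.2) hK hC (g := fun s =>
    G (s, Real.exp (K * |s|) * ((U (z.1 + c * (z.2 - s), s)).1 +
      (U (z.1 + c * (z.2 - s), s)).2))) fun s _ =>
    (hG _).trans (le_mul_of_one_le_right hC (Real.one_le_exp (by positivity)))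
  unfold picardComponent
  rw [mul_add]
  refine (abs_add_le _ _).trans (add_le_add ?_ ?_)
  · rw [abs_mul, abs_of_pos (Real.exp_pos _)]
    exact (mul_le_of_le_one_left (abs_nonneg _) h1).trans (hf _)
  · rw [abs_mul, abs_of_pos (Real.exp_pos _)]
    exact h2

theorem abs_picardComponent_sub_le {K c L δ : ℝ} (hK : 0 < K) (hL : 0 ≤ L) (hδ : 0 ≤ δ)
    {f : ℝ → ℝ} {G : ℝ × ℝ → ℝ}
    (hGc : Continuous G) (hG : ∀ t w w', |G (t, w) - G (t, w')| ≤ L * |w - w'|)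
    {U V : ℝ × ℝ → ℝ × ℝ} (hU : Continuous U) (hV : Continuous V)
    (hUV : ∀ z, ‖U z - V z‖ ≤ δ) (z : ℝ × ℝ) :
    |picardComponent K c f G U z - picardComponent K c f G V z| ≤ 2 * L * δ / K := by
  unfold picardComponent
  rw [← mul_sub, add_sub_add_left_eq_sub, ← intervalIntegral.integral_sub, abs_mul,
    abs_of_pos (Real.exp_pos _)]
  · refine exp_neg_mul_norm_integral_le hK (by positivity) fun s _ => ?_
    have h1 := hUV (z.1 + c * (z.2 - s), s)
    refine (hG _ _ _).trans ?_
    rw [← mul_sub, abs_mul, abs_of_pos (Real.exp_pos _)]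
    have h2 := (norm_fst_le _).trans h1
    have h3 := (norm_snd_le _).trans h1
    rw [Real.norm_eq_abs] at h2 h3
    rw [Prod.fst_sub] at h2
    rw [Prod.snd_sub] at h3
    have h4 := abs_add_le ((U (z.1 + c * (z.2 - s), s)).1 - (V (z.1 + c * (z.2 - s), s)).1)
      ((U (z.1 + c * (z.2 - s), s)).2 - (V (z.1 + c * (z.2 - s), s)).2)
    rw [← add_sub_add_comm] at h4
    calc _ ≤ L * (Real.exp (K * |s|) * (2 * δ)) := by gcongr; linarith
      _ = _ := by ring
  · exact Continuous.intervalIntegrable (by fun_prop) _ _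
  · exact Continuous.intervalIntegrable (by fun_prop) _ _

/-- Global existence of mild solutions for a bounded and globally Lipschitz source. -/
theorem exists_isMild {f g : ℝ → ℝ} {G : ℝ × ℝ → ℝ} {C D L : ℝ} (hL : 0 ≤ L)
    (hf : Continuous f) (hg : Continuous g) (hfD : ∀ y, |f y| ≤ D) (hgD : ∀ y, |g y| ≤ D)
    (hGc : Continuous G) (hGC : ∀ w, |G w| ≤ C)
    (hGL : ∀ t w w', |G (t, w) - G (t, w')| ≤ L * |w - w'|) :
    ∃ φ ψ : ℝ × ℝ → ℝ, IsMild (fun w => G (w.1, w.2.1 + w.2.2))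
      (fun w => G (w.1, w.2.1 + w.2.2)) f g φ ψ := by
  set K := 4 * L + 1 with hKdef
  have hK : 0 < K := by positivity
  let F : (ℝ × ℝ →ᵇ ℝ × ℝ) → (ℝ × ℝ →ᵇ ℝ × ℝ) := fun U =>
    ofNormedAddCommGroup (fun z => (picardComponent K 1 f G U z, picardComponent K (-1) g G U z))
      ((continuous_picardComponent hf hGc U.continuous).prodMk
        (continuous_picardComponent hg hGc U.continuous)) (D + C / K)
      fun z => max_le (abs_picardComponent_le hK hfD hGC U z) (abs_picardComponent_le hK hgD hGC U z)
  have hF : ContractingWith (1 / 2) F := by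
    refine ⟨by norm_num, LipschitzWith.of_dist_le_mul fun U V => ?_⟩
    have hδ : ∀ z, ‖U z - V z‖ ≤ dist U V := fun z => by
      rw [← dist_eq_norm]; exact dist_coe_le_dist z
    have h1 : 2 * L * dist U V / K ≤ ((1 / 2 : NNReal) : ℝ) * dist U V := by
      rw [div_le_iff₀ hK, hKdef]
      push_cast
      nlinarith [dist_nonneg (x := U) (y := V)]
    refine (dist_le (by positivity)).2 fun z => ?_
    rw [dist_eq_norm]
    exact max_le ((abs_picardComponent_sub_le hK hL dist_nonneg hGc hGL U.continuous V.continuous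
      hδ z).trans h1) ((abs_picardComponent_sub_le hK hL dist_nonneg hGc hGL U.continuous
      V.continuous hδ z).trans h1)
  set U := ContractingWith.fixedPoint F hF
  have hU : F U = U := hF.fixedPoint_isFixedPt
  have h1 : ∀ z, picardComponent K 1 f G U z = (U z).1 := fun z =>
    congrArg Prod.fst (DFunLike.congr_fun hU z)
  have h2 : ∀ z, picardComponent K (-1) g G U z = (U z).2 := fun z =>
    congrArg Prod.snd (DFunLike.congr_fun hU z)
  have hUc := U.continuous
  refine ⟨fun z => Real.exp (K * |z.2|) * (U z).1, fun z => Real.exp (K * |z.2|) * (U z).2,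
    by fun_prop, by fun_prop, fun x t => ?_, fun x t => ?_⟩
  · simp only [← mul_add]
    rw [← h1, picardComponent, ← mul_assoc, ← Real.exp_add, add_neg_cancel, Real.exp_zero, one_mul]
  · simp only [← mul_add]
    rw [← h2, picardComponent, ← mul_assoc, ← Real.exp_add, add_neg_cancel, Real.exp_zero, one_mul]

/-- Global existence of classical solutions for a bounded and globally Lipschitz source. -/
theorem exists_classical_solution {f g : ℝ → ℝ} {G : ℝ × ℝ → ℝ} {C D L : ℝ} {k : ℕ} (hk : k ≠ 0)
    (hL : 0 ≤ L) (hf : ContDiff ℝ k f) (hg : ContDiff ℝ k g) (hfD : ∀ y, |f y| ≤ D)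
    (hgD : ∀ y, |g y| ≤ D) (hG : ContDiff ℝ k G) (hGC : ∀ w, |G w| ≤ C)
    (hGL : ∀ t w w', |G (t, w) - G (t, w')| ≤ L * |w - w'|) :
    ∃ φ ψ : ℝ × ℝ → ℝ, ContDiff ℝ k φ ∧ ContDiff ℝ k ψ ∧ (∀ x, φ (x, 0) = f x) ∧
      (∀ x, ψ (x, 0) = g x) ∧ (∀ z, Dminus φ z = G (z.2, φ z + ψ z)) ∧
      ∀ z, Dplus ψ z = G (z.2, φ z + ψ z) := by
  obtain ⟨φ, ψ, h⟩ := exists_isMild hL hf.continuous hg.continuous hfD hgD hG.continuous hGC hGL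
  have hA : ContDiff ℝ k fun w : ℝ × ℝ × ℝ => G (w.1, w.2.1 + w.2.2) := hG.comp (by fun_prop)
  obtain ⟨hφ, hψ⟩ := h.contDiff k hA hA hf hg
  have hS : Continuous fun z : ℝ × ℝ => G (z.2, φ z + ψ z) :=
    hG.continuous.comp (continuous_snd.prodMk (h.cont_left.add h.cont_right))
  have hk' : (k : WithTop ℕ∞) ≠ 0 := by exact_mod_cast hk
  have key : ∀ (c : ℝ) (φ : ℝ × ℝ → ℝ) (f : ℝ → ℝ) (S : ℝ × ℝ → ℝ), ContDiff ℝ k φ →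
      Continuous S → Transport c f S φ → ∀ z, fderiv ℝ φ z (-c, 1) = S z := by
    intro c φ f S hφ hS hT z
    have h1 := hT.hasDerivAt_char hS (z.1 + c * z.2) z.2
    have h2 : HasDerivAt (fun t => (z.1 + c * z.2 - c * t, t)) (-c, (1 : ℝ)) z.2 := by
      refine HasDerivAt.prodMk ?_ (hasDerivAt_id _)
      simpa using ((hasDerivAt_id z.2).const_mul c).const_sub (z.1 + c * z.2)
    have h3 := HasFDerivAt.comp_hasDerivAt (f := fun t => (z.1 + c * z.2 - c * t, t)) z.2
      ((hφ.differentiable hk') (z.1 + c * z.2 - c * z.2, z.2)).hasFDerivAt h2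
    have h4 := h3.unique h1
    simpa only [add_sub_cancel_right] using h4
  refine ⟨φ, ψ, hφ, hψ, fun x => ?_, fun x => ?_, fun z => ?_, fun z => ?_⟩
  · simpa using h.left x 0
  · simpa using h.right x 0
  · exact key 1 φ f _ hφ hS h.left z
  · have := key (-1) ψ g _ hψ hS h.right z
    rwa [neg_neg] at this

end Existence
end BlowupCurve

namespace BlowupCurve

section Comparison

/-- The closed backward cone with vertex `z`, including its base on the initial line. -/
def closedCone (z : ℝ × ℝ) : Set (ℝ × ℝ) := {w | 0 ≤ w.2 ∧ |w.1 - z.1| ≤ z.2 - w.2}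

theorem isCompact_closedCone (z : ℝ × ℝ) : IsCompact (closedCone z) := by
  refine (isCompact_doubleCone z.1 z.2).of_isClosed_subset ?_ ?_
  · have h1 : IsClosed {w : ℝ × ℝ | 0 ≤ w.2} := isClosed_le continuous_const continuous_snd
    have h2 : IsClosed {w : ℝ × ℝ | |w.1 - z.1| ≤ z.2 - w.2} :=
      isClosed_le (by fun_prop) (by fun_prop)
    exact h1.inter h2
  · rintro w ⟨h1, h2⟩
    change |w.1 - z.1| + |w.2| ≤ z.2
    rw [abs_of_nonneg h1]; linarith

theorem mem_closedCone_char {z w : ℝ × ℝ} (hw : w ∈ closedCone z) {c s : ℝ} (hc : |c| ≤ 1)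
    (hs : s ≤ 0) (hws : 0 ≤ w.2 + s) : (w.1 + c * s, w.2 + s) ∈ closedCone z := by
  refine ⟨hws, ?_⟩
  have h1 : |w.1 + c * s - z.1| ≤ |w.1 - z.1| + |c * s| := by
    rw [add_sub_right_comm]; exact abs_add_le _ _
  have h2 : |c * s| ≤ -s := by
    rw [abs_mul, abs_of_nonpos hs]; exact mul_le_of_le_one_left (by linarith) hc
  have := hw.2
  simp only
  linarith

theorem self_mem_closedCone {z : ℝ × ℝ} (hz : 0 ≤ z.2) : z ∈ closedCone z := ⟨hz, by simp⟩

theorem deriv_nonpos_of_le_left {h : ℝ → ℝ} {d r : ℝ} (hr : 0 < r) (hd : HasDerivAt h d 0)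
    (hmin : ∀ s ∈ Icc (-r) 0, h 0 ≤ h s) : d ≤ 0 := by
  have h1 : Tendsto (slope h 0) (𝓝[<] 0) (𝓝 d) :=
    (hasDerivWithinAt_iff_tendsto_slope' (by simp)).1 (hd.hasDerivWithinAt (s := Iio 0))
  refine le_of_tendsto h1 ?_
  filter_upwards [Ioo_mem_nhdsLT (by linarith : -r < 0)] with s hs
  rw [slope_def_field]
  exact div_nonpos_of_nonneg_of_nonpos (by linarith [hmin s ⟨hs.1.le, hs.2.le⟩])
    (by linarith [hs.2])

/-- Minimum principle in a backward cone for a weakly coupled pair of transport inequalities. -/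
theorem nonneg_of_transport_ineq {z₀ : ℝ × ℝ} {L : ℝ} {P Q : ℝ × ℝ → ℝ}
    (hP : ContinuousOn P (closedCone z₀)) (hQ : ContinuousOn Q (closedCone z₀))
    (hP0 : ∀ z ∈ closedCone z₀, z.2 = 0 → 0 ≤ P z) (hQ0 : ∀ z ∈ closedCone z₀, z.2 = 0 → 0 ≤ Q z)
    (hPd : ∀ z ∈ closedCone z₀, 0 < z.2 → P z < 0 → P z ≤ Q z →
      ∃ d, HasDerivAt (fun s => P (z.1 - s, z.2 + s)) d 0 ∧ L * P z ≤ d)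
    (hQd : ∀ z ∈ closedCone z₀, 0 < z.2 → Q z < 0 → Q z ≤ P z →
      ∃ d, HasDerivAt (fun s => Q (z.1 + s, z.2 + s)) d 0 ∧ L * Q z ≤ d)
    {z : ℝ × ℝ} (hz : z ∈ closedCone z₀) : 0 ≤ P z ∧ 0 ≤ Q z := by
  obtain ⟨w, hw, hmin⟩ := (isCompact_closedCone z₀).exists_isMinOn ⟨z, hz⟩
    (f := fun z => Real.exp (-((L + 1) * z.2)) * min (P z) (Q z))
    ((Continuous.continuousOn (by fun_prop)).mul (ContinuousOn.inf hP hQ))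
  have hmin' : ∀ v ∈ closedCone z₀, Real.exp (-((L + 1) * w.2)) * min (P w) (Q w) ≤
      Real.exp (-((L + 1) * v.2)) * min (P v) (Q v) := fun v hv => hmin hv
  by_cases hneg : 0 ≤ min (P w) (Q w)
  · have h1 := (mul_nonneg (Real.exp_pos _).le hneg).trans (hmin' z hz)
    have h2 := nonneg_of_mul_nonneg_right h1 (Real.exp_pos _)
    exact ⟨h2.trans (min_le_left _ _), h2.trans (min_le_right _ _)⟩
  exfalso
  push Not at hneg
  have hw0 : 0 < w.2 := by
    refine lt_of_le_of_ne hw.1 fun h => ?_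
    exact absurd (le_min (hP0 w hw h.symm) (hQ0 w hw h.symm)) (not_le.2 hneg)
  have key : ∀ (c : ℝ) (R : ℝ × ℝ → ℝ), |c| ≤ 1 → R w = min (P w) (Q w) →
      (∀ v, min (P v) (Q v) ≤ R v) → R w < 0 →
      ¬ ∃ d, HasDerivAt (fun s => R (w.1 + c * s, w.2 + s)) d 0 ∧ L * R w ≤ d := by
    rintro c R hc hR hPQ hRneg ⟨d, hd, hdL⟩
    have h1 : HasDerivAt (fun s => Real.exp (-((L + 1) * (w.2 + s))))
        (Real.exp (-((L + 1) * (w.2 + 0))) * -((L + 1) * 1)) 0 :=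
      ((((hasDerivAt_id (0 : ℝ)).const_add w.2).const_mul (L + 1)).neg).exp
    have h2 := h1.mul hd
    have h3 := deriv_nonpos_of_le_left hw0 h2 fun s hs => ?_
    · simp only [add_zero, mul_zero, mul_one] at h3
      have h4 : Real.exp (-((L + 1) * w.2)) * (d - (L + 1) * R w) ≤ 0 := by
        have : R (w.1, w.2) = R w := rfl
        rw [this] at h3
        linarith
      have h5 : 0 < d - (L + 1) * R w := by linarith
      exact absurd h4 (not_le.2 (mul_pos (Real.exp_pos _) h5))
    · have hv := hmin' _ (mem_closedCone_char hw hc hs.2 (by linarith [hs.1]))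
      simp only [Pi.mul_apply, mul_zero, add_zero]
      refine le_trans ?_ (hv.trans (mul_le_mul_of_nonneg_left (hPQ _) (Real.exp_pos _).le))
      rw [← hR]
  rcases le_total (P w) (Q w) with h | h
  · have h1 : P w < 0 := by rwa [min_eq_left h] at hneg
    refine key (-1) P (by simp) (min_eq_left h).symm (fun v => min_le_left _ _) h1 ?_
    simpa only [neg_one_mul, ← sub_eq_add_neg] using hPd w hw hw0 h1 h
  · have h1 : Q w < 0 := by rwa [min_eq_right h] at hneg
    refine key 1 Q (by simp) (min_eq_right h).symm (fun v => min_le_right _ _) h1 ?_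
    simpa only [one_mul] using hQd w hw hw0 h1 h

/-- Uniqueness in a backward cone. -/
theorem eq_of_transport_eq {z₀ : ℝ × ℝ} {L : ℝ} (hL : 0 ≤ L) {H : ℝ → ℝ → ℝ}
    {φ ψ φ' ψ' : ℝ × ℝ → ℝ} (hφ : ContinuousOn φ (closedCone z₀))
    (hψ : ContinuousOn ψ (closedCone z₀)) (hφ' : ContinuousOn φ' (closedCone z₀))
    (hψ' : ContinuousOn ψ' (closedCone z₀))
    (h0 : ∀ z ∈ closedCone z₀, z.2 = 0 → φ z = φ' z ∧ ψ z = ψ' z)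
    (hH : ∀ z ∈ closedCone z₀, |H z.2 (φ z + ψ z) - H z.2 (φ' z + ψ' z)| ≤
      L * |(φ z + ψ z) - (φ' z + ψ' z)|)
    (hdφ : ∀ z ∈ closedCone z₀, 0 < z.2 →
      HasDerivAt (fun s => φ (z.1 - s, z.2 + s)) (H z.2 (φ z + ψ z)) 0 ∧
      HasDerivAt (fun s => φ' (z.1 - s, z.2 + s)) (H z.2 (φ' z + ψ' z)) 0)
    (hdψ : ∀ z ∈ closedCone z₀, 0 < z.2 →
      HasDerivAt (fun s => ψ (z.1 + s, z.2 + s)) (H z.2 (φ z + ψ z)) 0 ∧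
      HasDerivAt (fun s => ψ' (z.1 + s, z.2 + s)) (H z.2 (φ' z + ψ' z)) 0)
    {z : ℝ × ℝ} (hz : z ∈ closedCone z₀) : φ z = φ' z ∧ ψ z = ψ' z := by
  have alg : ∀ a b h : ℝ, |h| ≤ L * |a + b| → -a ^ 2 ≤ -b ^ 2 → 4 * L * -a ^ 2 ≤ -(2 * a * h) := by
    intro a b h hh hab
    have h1 : |b| ≤ |a| := sq_le_sq.1 (by linarith)
    have h2 : |h| ≤ L * (2 * |a|) := hh.trans (by gcongr; linarith [abs_add_le a b])
    have h3 : 2 * a * h ≤ 2 * |a| * |h| := by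
      have := le_abs_self (a * h); rw [abs_mul] at this; linarith
    have h4 : |a| * |h| ≤ |a| * (L * (2 * |a|)) := by gcongr
    have h5 : |a| * |a| = a ^ 2 := by rw [← sq, sq_abs]
    nlinarith
  have h := nonneg_of_transport_ineq (z₀ := z₀) (L := 4 * L)
    (P := fun z => -(φ z - φ' z) ^ 2) (Q := fun z => -(ψ z - ψ' z) ^ 2)
    (by fun_prop) (by fun_prop) (fun z hz hz0 => by simp [(h0 z hz hz0).1])
    (fun z hz hz0 => by simp [(h0 z hz hz0).2]) (fun z hz hz0 _ hle => ?_)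
    (fun z hz hz0 _ hle => ?_) hz
  · refine ⟨sub_eq_zero.1 (pow_eq_zero_iff two_ne_zero |>.1 ?_),
      sub_eq_zero.1 (pow_eq_zero_iff two_ne_zero |>.1 ?_)⟩
    · exact le_antisymm (by linarith [h.1]) (sq_nonneg _)
    · exact le_antisymm (by linarith [h.2]) (sq_nonneg _)
  · have hd := (((hdφ z hz hz0).1.sub (hdφ z hz hz0).2).pow 2).neg
    refine ⟨_, hd, (alg (φ z - φ' z) (ψ z - ψ' z)
      (H z.2 (φ z + ψ z) - H z.2 (φ' z + ψ' z)) ?_ hle).trans_eq ?_⟩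
    · refine (hH z hz).trans_eq ?_
      congr 2; ring
    · simp
  · have hd := (((hdψ z hz hz0).1.sub (hdψ z hz hz0).2).pow 2).neg
    refine ⟨_, hd, (alg (ψ z - ψ' z) (φ z - φ' z)
      (H z.2 (φ z + ψ z) - H z.2 (φ' z + ψ' z)) ?_ hle).trans_eq ?_⟩
    · refine (hH z hz).trans_eq ?_
      congr 2; ring
    · simp

end Comparison
end BlowupCurve

namespace BlowupCurve

section Oscillation

theorem le_exp_mul_of_relaxation {a b M m : ℝ} (hab : a ≤ b) (hM : 0 ≤ M) (hm : 0 ≤ m)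
    {y x A ξ : ℝ → ℝ} (hy : ∀ s ∈ Icc a b, ∃ d, HasDerivAt y d s ∧ A s * (x s - y s) ≤ d)
    (hA : ∀ s ∈ Icc a b, m ≤ A s ∧ A s ≤ M) (hy0 : ∀ s ∈ Icc a b, 0 ≤ y s)
    (hξ : ContinuousOn ξ (Icc a b)) (hξx : ∀ s ∈ Icc a b, 0 ≤ ξ s ∧ ξ s ≤ x s) :
    y a + m * ∫ s in a..b, ξ s ≤ Real.exp (M * (b - a)) * y b := by
  set h : ℝ → ℝ := fun s => Real.exp (M * (s - a)) * y s - m * ∫ r in a..s, ξ r with hh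
  have hyc : ContinuousOn y (Icc a b) := fun s hs => by
    obtain ⟨d, hd, _⟩ := hy s hs
    exact hd.continuousAt.continuousWithinAt
  have hint : IntervalIntegrable ξ MeasureTheory.volume a b := by
    apply ContinuousOn.intervalIntegrable; rwa [uIcc_of_le hab]
  have hIc : ContinuousOn (fun s => ∫ r in a..s, ξ r) (Icc a b) := by
    have := intervalIntegral.continuousOn_primitive_interval (a := a) (b := b) (f := ξ)
      (μ := MeasureTheory.volume) ?_
    · rwa [uIcc_of_le hab] at this
    · rw [uIcc_of_le hab]; exact hξ.integrableOn_Icc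
  have hc : ContinuousOn h (Icc a b) := by
    rw [hh]
    exact (ContinuousOn.mul (Continuous.continuousOn (by fun_prop)) hyc).sub (hIc.const_mul m)
  have hderiv : ∀ s ∈ Ioo a b, ∃ d, HasDerivAt h d s ∧ 0 ≤ d := by
    intro s hs
    have hs' := Ioo_subset_Icc_self hs
    obtain ⟨d, hd, hdle⟩ := hy s hs'
    have h1 : HasDerivAt (fun s => Real.exp (M * (s - a))) (Real.exp (M * (s - a)) * (M * 1)) s :=
      (((hasDerivAt_id s).sub_const a).const_mul M).exp
    have hξs : ContinuousAt ξ s := hξ.continuousAt (Icc_mem_nhds hs.1 hs.2)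
    have h2 : HasDerivAt (fun s => ∫ r in a..s, ξ r) (ξ s) s := by
      refine intervalIntegral.integral_hasDerivAt_right ?_ ?_ hξs
      · exact hint.mono_set (by rw [uIcc_of_le hab, uIcc_of_le hs.1.le]; exact Icc_subset_Icc_right hs.2.le)
      · exact ContinuousOn.stronglyMeasurableAtFilter_nhdsWithin
          (hξ.mono Ioo_subset_Icc_self) measurableSet_Ioo s |>.filter_mono
          (by rw [isOpen_Ioo.nhdsWithin_eq hs])
    refine ⟨_, (h1.mul hd).sub (h2.const_mul m), ?_⟩
    obtain ⟨hA1, hA2⟩ := hA s hs'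
    obtain ⟨hx1, hx2⟩ := hξx s hs'
    have he : 1 ≤ Real.exp (M * (s - a)) := Real.one_le_exp (mul_nonneg hM (by linarith [hs.1]))
    have h3 : 0 ≤ M * y s - A s * y s := by
      rw [← sub_mul]; exact mul_nonneg (by linarith) (hy0 s hs')
    have h4 : m * ξ s ≤ A s * x s := mul_le_mul hA1 hx2 hx1 (hm.trans hA1)
    have h5 : m * ξ s ≤ M * y s + d := by linarith
    have h6 : 0 ≤ m * ξ s := mul_nonneg hm hx1
    nlinarith
  have hmono : MonotoneOn h (Icc a b) := by
    refine monotoneOn_of_deriv_nonneg (convex_Icc a b) hc ?_ ?_ <;> rw [interior_Icc]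
    · intro s hs
      obtain ⟨d, hd, _⟩ := hderiv s hs
      exact hd.differentiableAt.differentiableWithinAt
    · intro s hs
      obtain ⟨d, hd, hd0⟩ := hderiv s hs
      rwa [hd.deriv]
  have h1 := hmono (left_mem_Icc.2 hab) (right_mem_Icc.2 hab) hab
  simp only [hh, sub_self, mul_zero, Real.exp_zero, one_mul, intervalIntegral.integral_same,
    sub_zero] at h1
  linarith

/-- The square `[-ρ, 0]²` without its upper right corner. -/
def cornerSquare (ρ : ℝ) : Set (ℝ × ℝ) := {w | w.1 ∈ Icc (-ρ) 0 ∧ w.2 ∈ Icc (-ρ) 0 ∧ w.1 + w.2 < 0}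

theorem cornerSquare_mono {ρ ρ' : ℝ} (h : ρ ≤ ρ') : cornerSquare ρ ⊆ cornerSquare ρ' :=
  fun _ hw => ⟨⟨by linarith [hw.1.1], hw.1.2⟩, ⟨by linarith [hw.2.1.1], hw.2.1.2⟩, hw.2.2⟩

/-- `α` and `γ` are supersolutions, on the punctured square, of `∂ᵤ α = A (γ - α)` and
`∂ᵥ γ = B (α - γ)`, where `A` and `B` are comparable to the inverse distance to the corner. -/
structure IsRelaxing (ρ c C : ℝ) (A B α γ : ℝ × ℝ → ℝ) : Prop where
  cont_left : ContinuousOn α (cornerSquare ρ)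
  cont_right : ContinuousOn γ (cornerSquare ρ)
  rate_left : ∀ w ∈ cornerSquare ρ, c ≤ A w * -(w.1 + w.2) ∧ A w * -(w.1 + w.2) ≤ C
  rate_right : ∀ w ∈ cornerSquare ρ, c ≤ B w * -(w.1 + w.2) ∧ B w * -(w.1 + w.2) ≤ C
  deriv_left : ∀ w ∈ cornerSquare ρ,
    ∃ d, HasDerivAt (fun s => α (s, w.2)) d w.1 ∧ A w * (γ w - α w) ≤ d
  deriv_right : ∀ w ∈ cornerSquare ρ,
    ∃ d, HasDerivAt (fun s => γ (w.1, s)) d w.2 ∧ B w * (α w - γ w) ≤ d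

theorem IsRelaxing.le_of_le_on_edges {ρ r c C ℓ : ℝ} (hc : 0 < c) (hrρ : r ≤ ρ)
    {A B α γ : ℝ × ℝ → ℝ} (h : IsRelaxing ρ c C A B α γ)
    (hα : ∀ v ∈ Icc (-r) 0, ℓ ≤ α (-r, v)) (hγ : ∀ u ∈ Icc (-r) 0, ℓ ≤ γ (u, -r)) {w : ℝ × ℝ}
    (hw : w ∈ cornerSquare r) : ℓ ≤ α w ∧ ℓ ≤ γ w := by
  have hr : 0 < r := by linarith [hw.1.1, hw.2.1.1, hw.2.2]
  set K : Set (ℝ × ℝ) := Icc (-r) w.1 ×ˢ Icc (-r) w.2 with hK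
  have hKs : K ⊆ cornerSquare ρ := by
    rintro z ⟨hz1, hz2⟩
    refine cornerSquare_mono hrρ ⟨⟨hz1.1, hz1.2.trans hw.1.2⟩, ⟨hz2.1, hz2.2.trans hw.2.1.2⟩, ?_⟩
    linarith [hz1.2, hz2.2, hw.2.2]
  have hwK : w ∈ K := ⟨⟨hw.1.1, le_rfl⟩, ⟨hw.2.1.1, le_rfl⟩⟩
  have hApos : ∀ A : ℝ × ℝ → ℝ, ∀ z ∈ K, c ≤ A z * -(z.1 + z.2) → 0 ≤ A z := by
    intro A z hz hAz
    have := (hKs hz).2.2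
    by_contra hneg
    nlinarith
  suffices H : ∀ ε > 0, ℓ - ε * (2 * r) ≤ α w ∧ ℓ - ε * (2 * r) ≤ γ w by
    constructor <;> refine le_of_forall_pos_sub_le fun ε hε => ?_
    · have := (H (ε / (2 * r)) (by positivity)).1
      rwa [div_mul_cancel₀ _ (by positivity)] at this
    · have := (H (ε / (2 * r)) (by positivity)).2
      rwa [div_mul_cancel₀ _ (by positivity)] at this
  intro ε hε
  obtain ⟨z, hz, hmin⟩ := (isCompact_Icc.prod isCompact_Icc : IsCompact K).exists_isMinOn ⟨w, hwK⟩
    (f := fun z => min (α z) (γ z) + ε * (z.1 + z.2))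
    ((ContinuousOn.inf (h.cont_left.mono hKs) (h.cont_right.mono hKs)).add
      (Continuous.continuousOn (by fun_prop)))
  have hmin' : ∀ v ∈ K, min (α z) (γ z) + ε * (z.1 + z.2) ≤ min (α v) (γ v) + ε * (v.1 + v.2) :=
    fun v hv => hmin hv
  have hzsum : -(2 * r) ≤ z.1 + z.2 := by linarith [hz.1.1, hz.2.1]
  have hzs : ℓ ≤ min (α z) (γ z) := by
    rcases le_total (α z) (γ z) with hle | hle
    · rw [min_eq_left hle] at hmin' ⊢
      rcases eq_or_lt_of_le hz.1.1 with heq | hlt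
      · have := hα z.2 ⟨hz.2.1, hz.2.2.trans hw.2.1.2⟩
        rwa [heq] at this
      · exfalso
        obtain ⟨d, hd, hdle⟩ := h.deriv_left z (hKs hz)
        have h1 : HasDerivAt (fun s => α (z.1 + s, z.2) + ε * (z.1 + s + z.2)) (d + ε * 1) 0 := by
          refine HasDerivAt.add ?_ ?_
          · have : HasDerivAt (fun s => α (s, z.2)) d (z.1 + 0) := by rwa [add_zero]
            exact this.comp_const_add z.1 0
          · exact (((hasDerivAt_id 0).const_add z.1).add_const z.2).const_mul ε
        have h2 := deriv_nonpos_of_le_left (r := z.1 + r) (by linarith) h1 fun s hs => ?_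
        · have h3 := mul_nonneg (hApos A z hz (h.rate_left z (hKs hz)).1) (sub_nonneg.2 hle)
          linarith
        · simp only [add_zero]
          exact (hmin' (z.1 + s, z.2) ⟨⟨by simp only; linarith [hs.1], by
            simp only; linarith [hs.2, hz.1.2]⟩, hz.2⟩).trans (by gcongr; exact min_le_left _ _)
    · rw [min_eq_right hle] at hmin' ⊢
      rcases eq_or_lt_of_le hz.2.1 with heq | hlt
      · have := hγ z.1 ⟨hz.1.1, hz.1.2.trans hw.1.2⟩
        rwa [heq] at this
      · exfalso
        obtain ⟨d, hd, hdle⟩ := h.deriv_right z (hKs hz)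
        have h1 : HasDerivAt (fun s => γ (z.1, z.2 + s) + ε * (z.1 + (z.2 + s))) (d + ε * 1) 0 := by
          refine HasDerivAt.add ?_ ?_
          · have : HasDerivAt (fun s => γ (z.1, s)) d (z.2 + 0) := by rwa [add_zero]
            exact this.comp_const_add z.2 0
          · exact (((hasDerivAt_id 0).const_add z.2).const_add z.1).const_mul ε
        have h2 := deriv_nonpos_of_le_left (r := z.2 + r) (by linarith) h1 fun s hs => ?_
        · have h3 := mul_nonneg (hApos B z hz (h.rate_right z (hKs hz)).1) (sub_nonneg.2 hle)
          linarith
        · simp only [add_zero]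
          exact (hmin' (z.1, z.2 + s) ⟨hz.1, ⟨by simp only; linarith [hs.1], by
            simp only; linarith [hs.2, hz.2.2]⟩⟩).trans (by gcongr; exact min_le_right _ _)
  have h1 := hmin' w hwK
  have h2 : ε * (w.1 + w.2) ≤ 0 := mul_nonpos_of_nonneg_of_nonpos hε.le hw.2.2.le
  have h3 : -(ε * (2 * r)) ≤ ε * (z.1 + z.2) := by nlinarith
  have h4 : ℓ - ε * (2 * r) ≤ min (α w) (γ w) := by linarith
  exact ⟨h4.trans (min_le_left _ _), h4.trans (min_le_right _ _)⟩

/-- The fraction of the mean gained when passing to the square of half the size. -/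
noncomputable def relaxConst (c C : ℝ) : ℝ := Real.exp (-(8 * C)) * min (c / 4) (c ^ 2 / 16)

theorem relaxConst_pos {c C : ℝ} (hc : 0 < c) : 0 < relaxConst c C := by
  unfold relaxConst; positivity

theorem IsRelaxing.gain {ρ c C δ : ℝ} (hρ : 0 < ρ) (hc : 0 < c) (hδ : 0 ≤ δ)
    {A B α γ : ℝ × ℝ → ℝ} (h : IsRelaxing ρ c C A B α γ)
    (hα0 : ∀ w ∈ cornerSquare ρ, 0 ≤ α w) (hγ0 : ∀ w ∈ cornerSquare ρ, 0 ≤ γ w)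
    (havg : δ * (ρ / 2) ≤ ∫ v in (-ρ)..(-(ρ / 2)), α (-ρ, v)) {w : ℝ × ℝ}
    (hw : w ∈ cornerSquare (ρ / 2)) : relaxConst c C * δ ≤ α w ∧ relaxConst c C * δ ≤ γ w := by
  have hC : 0 < C := by
    have h1 : ((-ρ, -ρ) : ℝ × ℝ) ∈ cornerSquare ρ :=
      ⟨⟨le_rfl, by simp only; linarith⟩, ⟨le_rfl, by simp only; linarith⟩, by simp only; linarith⟩
    linarith [h.rate_left _ h1]
  have rate : ∀ A : ℝ × ℝ → ℝ, (∀ w ∈ cornerSquare ρ, c ≤ A w * -(w.1 + w.2) ∧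
      A w * -(w.1 + w.2) ≤ C) → ∀ w ∈ cornerSquare ρ, w.1 + w.2 ≤ -(ρ / 2) →
      c / (2 * ρ) ≤ A w ∧ A w ≤ 2 * C / ρ := by
    intro A hA w hw hle
    obtain ⟨h1, h2⟩ := hA w hw
    have hpos : 0 < -(w.1 + w.2) := by linarith
    have hA0 : 0 < A w := by
      by_contra hneg
      nlinarith
    rw [div_le_iff₀ (by positivity), le_div_iff₀ hρ]
    have h3 := hw.1.1
    have h4 := hw.2.1.1
    constructor <;> nlinarith
  have hMρ : ∀ x, x ≤ ρ → Real.exp (2 * C / ρ * x) ≤ Real.exp (2 * C) := by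
    intro x hx
    apply Real.exp_le_exp.2
    rw [div_mul_eq_mul_div, div_le_iff₀ hρ]
    nlinarith
  have he : ∀ {x y L : ℝ}, 0 ≤ y → L ≤ ρ → x ≤ Real.exp (2 * C / ρ * L) * y →
      Real.exp (-(2 * C)) * x ≤ y := by
    intro x y L hy hL hx
    rw [Real.exp_neg, inv_mul_le_iff₀ (Real.exp_pos _)]
    exact hx.trans (mul_le_mul_of_nonneg_right (hMρ L hL) hy)
  have hM0 : 0 ≤ 2 * C / ρ := by positivity
  have hm0 : 0 ≤ c / (2 * ρ) := by positivity
  -- decay along the first characteristic, for initial values on the left edge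
  have s1 : ∀ u ∈ Icc (-ρ) 0, ∀ v ∈ Icc (-ρ) (-(ρ / 2)),
      Real.exp (-(2 * C)) * α (-ρ, v) ≤ α (u, v) := by
    intro u hu v hv
    have hmem : ∀ s ∈ Icc (-ρ) u, (s, v) ∈ cornerSquare ρ := fun s hs =>
      ⟨⟨hs.1, hs.2.trans hu.2⟩, ⟨hv.1, by simp only; linarith [hv.2]⟩, by
        simp only; linarith [hs.2, hu.2, hv.2]⟩
    have := le_exp_mul_of_relaxation (y := fun s => α (s, v)) (x := fun s => γ (s, v))
      (A := fun s => A (s, v)) (ξ := fun _ => 0) hu.1 hM0 le_rfl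
      (fun s hs => h.deriv_left (s, v) (hmem s hs))
      (fun s hs => by
        have := rate A h.rate_left (s, v) (hmem s hs) (by simp only; linarith [hs.2, hu.2, hv.2])
        exact ⟨hm0.trans this.1, this.2⟩)
      (fun s hs => hα0 _ (hmem s hs)) continuousOn_const (fun s hs => ⟨le_rfl, hγ0 _ (hmem s hs)⟩)
    rw [zero_mul, add_zero] at this
    exact he (hα0 _ (hmem u ⟨hu.1, le_rfl⟩)) (by linarith [hu.2]) this
  -- gain along the second characteristic
  have s2 : ∀ u ∈ Icc (-ρ) 0, Real.exp (-(4 * C)) * (c / 4) * δ ≤ γ (u, -(ρ / 2)) := by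
    intro u hu
    have hmem : ∀ s ∈ Icc (-ρ) (-(ρ / 2)), (u, s) ∈ cornerSquare ρ := fun s hs =>
      ⟨hu, ⟨hs.1, by simp only; linarith [hs.2]⟩, by simp only; linarith [hs.2, hu.2]⟩
    have hmem' : ∀ s ∈ Icc (-ρ) (-(ρ / 2)), (-ρ, s) ∈ cornerSquare ρ := fun s hs =>
      ⟨⟨le_rfl, by simp only; linarith⟩, ⟨hs.1, by simp only; linarith [hs.2]⟩, by
        simp only; linarith [hs.2]⟩
    have := le_exp_mul_of_relaxation (y := fun s => γ (u, s)) (x := fun s => α (u, s))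
      (A := fun s => B (u, s)) (ξ := fun s => Real.exp (-(2 * C)) * α (-ρ, s))
      (by linarith : -ρ ≤ -(ρ / 2)) hM0 hm0
      (fun s hs => h.deriv_right (u, s) (hmem s hs))
      (fun s hs => rate B h.rate_right (u, s) (hmem s hs) (by simp only; linarith [hs.2, hu.2]))
      (fun s hs => hγ0 _ (hmem s hs))
      (continuousOn_const.mul (h.cont_left.comp (Continuous.continuousOn (by fun_prop)) hmem'))
      (fun s hs => ⟨mul_nonneg (Real.exp_pos _).le (hα0 _ (hmem' s hs)), s1 u hu s hs⟩)
    rw [intervalIntegral.integral_const_mul] at this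
    have h0 := hγ0 _ (hmem (-ρ) ⟨le_rfl, by linarith⟩)
    have h1 := he (hγ0 _ (hmem (-(ρ / 2)) ⟨by linarith, le_rfl⟩)) (by linarith) this
    refine le_trans ?_ h1
    have h2 : Real.exp (-(2 * C)) * (δ * (ρ / 2)) ≤
      Real.exp (-(2 * C)) * ∫ v in (-ρ)..(-(ρ / 2)), α (-ρ, v) := by gcongr
    calc _ = Real.exp (-(2 * C)) * (c / (2 * ρ) * (Real.exp (-(2 * C)) * (δ * (ρ / 2)))) := by
          rw [show -(4 * C) = -(2 * C) + -(2 * C) by ring, Real.exp_add]; field_simp; ring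
      _ ≤ _ := by
          refine mul_le_mul_of_nonneg_left ?_ (Real.exp_pos _).le
          have := mul_le_mul_of_nonneg_left h2 hm0
          linarith
  have s3 : ∀ u ∈ Icc (-ρ) (-(ρ / 2)), ∀ v ∈ Icc (-(ρ / 2)) 0,
      Real.exp (-(6 * C)) * (c / 4) * δ ≤ γ (u, v) := by
    intro u hu v hv
    have hmem : ∀ s ∈ Icc (-(ρ / 2)) v, (u, s) ∈ cornerSquare ρ := fun s hs =>
      ⟨⟨hu.1, by simp only; linarith [hu.2]⟩, ⟨by simp only; linarith [hs.1], hs.2.trans hv.2⟩, by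
        simp only; linarith [hs.2, hu.2, hv.2]⟩
    have := le_exp_mul_of_relaxation (y := fun s => γ (u, s)) (x := fun s => α (u, s))
      (A := fun s => B (u, s)) (ξ := fun _ => 0) hv.1 hM0 le_rfl
      (fun s hs => h.deriv_right (u, s) (hmem s hs))
      (fun s hs => by
        have := rate B h.rate_right (u, s) (hmem s hs) (by simp only; linarith [hs.2, hu.2, hv.2])
        exact ⟨hm0.trans this.1, this.2⟩)
      (fun s hs => hγ0 _ (hmem s hs)) continuousOn_const (fun s hs => ⟨le_rfl, hα0 _ (hmem s hs)⟩)
    rw [zero_mul, add_zero] at this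
    have h1 := he (hγ0 _ (hmem v ⟨hv.1, le_rfl⟩)) (by linarith [hv.2]) this
    refine le_trans ?_ h1
    rw [show -(6 * C) = -(2 * C) + -(4 * C) by ring, Real.exp_add, mul_assoc, mul_assoc]
    refine mul_le_mul_of_nonneg_left ?_ (Real.exp_pos _).le
    rw [← mul_assoc]
    exact s2 u ⟨hu.1, by linarith [hu.2]⟩
  have s4 : ∀ v ∈ Icc (-(ρ / 2)) 0, Real.exp (-(8 * C)) * (c ^ 2 / 16) * δ ≤ α (-(ρ / 2), v) := by
    intro v hv
    have hmem : ∀ s ∈ Icc (-ρ) (-(ρ / 2)), (s, v) ∈ cornerSquare ρ := fun s hs =>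
      ⟨⟨hs.1, by simp only; linarith [hs.2]⟩, ⟨by simp only; linarith [hv.1], hv.2⟩, by
        simp only; linarith [hs.2, hv.2]⟩
    have := le_exp_mul_of_relaxation (y := fun s => α (s, v)) (x := fun s => γ (s, v))
      (A := fun s => A (s, v)) (ξ := fun _ => Real.exp (-(6 * C)) * (c / 4) * δ)
      (by linarith : -ρ ≤ -(ρ / 2)) hM0 hm0
      (fun s hs => h.deriv_left (s, v) (hmem s hs))
      (fun s hs => rate A h.rate_left (s, v) (hmem s hs) (by simp only; linarith [hs.2, hv.2]))
      (fun s hs => hα0 _ (hmem s hs)) continuousOn_const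
      (fun s hs => ⟨by positivity, s3 s hs v hv⟩)
    rw [intervalIntegral.integral_const, smul_eq_mul] at this
    have h0 := hα0 _ (hmem (-ρ) ⟨le_rfl, by linarith⟩)
    have h1 := he (hα0 _ (hmem (-(ρ / 2)) ⟨by linarith, le_rfl⟩)) (by linarith) this
    refine le_trans ?_ h1
    calc _ = Real.exp (-(2 * C)) * (c / (2 * ρ) * ((-(ρ / 2) - -ρ) *
          (Real.exp (-(6 * C)) * (c / 4) * δ))) := by
          rw [show -(8 * C) = -(2 * C) + -(6 * C) by ring, Real.exp_add]; field_simp; ring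
      _ ≤ _ := by
          refine mul_le_mul_of_nonneg_left ?_ (Real.exp_pos _).le
          linarith
  refine h.le_of_le_on_edges hc (by linarith : ρ / 2 ≤ ρ) (fun v hv => ?_) (fun u hu => ?_) hw
  · refine le_trans ?_ (s4 v hv)
    unfold relaxConst
    gcongr
    exact min_le_right _ _
  · refine le_trans ?_ (s2 u ⟨by linarith [hu.1], hu.2⟩)
    unfold relaxConst
    gcongr
    · linarith
    · exact min_le_left _ _

/-- Decay of the oscillation when passing to the square of half the size. -/
theorem oscillation_decay {ρ c C E lo hi : ℝ} (hρ : 0 < ρ) (hc : 0 < c) (hE : 0 ≤ E)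
    {A B α γ : ℝ × ℝ → ℝ} (hα : ContinuousOn α (cornerSquare ρ))
    (hγ : ContinuousOn γ (cornerSquare ρ))
    (hA : ∀ w ∈ cornerSquare ρ, c ≤ A w * -(w.1 + w.2) ∧ A w * -(w.1 + w.2) ≤ C)
    (hB : ∀ w ∈ cornerSquare ρ, c ≤ B w * -(w.1 + w.2) ∧ B w * -(w.1 + w.2) ≤ C)
    (hdα : ∀ w ∈ cornerSquare ρ,
      ∃ d, HasDerivAt (fun s => α (s, w.2)) d w.1 ∧ |d - A w * (γ w - α w)| ≤ E)
    (hdγ : ∀ w ∈ cornerSquare ρ,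
      ∃ d, HasDerivAt (fun s => γ (w.1, s)) d w.2 ∧ |d - B w * (α w - γ w)| ≤ E)
    (hαb : ∀ w ∈ cornerSquare ρ, α w ∈ Icc lo hi) (hγb : ∀ w ∈ cornerSquare ρ, γ w ∈ Icc lo hi) :
    ∃ lo' hi', hi' - lo' = (1 - relaxConst c C / 2) * (hi - lo) + 2 * E * ρ ∧
      ∀ w ∈ cornerSquare (ρ / 2), α w ∈ Icc lo' hi' ∧ γ w ∈ Icc lo' hi' := by
  have hlohi : lo ≤ hi := by
    have h1 : ((-ρ, -ρ) : ℝ × ℝ) ∈ cornerSquare ρ :=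
      ⟨⟨le_rfl, by simp only; linarith⟩, ⟨le_rfl, by simp only; linarith⟩, by simp only; linarith⟩
    exact (hαb _ h1).1.trans (hαb _ h1).2
  have hedge : ∀ s ∈ Icc (-ρ) (-(ρ / 2)), (-ρ, s) ∈ cornerSquare ρ := fun s hs =>
    ⟨⟨le_rfl, by simp only; linarith⟩, ⟨hs.1, by simp only; linarith [hs.2]⟩, by
      simp only; linarith [hs.2]⟩
  have hcont : ContinuousOn (fun v => α (-ρ, v)) (Icc (-ρ) (-(ρ / 2))) :=
    hα.comp (Continuous.continuousOn (by fun_prop)) hedge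
  have hle : -ρ ≤ -(ρ / 2) := by linarith
  have key : ∀ σ k : ℝ, (σ = 1 ∨ σ = -1) → (∀ w ∈ cornerSquare ρ, 0 ≤ σ * α w + k) →
      (∀ w ∈ cornerSquare ρ, 0 ≤ σ * γ w + k) →
      (hi - lo) / 2 * (ρ / 2) ≤ ∫ v in (-ρ)..(-(ρ / 2)), (σ * α (-ρ, v) + k) →
      ∀ w ∈ cornerSquare (ρ / 2),
        relaxConst c C * ((hi - lo) / 2) - 2 * E * ρ ≤ σ * α w + k ∧
        relaxConst c C * ((hi - lo) / 2) - 2 * E * ρ ≤ σ * γ w + k := by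
    intro σ k hσ hα0 hγ0 havg w hw
    have habs : ∀ x, |x| ≤ E → 0 ≤ σ * x + E := by
      intro x hx
      have := abs_le.1 hx
      rcases hσ with rfl | rfl <;> linarith
    have hlin : ∀ w ∈ cornerSquare ρ, 0 ≤ E * (w.1 + w.2 + 2 * ρ) := fun w hw =>
      mul_nonneg hE (by linarith [hw.1.1, hw.2.1.1])
    have hrel : IsRelaxing ρ c C A B (fun w => σ * α w + k + E * (w.1 + w.2 + 2 * ρ))
        (fun w => σ * γ w + k + E * (w.1 + w.2 + 2 * ρ)) := by
      refine ⟨by fun_prop, by fun_prop, hA, hB, fun w hw => ?_, fun w hw => ?_⟩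
      · obtain ⟨d, hd, hdE⟩ := hdα w hw
        refine ⟨_, ((hd.const_mul σ).add_const k).add
          ((((hasDerivAt_id w.1).add_const w.2).add_const (2 * ρ)).const_mul E), ?_⟩
        have := habs _ hdE
        linarith
      · obtain ⟨d, hd, hdE⟩ := hdγ w hw
        refine ⟨_, ((hd.const_mul σ).add_const k).add
          ((((hasDerivAt_id w.2).const_add w.1).add_const (2 * ρ)).const_mul E), ?_⟩
        have := habs _ hdE
        linarith
    have hg := hrel.gain hρ hc (by linarith : 0 ≤ (hi - lo) / 2)
      (fun w hw => add_nonneg (hα0 w hw) (hlin w hw))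
      (fun w hw => add_nonneg (hγ0 w hw) (hlin w hw)) (havg.trans ?_) hw
    · have h2 : E * (w.1 + w.2 + 2 * ρ) ≤ E * (2 * ρ) :=
        mul_le_mul_of_nonneg_left (by linarith [hw.2.2]) hE
      constructor <;> linarith
    · refine intervalIntegral.integral_mono_on hle ?_ ?_ fun v hv => ?_
      · apply ContinuousOn.intervalIntegrable; rw [uIcc_of_le hle]
        exact (continuousOn_const.mul hcont).add continuousOn_const
      · apply ContinuousOn.intervalIntegrable; rw [uIcc_of_le hle]
        exact ((continuousOn_const.mul hcont).add continuousOn_const).add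
          (Continuous.continuousOn (by fun_prop))
      · linarith [hlin _ (hedge v hv)]
  have hint : ∀ σ k : ℝ, ∫ v in (-ρ)..(-(ρ / 2)), (σ * α (-ρ, v) + k) =
      σ * (∫ v in (-ρ)..(-(ρ / 2)), α (-ρ, v)) + ρ / 2 * k := by
    intro σ k
    rw [intervalIntegral.integral_add, intervalIntegral.integral_const_mul,
      intervalIntegral.integral_const, smul_eq_mul]
    · ring
    · apply ContinuousOn.intervalIntegrable; rw [uIcc_of_le hle]
      exact continuousOn_const.mul hcont
    · exact intervalIntegrable_const
  rcases le_total ((lo + hi) / 2 * (ρ / 2)) (∫ v in (-ρ)..(-(ρ / 2)), α (-ρ, v)) with hav | hav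
  · refine ⟨lo + (relaxConst c C * ((hi - lo) / 2) - 2 * E * ρ), hi, by ring, fun w hw => ?_⟩
    have := key 1 (-lo) (Or.inl rfl) (fun w hw => by linarith [(hαb w hw).1])
      (fun w hw => by linarith [(hγb w hw).1]) (by rw [hint]; linarith) w hw
    have hw' := cornerSquare_mono (by linarith : ρ / 2 ≤ ρ) hw
    exact ⟨⟨by linarith [this.1], (hαb w hw').2⟩, ⟨by linarith [this.2], (hγb w hw').2⟩⟩
  · refine ⟨lo, hi - (relaxConst c C * ((hi - lo) / 2) - 2 * E * ρ), by ring, fun w hw => ?_⟩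
    have := key (-1) hi (Or.inr rfl) (fun w hw => by linarith [(hαb w hw).2])
      (fun w hw => by linarith [(hγb w hw).2]) (by rw [hint]; linarith) w hw
    have hw' := cornerSquare_mono (by linarith : ρ / 2 ≤ ρ) hw
    exact ⟨⟨(hαb w hw').1, by linarith [this.1]⟩, ⟨(hγb w hw').1, by linarith [this.2]⟩⟩

end Oscillation
end BlowupCurve

namespace BlowupCurve

section Truncation

/-- A smooth nondecreasing, nonexpansive truncation which is the identity on `[a, b]`. -/
theorem exists_smooth_truncation {a b ε : ℝ} (hab : a < b) (hε : 0 < ε) :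
    ∃ τ : ℝ → ℝ, ContDiff ℝ 4 τ ∧ (∀ x ∈ Icc a b, τ x = x) ∧ Monotone τ ∧
      (∀ x, |deriv τ x| ≤ 1) ∧ (∀ x y, |τ x - τ y| ≤ |x - y|) ∧
      ∀ x, a - ε ≤ τ x ∧ τ x ≤ b + ε := by
  let χ : ContDiffBump ((a + b) / 2) :=
    ⟨(b - a) / 2, (b - a) / 2 + ε, by linarith, by linarith⟩
  have hχc : Continuous χ := χ.continuous
  have hii : ∀ x y, IntervalIntegrable χ MeasureTheory.volume x y :=
    fun x y => hχc.intervalIntegrable x y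
  set τ : ℝ → ℝ := fun x => a + ∫ s in a..x, χ s with hτ
  have hd : ∀ x, HasDerivAt τ (χ x) x := fun x =>
    ((hχc.integral_hasStrictDerivAt a x).hasDerivAt).const_add a
  have hderiv : deriv τ = χ := funext fun x => (hd x).deriv
  have hsub : ∀ x y, τ y - τ x = ∫ s in x..y, χ s := by
    intro x y
    simp only [hτ, add_sub_add_left_eq_sub]
    exact intervalIntegral.integral_interval_sub_left (hii _ _) (hii _ _)
  have hone : ∀ x ∈ Icc a b, χ x = 1 := fun x hx => χ.one_of_mem_closedBall (by
    rw [Metric.mem_closedBall, Real.dist_eq, abs_le]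
    exact ⟨by change -((b - a) / 2) ≤ _; linarith [hx.1], by
      change _ ≤ (b - a) / 2; linarith [hx.2]⟩)
  have hzero : ∀ x, (b - a) / 2 + ε ≤ |x - (a + b) / 2| → χ x = 0 := fun x hx =>
    χ.zero_of_le_dist (by rwa [Real.dist_eq])
  have hmono : Monotone τ := monotone_of_deriv_nonneg (fun x => (hd x).differentiableAt)
    fun x => by rw [hderiv]; exact χ.nonneg
  have hid : ∀ x ∈ Icc a b, τ x = x := by
    intro x hx
    have : ∫ s in a..x, χ s = ∫ s in a..x, (1 : ℝ) := by
      refine intervalIntegral.integral_congr fun s hs => ?_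
      rw [uIcc_of_le hx.1] at hs
      exact hone s ⟨hs.1, hs.2.trans hx.2⟩
    simp only [hτ, this, intervalIntegral.integral_const, smul_eq_mul, mul_one]
    ring
  have habs : ∀ x, |deriv τ x| ≤ 1 := fun x => by
    rw [hderiv, abs_of_nonneg χ.nonneg]; exact χ.le_one
  have hlip : ∀ x y, |τ x - τ y| ≤ |x - y| := fun x y => by
    have := convex_univ.norm_image_sub_le_of_norm_deriv_le (f := τ) (C := 1)
      (fun x _ => (hd x).differentiableAt) (fun x _ => habs x) (mem_univ y) (mem_univ x)
    simpa using this
  have ha := hid a ⟨le_rfl, hab.le⟩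
  have hb := hid b ⟨hab.le, le_rfl⟩
  refine ⟨τ, ?_, hid, hmono, habs, hlip, fun x => ⟨?_, ?_⟩⟩
  · have h1 : ContDiff ℝ 3 χ := χ.contDiff
    have : (4 : WithTop ℕ∞) = 3 + 1 := by norm_num
    rw [this, contDiff_succ_iff_deriv]
    refine ⟨fun x => (hd x).differentiableAt, by simp, ?_⟩
    rw [hderiv]; exact h1
  · rcases le_total (a - ε) x with h | h
    · have h1 := hmono h
      have h2 := hlip a (a - ε)
      rw [ha, sub_sub_cancel, abs_of_pos hε] at h2
      linarith [le_abs_self (a - τ (a - ε))]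
    · have h1 : ∫ s in x..(a - ε), χ s = ∫ s in x..(a - ε), (0 : ℝ) := by
        refine intervalIntegral.integral_congr fun s hs => hzero s ?_
        rw [uIcc_of_le h] at hs
        rw [abs_of_nonpos (by linarith [hs.2])]
        linarith [hs.2]
      have h2 := hlip a (a - ε)
      rw [ha, sub_sub_cancel, abs_of_pos hε] at h2
      have h3 := hsub x (a - ε)
      rw [h1, intervalIntegral.integral_zero] at h3
      linarith [le_abs_self (a - τ (a - ε))]
  · rcases le_total x (b + ε) with h | h
    · have h1 := hmono h
      have h2 := hlip (b + ε) b
      rw [hb, add_sub_cancel_left, abs_of_pos hε] at h2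
      linarith [le_abs_self (τ (b + ε) - b)]
    · have h1 : ∫ s in (b + ε)..x, χ s = ∫ s in (b + ε)..x, (0 : ℝ) := by
        refine intervalIntegral.integral_congr fun s hs => hzero s ?_
        rw [uIcc_of_le h] at hs
        rw [abs_of_nonneg (by linarith [hs.1])]
        linarith [hs.1]
      have h2 := hlip (b + ε) b
      rw [hb, add_sub_cancel_left, abs_of_pos hε] at h2
      have h3 := hsub (b + ε) x
      rw [h1, intervalIntegral.integral_zero] at h3
      linarith [le_abs_self (τ (b + ε) - b)]

/-- Extension of the data from a ball to the line, preserving bounds on values and slopes. -/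
theorem exists_data_extension {r₁ r₂ : ℝ} (h0 : 0 < r₁) (h12 : r₁ < r₂) :
    ∃ θ : ℝ → ℝ, (∀ x, |x| ≤ r₁ → θ x = x) ∧ ∀ f : ℝ → ℝ,
      ContDiffOn ℝ 4 f (Metric.closedBall 0 r₂) → ContDiff ℝ 4 (f ∘ θ) ∧
      (∃ D, ∀ x, |f (θ x)| ≤ D) ∧ ∀ x, θ x ∈ Metric.ball (0 : ℝ) r₂ ∧
        |deriv (f ∘ θ) x| ≤ |deriv f (θ x)| := by
  obtain ⟨θ, hθ, hid, -, hd, -, hb⟩ := exists_smooth_truncation (a := -r₁) (b := r₁)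
    (ε := (r₂ - r₁) / 2) (by linarith) (by linarith)
  have hmem : ∀ x, |θ x| ≤ (r₁ + r₂) / 2 := fun x =>
    abs_le.2 ⟨by linarith [(hb x).1], by linarith [(hb x).2]⟩
  have hball : ∀ x, θ x ∈ Metric.ball (0 : ℝ) r₂ := fun x => by
    rw [mem_ball_zero_iff, Real.norm_eq_abs]; linarith [hmem x]
  refine ⟨θ, fun x hx => hid x (abs_le.1 hx), fun f hf => ?_⟩
  have hf' : ∀ x, ContDiffAt ℝ 4 f (θ x) := fun x =>
    hf.contDiffAt (mem_of_superset (Metric.isOpen_ball.mem_nhds (hball x))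
      Metric.ball_subset_closedBall)
  refine ⟨contDiff_iff_contDiffAt.2 fun x => (hf' x).comp x hθ.contDiffAt, ?_, fun x => ?_⟩
  · obtain ⟨D, hD⟩ := (isCompact_closedBall (0 : ℝ) r₂).exists_bound_of_continuousOn
      hf.continuousOn
    exact ⟨D, fun x => hD _ (Metric.ball_subset_closedBall (hball x))⟩
  · refine ⟨hball x, ?_⟩
    rw [deriv_comp x ((hf' x).differentiableAt (by norm_num))
      (hθ.differentiable (by norm_num) x), abs_mul]
    exact mul_le_of_le_one_right (abs_nonneg _) (hd x)

end Truncation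

section Source

variable {p μ : ℝ}

/-- Values of `w` in the range where the nonlinear part of the source dominates. -/
def IsLarge (p μ w : ℝ) : Prop := 0 < w ∧ μ * p ≤ (2 : ℝ) ^ (-p) * w ^ (p - 1)

theorem IsLarge.mono (hp : 1 < p) {w w' : ℝ} (hw : IsLarge p μ w) (h : w ≤ w') :
    IsLarge p μ w' := by
  refine ⟨hw.1.trans_le h, hw.2.trans ?_⟩
  have := Real.rpow_le_rpow hw.1.le h (by linarith : 0 ≤ p - 1)
  gcongr

theorem isLarge_of_le (hp : 1 < p) (hμ : 0 < μ) {w : ℝ} (hw : 0 < w)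
    (h : (μ * p * (2 : ℝ) ^ p) ^ (1 / (p - 1)) ≤ w) : IsLarge p μ w := by
  refine ⟨hw, ?_⟩
  have hp' : 0 < p - 1 := by linarith
  have h1 := Real.rpow_le_rpow (by positivity) h hp'.le
  rw [← Real.rpow_mul (by positivity), one_div, inv_mul_cancel₀ hp'.ne', Real.rpow_one] at h1
  rw [Real.rpow_neg (by norm_num), le_inv_mul_iff₀ (by positivity), mul_comm]
  exact h1

theorem rpow_eq_mul_rpow_sub_one {w : ℝ} (hw : 0 < w) : w ^ p = w ^ (p - 1) * w := by
  rw [Real.rpow_sub_one hw.ne', div_mul_cancel₀ _ hw.ne']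

theorem IsLarge.linear_le {w : ℝ} (hw : IsLarge p μ w) :
    μ * p * w ≤ (2 : ℝ) ^ (-p) * w ^ p := by
  rw [rpow_eq_mul_rpow_sub_one hw.1, ← mul_assoc]
  exact mul_le_mul_of_nonneg_right hw.2 hw.1.le

theorem source_of_pos {t w : ℝ} (hw : 0 < w) :
    source p μ t w = (2 : ℝ) ^ (-p) * w ^ p - μ / (1 + t) * (w / 2) := by
  rw [source, abs_of_pos hw]

theorem div_one_add_le (hμ : 0 < μ) {t : ℝ} (ht : -(1 / 2) ≤ t) : μ / (1 + t) ≤ 2 * μ := by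
  rw [div_le_iff₀ (by linarith)]; nlinarith

theorem div_one_add_le_self (hμ : 0 < μ) {t : ℝ} (ht : 0 ≤ t) : μ / (1 + t) ≤ μ :=
  div_le_self hμ.le (by linarith)

theorem source_pos (hp : 1 < p) (hμ : 0 < μ) {t w : ℝ} (ht : -(1 / 2) ≤ t)
    (hw : IsLarge p μ w) : 0 < source p μ t w := by
  rw [source_of_pos hw.1]
  have h1 := hw.linear_le
  have h2 := div_one_add_le hμ ht
  have hw0 := hw.1
  have h3 : μ / (1 + t) * (w / 2) ≤ μ * w := by nlinarith
  have h4 : μ * w < μ * p * w := by nlinarith [mul_pos hμ hw0]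
  linarith

theorem half_le_source (hp : 1 < p) (hμ : 0 < μ) {t w : ℝ} (ht : 0 ≤ t)
    (hw : IsLarge p μ w) : (2 : ℝ) ^ (-p) * w ^ p / 2 ≤ source p μ t w := by
  rw [source_of_pos hw.1]
  have h1 := hw.linear_le
  have h2 := div_one_add_le_self hμ ht
  have hw0 := hw.1
  have h3 : μ / (1 + t) * (w / 2) ≤ μ * (w / 2) := by gcongr
  have h4 : μ * w < μ * p * w := by nlinarith [mul_pos hμ hw0]
  linarith

theorem source_le (hμ : 0 < μ) {t w : ℝ} (ht : -1 < t) (hw : 0 < w) :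
    source p μ t w ≤ (2 : ℝ) ^ (-p) * w ^ p := by
  rw [source_of_pos hw]
  have : 0 ≤ μ / (1 + t) * (w / 2) := by
    have : 0 < 1 + t := by linarith
    positivity
  linarith

/-- The derivative of the source with respect to `w`. -/
noncomputable def sourceSlope (p μ t w : ℝ) : ℝ :=
  p * ((2 : ℝ) ^ (-p) * w ^ (p - 1)) - μ / (1 + t) / 2

theorem hasDerivAt_source_right {t w : ℝ} (hw : 0 < w) :
    HasDerivAt (source p μ t) (sourceSlope p μ t w) w := by
  have h1 : HasDerivAt (fun w => (2 : ℝ) ^ (-p) * w ^ p - μ / (1 + t) * (w / 2))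
      ((2 : ℝ) ^ (-p) * (p * w ^ (p - 1)) - μ / (1 + t) * (1 / 2)) w :=
    ((Real.hasDerivAt_rpow_const (Or.inl hw.ne')).const_mul _).sub
      (((hasDerivAt_id w).div_const 2).const_mul _)
  refine (h1.congr_deriv ?_).congr_of_eventuallyEq ?_
  · unfold sourceSlope; ring
  · filter_upwards [lt_mem_nhds hw] with v hv
    exact source_of_pos hv

theorem hasDerivAt_source_left {t w : ℝ} (ht : -1 < t) :
    HasDerivAt (fun t => source p μ t w) (μ / (1 + t) ^ 2 * (w / 2)) t := by
  have h0 : (1 + t) ≠ 0 := by linarith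
  have h1 : HasDerivAt (fun t : ℝ => 1 + t) 1 t := (hasDerivAt_id t).const_add 1
  have h2 := (((hasDerivAt_const t μ).div h1 h0).mul_const (w / 2)).const_sub
    ((2 : ℝ) ^ (-p) * |w| ^ p)
  refine h2.congr_deriv ?_
  field_simp
  ring

theorem sourceSlope_nonneg (hp : 1 < p) (hμ : 0 < μ) {t w : ℝ} (ht : -(1 / 2) ≤ t)
    (hw : IsLarge p μ w) : 0 ≤ sourceSlope p μ t w := by
  have h1 := div_one_add_le hμ ht
  have h2 := hw.2
  have h3 : μ * p < p * ((2 : ℝ) ^ (-p) * w ^ (p - 1)) := by nlinarith [mul_pos hμ (by linarith : 0 < p)]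
  have h4 : μ < μ * p := by nlinarith
  unfold sourceSlope
  linarith

theorem half_le_sourceSlope (hp : 1 < p) (hμ : 0 < μ) {t w : ℝ} (ht : 0 ≤ t)
    (hw : IsLarge p μ w) : (2 : ℝ) ^ (-p) * w ^ (p - 1) / 2 ≤ sourceSlope p μ t w := by
  have h1 := div_one_add_le_self hμ ht
  have h2 := hw.2
  have h4 : μ < μ * p := by nlinarith
  unfold sourceSlope
  nlinarith

theorem sourceSlope_le (hμ : 0 < μ) {t w : ℝ} (ht : -1 < t) :
    sourceSlope p μ t w ≤ p * ((2 : ℝ) ^ (-p) * w ^ (p - 1)) := by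
  have : 0 ≤ μ / (1 + t) / 2 := by
    have : 0 < 1 + t := by linarith
    positivity
  unfold sourceSlope
  linarith

theorem contDiffAt_source {n : WithTop ℕ∞} {t w : ℝ} (ht : -1 < t) (hw : 0 < w) :
    ContDiffAt ℝ n (fun z : ℝ × ℝ => source p μ z.1 z.2) (t, w) := by
  have h1 : ContDiffAt ℝ n (fun z : ℝ × ℝ => (2 : ℝ) ^ (-p) * z.2 ^ p - μ / (1 + z.1) * (z.2 / 2))
      (t, w) := by
    refine (contDiffAt_const.mul (contDiffAt_snd.rpow_const_of_ne hw.ne')).sub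
      ((contDiffAt_const.div (contDiffAt_const.add contDiffAt_fst) ?_).mul
        (contDiffAt_snd.div_const 2))
    change 1 + t ≠ 0
    linarith
  refine h1.congr_of_eventuallyEq ?_
  filter_upwards [continuous_snd.continuousAt.eventually (lt_mem_nhds hw)] with z hz
  exact source_of_pos hz

theorem source_mono_left (hμ : 0 < μ) {t t' w : ℝ} (ht : -1 < t) (htt : t ≤ t') (hw : 0 < w) :
    source p μ t w ≤ source p μ t' w := by
  unfold source
  have : μ / (1 + t') ≤ μ / (1 + t) := by
    apply div_le_div_of_nonneg_left hμ.le <;> linarith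
  gcongr

theorem source_mono_right (hp : 1 < p) (hμ : 0 < μ) {t w w' : ℝ} (ht : -(1 / 2) ≤ t)
    (hw : IsLarge p μ w) (h : w ≤ w') : source p μ t w ≤ source p μ t w' := by
  have hmono : MonotoneOn (source p μ t) (Ici w) := by
    refine monotoneOn_of_deriv_nonneg (convex_Ici w) (fun v hv => ?_) (fun v hv => ?_)
      fun v hv => ?_
    · exact (hasDerivAt_source_right (hw.mono hp hv).1).continuousAt.continuousWithinAt
    · rw [interior_Ici] at hv
      exact (hasDerivAt_source_right (hw.mono hp (le_of_lt hv)).1).differentiableAt.differentiableWithinAt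
    · rw [interior_Ici] at hv
      rw [(hasDerivAt_source_right (hw.mono hp (le_of_lt hv)).1).deriv]
      exact sourceSlope_nonneg hp hμ ht (hw.mono hp (le_of_lt hv))
  exact hmono self_mem_Ici h h

theorem abs_source_sub_le (hp : 1 < p) (hμ : 0 < μ) {t w₀ w₁ w w' : ℝ} (ht : -(1 / 2) ≤ t)
    (hw₀ : IsLarge p μ w₀) (hw : w ∈ Icc w₀ w₁) (hw' : w' ∈ Icc w₀ w₁) :
    |source p μ t w - source p μ t w'| ≤ p * ((2 : ℝ) ^ (-p) * w₁ ^ (p - 1)) * |w - w'| := by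
  refine (convex_Icc w₀ w₁).norm_image_sub_le_of_norm_hasDerivWithin_le
    (f' := sourceSlope p μ t)
    (fun v hv => (hasDerivAt_source_right (hw₀.mono hp hv.1).1).hasDerivWithinAt)
    (fun v hv => ?_) hw' hw
  rw [Real.norm_eq_abs, abs_of_nonneg (sourceSlope_nonneg hp hμ ht (hw₀.mono hp hv.1))]
  refine (sourceSlope_le hμ (by linarith)).trans ?_
  have h1 := (hw₀.mono hp hv.1).1.le
  have := hv.2
  have : v ^ (p - 1) ≤ w₁ ^ (p - 1) := Real.rpow_le_rpow h1 hv.2 (by linarith)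
  gcongr

theorem odeSource_le_source (hμ : 0 < μ) {t w : ℝ} (ht : 0 ≤ t) (hw : 0 < w) :
    odeSource p μ w ≤ source p μ t w := by
  have h1 := div_one_add_le_self hμ ht
  have : μ / (1 + t) * (w / 2) ≤ μ * (w / 2) := by gcongr
  unfold source odeSource
  linarith

end Source
end BlowupCurve

namespace BlowupCurve

section TruncatedSource

/-- A smooth positive source, nondecreasing in both variables and Lipschitz in the second. -/
structure IsMonotoneSource (L : ℝ) (G : ℝ × ℝ → ℝ) : Prop where
  contDiff : ContDiff ℝ 4 G
  pos : ∀ z, 0 < G z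
  mono_left : ∀ t t' w, t ≤ t' → G (t, w) ≤ G (t', w)
  mono_right : ∀ t w w', w ≤ w' → G (t, w) ≤ G (t, w')
  lip : ∀ t w w', |G (t, w) - G (t, w')| ≤ L * |w - w'|

theorem exists_truncated_source {p μ w₀ γ N S : ℝ} (hp : 1 < p) (hμ : 0 < μ)
    (hw₀ : IsLarge p μ w₀) (hγ : w₀ < γ) (hN : γ < N) (hS : 0 < S) :
    ∃ (G : ℝ × ℝ → ℝ) (L C : ℝ), 0 ≤ L ∧ IsMonotoneSource L G ∧ (∀ z, |G z| ≤ C) ∧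
      ∀ t ∈ Icc 0 S, ∀ w ∈ Icc γ N, G (t, w) = source p μ t w := by
  obtain ⟨τ, hτ, hτid, hτm, -, -, hτb⟩ := exists_smooth_truncation (a := 0) (b := S)
    (ε := 1 / 2) hS (by norm_num)
  obtain ⟨σ, hσ, hσid, hσm, -, hσl, hσb⟩ := exists_smooth_truncation (a := γ) (b := N)
    (ε := γ - w₀) hN (by linarith)
  have ht : ∀ t, -(1 / 2) ≤ τ t := fun t => by linarith [(hτb t).1]
  have hw : ∀ w, σ w ∈ Icc w₀ (N + (γ - w₀)) := fun w => ⟨by linarith [(hσb w).1], (hσb w).2⟩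
  have hl : ∀ w, IsLarge p μ (σ w) := fun w => hw₀.mono hp (hw w).1
  have hN0 : 0 < N + (γ - w₀) := by linarith [hw₀.1]
  refine ⟨fun z => source p μ (τ z.1) (σ z.2),
    p * ((2 : ℝ) ^ (-p) * (N + (γ - w₀)) ^ (p - 1)), (2 : ℝ) ^ (-p) * (N + (γ - w₀)) ^ p,
    by positivity, ⟨?_, ?_, ?_, ?_, ?_⟩, ?_, ?_⟩
  · refine contDiff_iff_contDiffAt.2 fun z => ?_
    exact (contDiffAt_source (p := p) (μ := μ) (n := 4) (t := τ z.1) (w := σ z.2)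
      (by linarith [ht z.1]) (hl _).1).comp z
      ((hτ.comp contDiff_fst).prodMk (hσ.comp contDiff_snd)).contDiffAt
  · exact fun z => source_pos hp hμ (ht _) (hl _)
  · exact fun t t' w h => source_mono_left hμ (by linarith [ht t]) (hτm h) (hl _).1
  · exact fun t w w' h => source_mono_right hp hμ (ht _) (hl _) (hσm h)
  · intro t w w'
    refine (abs_source_sub_le hp hμ (ht _) hw₀ (hw w) (hw w')).trans ?_
    have := hσl w w'
    gcongr
  · intro z
    rw [abs_of_pos (source_pos hp hμ (ht _) (hl _))]
    refine (source_le hμ (by linarith [ht z.1]) (hl _).1).trans ?_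
    have := Real.rpow_le_rpow (hl z.2).1.le (hw z.2).2 (by linarith : 0 ≤ p)
    gcongr
  · intro t ht w hw
    simp only [hτid t ht, hσid w hw]

theorem IsMonotoneSource.fderiv_bounds {L : ℝ} {G : ℝ × ℝ → ℝ} (hG : IsMonotoneSource L G)
    (z : ℝ × ℝ) : 0 ≤ fderiv ℝ G z (1, 0) ∧ 0 ≤ fderiv ℝ G z (0, 1) ∧ fderiv ℝ G z (0, 1) ≤ L := by
  have hd := (hG.contDiff.differentiable (by norm_num) z).hasFDerivAt
  have h1 : HasDerivAt (fun t => G (t, z.2)) (fderiv ℝ G z (1, 0)) z.1 :=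
    HasFDerivAt.comp_hasDerivAt (f := fun t => (t, z.2)) z.1 hd
      ((hasDerivAt_id _).prodMk (hasDerivAt_const _ _))
  have h2 : HasDerivAt (fun w => G (z.1, w)) (fderiv ℝ G z (0, 1)) z.2 :=
    HasFDerivAt.comp_hasDerivAt (f := fun w => (z.1, w)) z.2 hd
      ((hasDerivAt_const _ _).prodMk (hasDerivAt_id _))
  have m1 : Monotone fun t => G (t, z.2) := fun t t' h => hG.mono_left t t' z.2 h
  have m2 : Monotone fun w => G (z.1, w) := fun w w' h => hG.mono_right z.1 w w' h
  have hL : 0 ≤ L := by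
    have := hG.lip 0 1 0
    rw [sub_zero, abs_one, mul_one] at this
    exact (abs_nonneg _).trans this
  refine ⟨?_, ?_, ?_⟩
  · rw [← h1.deriv]; exact m1.deriv_nonneg
  · rw [← h2.deriv]; exact m2.deriv_nonneg
  · refine (le_abs_self _).trans ?_
    exact h2.le_of_lip' hL (Eventually.of_forall fun w => hG.lip _ _ _)

end TruncatedSource

section Calculus

theorem fderiv_fderiv_comm {φ : ℝ × ℝ → ℝ} {z : ℝ × ℝ} (h : ContDiffAt ℝ 2 φ z) (u v : ℝ × ℝ) :
    fderiv ℝ (fun y => fderiv ℝ φ y u) z v = fderiv ℝ (fun y => fderiv ℝ φ y v) z u := by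
  have hd : DifferentiableAt ℝ (fderiv ℝ φ) z :=
    (h.fderiv_right (m := 1) (by norm_num)).differentiableAt one_ne_zero
  have key : ∀ u v, fderiv ℝ (fun y => fderiv ℝ φ y u) z v = fderiv ℝ (fderiv ℝ φ) z v u := by
    intro u v
    rw [fderiv_clm_apply hd (differentiableAt_const u)]
    simp
  rw [key, key]
  exact (h.isSymmSndFDerivAt (by simp)) v u

theorem differentiableAt_fderiv_apply {φ : ℝ × ℝ → ℝ} {z : ℝ × ℝ} (h : ContDiffAt ℝ 2 φ z)
    (u : ℝ × ℝ) : DifferentiableAt ℝ (fun y => fderiv ℝ φ y u) z :=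
  ((h.fderiv_right (m := 1) (by norm_num)).differentiableAt one_ne_zero).clm_apply
    (differentiableAt_const u)

theorem hasDerivAt_line {P : ℝ × ℝ → ℝ} {z : ℝ × ℝ} (h : DifferentiableAt ℝ P z) (u : ℝ × ℝ) :
    HasDerivAt (fun s => P (z.1 + u.1 * s, z.2 + u.2 * s)) (fderiv ℝ P z u) 0 := by
  have h1 : HasDerivAt (fun s : ℝ => (z.1 + u.1 * s, z.2 + u.2 * s)) u 0 := by
    have h2 := ((hasDerivAt_id (0 : ℝ)).const_mul u.1).const_add z.1
    have h3 := ((hasDerivAt_id (0 : ℝ)).const_mul u.2).const_add z.2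
    simpa using h2.prodMk h3
  have h4 : (z.1 + u.1 * 0, z.2 + u.2 * 0) = z := by simp
  refine HasFDerivAt.comp_hasDerivAt (f := fun s : ℝ => (z.1 + u.1 * s, z.2 + u.2 * s)) 0 ?_ h1
  rw [h4]
  exact h.hasFDerivAt

theorem hasDerivAt_minus {P : ℝ × ℝ → ℝ} {z : ℝ × ℝ} (h : DifferentiableAt ℝ P z) :
    HasDerivAt (fun s => P (z.1 - s, z.2 + s)) (fderiv ℝ P z (-1, 1)) 0 := by
  simpa only [neg_one_mul, one_mul, ← sub_eq_add_neg] using hasDerivAt_line h (-1, 1)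

theorem hasDerivAt_plus {P : ℝ × ℝ → ℝ} {z : ℝ × ℝ} (h : DifferentiableAt ℝ P z) :
    HasDerivAt (fun s => P (z.1 + s, z.2 + s)) (fderiv ℝ P z (1, 1)) 0 := by
  simpa only [one_mul] using hasDerivAt_line h (1, 1)

theorem fderiv_comp_source {G w : ℝ × ℝ → ℝ} {z : ℝ × ℝ} (hw : DifferentiableAt ℝ w z)
    (hG : DifferentiableAt ℝ G (z.2, w z)) (u : ℝ × ℝ) :
    fderiv ℝ (fun y => G (y.2, w y)) z u =
      u.2 * fderiv ℝ G (z.2, w z) (1, 0) + fderiv ℝ w z u * fderiv ℝ G (z.2, w z) (0, 1) := by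
  have h1 : HasFDerivAt (fun y : ℝ × ℝ => (y.2, w y))
      ((ContinuousLinearMap.snd ℝ ℝ ℝ).prod (fderiv ℝ w z)) z :=
    hasFDerivAt_snd.prodMk hw.hasFDerivAt
  have h2 := HasFDerivAt.comp (f := fun y : ℝ × ℝ => (y.2, w y)) z hG.hasFDerivAt h1
  have h3 : fderiv ℝ (fun y => G (y.2, w y)) z = _ := h2.fderiv
  rw [h3]
  have h4 : ((ContinuousLinearMap.snd ℝ ℝ ℝ).prod (fderiv ℝ w z)) u =
      u.2 • ((1, 0) : ℝ × ℝ) + (fderiv ℝ w z u) • ((0, 1) : ℝ × ℝ) := by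
    ext <;> simp
  rw [ContinuousLinearMap.comp_apply, h4, map_add, map_smul, map_smul, smul_eq_mul, smul_eq_mul]

end Calculus

section Truncated

variable {L : ℝ} {G φ ψ : ℝ × ℝ → ℝ} {f g : ℝ → ℝ}

/-- A classical solution of `D₋ φ = D₊ ψ = G (t, φ + ψ)` on the plane. -/
structure IsClassical (G : ℝ × ℝ → ℝ) (f g : ℝ → ℝ) (φ ψ : ℝ × ℝ → ℝ) : Prop where
  smooth_left : ContDiff ℝ 4 φ
  smooth_right : ContDiff ℝ 4 ψ
  init_left : ∀ x, φ (x, 0) = f x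
  init_right : ∀ x, ψ (x, 0) = g x
  eq_left : ∀ z, Dminus φ z = G (z.2, φ z + ψ z)
  eq_right : ∀ z, Dplus ψ z = G (z.2, φ z + ψ z)

theorem fderiv_eq_deriv_initial {φ : ℝ × ℝ → ℝ} {f : ℝ → ℝ} (hφ : Differentiable ℝ φ)
    (h : ∀ x, φ (x, 0) = f x) (x : ℝ) : fderiv ℝ φ (x, 0) (1, 0) = deriv f x := by
  have h1 : HasDerivAt (fun y => φ (y, 0)) (fderiv ℝ φ (x, 0) (1, 0)) x :=
    HasFDerivAt.comp_hasDerivAt (f := fun y => (y, (0 : ℝ))) x (hφ (x, 0)).hasFDerivAt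
      ((hasDerivAt_id _).prodMk (hasDerivAt_const _ _))
  rw [← h1.deriv]
  simp only [h]

theorem IsClassical.cone_condition (hG : IsMonotoneSource L G) (h : IsClassical G f g φ ψ) {k : ℝ}
    (hf : ∀ x, (1 + k) * |deriv f x| ≤ G (0, f x + g x))
    (hg : ∀ x, (1 + k) * |deriv g x| ≤ G (0, f x + g x)) {σ : ℝ} (hσ : |σ| ≤ k) {z : ℝ × ℝ}
    (hz : 0 ≤ z.2) : 0 ≤ fderiv ℝ φ z (σ, 1) ∧ 0 ≤ fderiv ℝ ψ z (σ, 1) := by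
  have hφd : Differentiable ℝ φ := h.smooth_left.differentiable (by norm_num)
  have hψd : Differentiable ℝ ψ := h.smooth_right.differentiable (by norm_num)
  have hφ2 : ∀ z, ContDiffAt ℝ 2 φ z := fun z => (h.smooth_left.of_le (by norm_num)).contDiffAt
  have hψ2 : ∀ z, ContDiffAt ℝ 2 ψ z := fun z => (h.smooth_right.of_le (by norm_num)).contDiffAt
  have hGd : Differentiable ℝ G := hG.contDiff.differentiable (by norm_num)
  have hsrc : ∀ z : ℝ × ℝ, fderiv ℝ (fun y : ℝ × ℝ => G (y.2, φ y + ψ y)) z (σ, 1) =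
      fderiv ℝ G (z.2, φ z + ψ z) (1, 0) + (fderiv ℝ φ z (σ, 1) + fderiv ℝ ψ z (σ, 1)) *
        fderiv ℝ G (z.2, φ z + ψ z) (0, 1) := by
    intro z
    rw [fderiv_comp_source (w := fun y => φ y + ψ y) ((hφd z).add (hψd z)) (hGd _) (σ, 1)]
    have h5 : fderiv ℝ (fun y => φ y + ψ y) z = fderiv ℝ φ z + fderiv ℝ ψ z :=
      fderiv_add (hφd z) (hψd z)
    rw [h5, one_mul]; rfl
  have hσ' := abs_le.1 hσ
  have alg : ∀ P Q m e : ℝ, 0 ≤ e → 0 ≤ m → m ≤ L → P < 0 → P ≤ Q →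
      2 * L * P ≤ e + (P + Q) * m := by
    intro P Q m e he hm hmL hP hPQ
    nlinarith
  refine nonneg_of_transport_ineq (L := 2 * L) (P := fun z => fderiv ℝ φ z (σ, 1))
    (Q := fun z => fderiv ℝ ψ z (σ, 1)) (z₀ := z) ?_ ?_ ?_ ?_ ?_ ?_ (self_mem_closedCone hz)
  · exact fun y _ => (differentiableAt_fderiv_apply (hφ2 y) _).continuousAt.continuousWithinAt
  · exact fun y _ => (differentiableAt_fderiv_apply (hψ2 y) _).continuousAt.continuousWithinAt
  · rintro ⟨x, t⟩ - (rfl : t = 0)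
    have h1 : ((σ, 1) : ℝ × ℝ) = (-1, 1) + (1 + σ) • (1, 0) := by ext <;> simp
    have h2 : fderiv ℝ φ (x, 0) (-1, 1) = G (0, f x + g x) := by
      rw [← h.init_left, ← h.init_right]; exact h.eq_left (x, 0)
    rw [h1, map_add, map_smul, h2, fderiv_eq_deriv_initial hφd h.init_left, smul_eq_mul]
    have h3 := hf x
    have h4 := abs_nonneg (deriv f x)
    have h5 : |(1 + σ) * deriv f x| ≤ (1 + k) * |deriv f x| := by
      rw [abs_mul]; gcongr; exact abs_le.2 ⟨by linarith, by linarith⟩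
    linarith [neg_abs_le ((1 + σ) * deriv f x)]
  · rintro ⟨x, t⟩ - (rfl : t = 0)
    have h1 : ((σ, 1) : ℝ × ℝ) = (1, 1) + (σ - 1) • (1, 0) := by ext <;> simp
    have h2 : fderiv ℝ ψ (x, 0) (1, 1) = G (0, f x + g x) := by
      rw [← h.init_left, ← h.init_right]; exact h.eq_right (x, 0)
    rw [h1, map_add, map_smul, h2, fderiv_eq_deriv_initial hψd h.init_right, smul_eq_mul]
    have h3 := hg x
    have h4 := abs_nonneg (deriv g x)
    have h5 : |(σ - 1) * deriv g x| ≤ (1 + k) * |deriv g x| := by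
      rw [abs_mul]; gcongr; exact abs_le.2 ⟨by linarith, by linarith⟩
    linarith [neg_abs_le ((σ - 1) * deriv g x)]
  · intro y _ _ hneg hle
    refine ⟨_, hasDerivAt_minus (differentiableAt_fderiv_apply (hφ2 y) (σ, 1)), ?_⟩
    have h1 : (fun y => fderiv ℝ φ y (-1, 1)) = fun y : ℝ × ℝ => G (y.2, φ y + ψ y) :=
      funext h.eq_left
    rw [fderiv_fderiv_comm (hφ2 y), h1, hsrc]
    obtain ⟨g1, g2, g3⟩ := hG.fderiv_bounds (y.2, φ y + ψ y)
    exact alg _ _ _ _ g1 g2 g3 hneg hle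
  · intro y _ _ hneg hle
    refine ⟨_, hasDerivAt_plus (differentiableAt_fderiv_apply (hψ2 y) (σ, 1)), ?_⟩
    have h1 : (fun y => fderiv ℝ ψ y (1, 1)) = fun y : ℝ × ℝ => G (y.2, φ y + ψ y) :=
      funext h.eq_right
    rw [fderiv_fderiv_comm (hψ2 y), h1, hsrc, add_comm (fderiv ℝ φ y (σ, 1))]
    obtain ⟨g1, g2, g3⟩ := hG.fderiv_bounds (y.2, φ y + ψ y)
    exact alg _ _ _ _ g1 g2 g3 hneg hle

theorem IsClassical.lower_bound (hG : IsMonotoneSource L G) (h : IsClassical G f g φ ψ)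
    {γ₁ γ₂ : ℝ} (hf : ∀ x, γ₁ ≤ f x) (hg : ∀ x, γ₂ ≤ g x) {z : ℝ × ℝ} (hz : 0 ≤ z.2) :
    γ₁ ≤ φ z ∧ γ₂ ≤ ψ z := by
  have hφd : Differentiable ℝ φ := h.smooth_left.differentiable (by norm_num)
  have hψd : Differentiable ℝ ψ := h.smooth_right.differentiable (by norm_num)
  have hφc := hφd.continuous
  have hψc := hψd.continuous
  have key := nonneg_of_transport_ineq (L := 0) (P := fun z => φ z - γ₁) (Q := fun z => ψ z - γ₂)
    (z₀ := z) (by fun_prop) (by fun_prop) ?_ ?_ ?_ ?_ (self_mem_closedCone hz)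
  · exact ⟨by linarith [key.1], by linarith [key.2]⟩
  · rintro ⟨x, t⟩ - (rfl : t = 0)
    simp only [h.init_left]; linarith [hf x]
  · rintro ⟨x, t⟩ - (rfl : t = 0)
    simp only [h.init_right]; linarith [hg x]
  · intro y _ _ _ _
    refine ⟨_, (hasDerivAt_minus (hφd y)).sub_const γ₁, ?_⟩
    have h1 := h.eq_left y
    rw [Dminus] at h1
    rw [h1, zero_mul]; exact (hG.pos _).le
  · intro y _ _ _ _
    refine ⟨_, (hasDerivAt_plus (hψd y)).sub_const γ₂, ?_⟩
    have h1 := h.eq_right y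
    rw [Dplus] at h1
    rw [h1, zero_mul]; exact (hG.pos _).le

/-- Comparison with a spatially homogeneous subsolution. -/
theorem IsClassical.comparison (hG : IsMonotoneSource L G) (h : IsClassical G f g φ ψ)
    {a b a' : ℝ → ℝ} {x₀ t₀ : ℝ} (ht₀ : 0 ≤ t₀) (ha : ContinuousOn a (Icc 0 t₀))
    (hb : ContinuousOn b (Icc 0 t₀)) (hf : ∀ x, a 0 ≤ f x) (hg : ∀ x, b 0 ≤ g x)
    (had : ∀ t ∈ Ioc 0 t₀, HasDerivAt a (a' t) t ∧ HasDerivAt b (a' t) t)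
    (hle : ∀ t ∈ Ioc 0 t₀, a' t ≤ G (t, a t + b t)) :
    a t₀ ≤ φ (x₀, t₀) ∧ b t₀ ≤ ψ (x₀, t₀) := by
  have hφd : Differentiable ℝ φ := h.smooth_left.differentiable (by norm_num)
  have hψd : Differentiable ℝ ψ := h.smooth_right.differentiable (by norm_num)
  have hφc := hφd.continuous
  have hψc := hψd.continuous
  have hmem : ∀ z ∈ closedCone (x₀, t₀), z.2 ∈ Icc 0 t₀ := fun z hz =>
    ⟨hz.1, by have := (abs_nonneg _).trans hz.2; simpa using this⟩
  have hL : 0 ≤ L := by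
    have := hG.fderiv_bounds 0
    exact this.2.1.trans this.2.2
  have alg : ∀ t w W P Q : ℝ, P + Q = w - W → P < 0 → P ≤ Q → a' t ≤ G (t, W) →
      2 * L * P ≤ G (t, w) - a' t := by
    intro t w W P Q hPQ hP hle hGa
    rcases le_total W w with hw | hw
    · have h1 := hG.mono_right t W w hw
      nlinarith
    · have h1 := (abs_le.1 (hG.lip t w W)).1
      rw [abs_of_nonpos (by linarith)] at h1
      nlinarith
  have key := nonneg_of_transport_ineq (L := 2 * L) (P := fun z => φ z - a z.2)
    (Q := fun z => ψ z - b z.2) (z₀ := (x₀, t₀)) ?_ ?_ ?_ ?_ ?_ ?_ (self_mem_closedCone ht₀)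
  · exact ⟨by linarith [key.1], by linarith [key.2]⟩
  · exact hφc.continuousOn.sub (ha.comp continuous_snd.continuousOn hmem)
  · exact hψc.continuousOn.sub (hb.comp continuous_snd.continuousOn hmem)
  · rintro ⟨x, t⟩ - (rfl : t = 0)
    simp only [h.init_left]; linarith [hf x]
  · rintro ⟨x, t⟩ - (rfl : t = 0)
    simp only [h.init_right]; linarith [hg x]
  · intro y hy hy0 hneg hle'
    have hyt : y.2 ∈ Ioc 0 t₀ := ⟨hy0, (hmem y hy).2⟩
    have h1 : HasDerivAt (fun s => a (y.2 + s)) (a' y.2) 0 :=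
      HasDerivAt.comp_const_add y.2 0 (by rw [add_zero]; exact (had _ hyt).1)
    refine ⟨_, (hasDerivAt_minus (hφd y)).sub h1, ?_⟩
    have h2 := h.eq_left y
    rw [Dminus] at h2
    rw [h2]
    exact alg y.2 _ (a y.2 + b y.2) _ (ψ y - b y.2) (by ring) hneg hle' (hle _ hyt)
  · intro y hy hy0 hneg hle'
    have hyt : y.2 ∈ Ioc 0 t₀ := ⟨hy0, (hmem y hy).2⟩
    have h1 : HasDerivAt (fun s => b (y.2 + s)) (a' y.2) 0 :=
      HasDerivAt.comp_const_add y.2 0 (by rw [add_zero]; exact (had _ hyt).2)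
    refine ⟨_, (hasDerivAt_plus (hψd y)).sub h1, ?_⟩
    have h2 := h.eq_right y
    rw [Dplus] at h2
    rw [h2]
    exact alg y.2 _ (a y.2 + b y.2) _ (φ y - a y.2) (by ring) hneg hle' (hle _ hyt)

end Truncated
end BlowupCurve

namespace BlowupCurve

section ODE

variable {p μ : ℝ}

theorem odeSource_pos (hp : 1 < p) (hμ : 0 < μ) {w : ℝ} (hw : IsLarge p μ w) :
    0 < odeSource p μ w := by
  have h := source_pos hp hμ (t := 0) (by norm_num) hw
  unfold source at h
  unfold odeSource
  rw [add_zero, div_one] at h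
  linarith

theorem mul_sub_le_odeSource (hp : 1 < p) (hμ : 0 < μ) {γ w : ℝ} (hγ : IsLarge p μ γ)
    (hw : w < γ) : 2 * (p * ((2 : ℝ) ^ (-p) * γ ^ (p - 1))) * (w - γ) ≤ 2 * odeSource p μ w := by
  have hγ0 := hγ.1
  have h1 := odeSource_pos hp hμ hγ
  have h2 : (0 : ℝ) < 2 ^ (-p) := by positivity
  rcases le_or_gt w 0 with h | h
  · have h3 : 0 ≤ odeSource p μ w := by
      unfold odeSource
      have : 0 ≤ (2 : ℝ) ^ (-p) * |w| ^ p := by positivity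
      nlinarith
    have h4 : 0 ≤ p * ((2 : ℝ) ^ (-p) * γ ^ (p - 1)) := by positivity
    nlinarith
  · have hb := one_add_mul_self_le_rpow_one_add (s := w / γ - 1) (p := p)
      (by have : 0 < w / γ := by positivity
          linarith) hp.le
    rw [add_sub_cancel, Real.div_rpow h.le hγ0.le, le_div_iff₀ (by positivity)] at hb
    have h5 : (1 + p * (w / γ - 1)) * γ ^ p = γ ^ p + p * γ ^ (p - 1) * (w - γ) := by
      rw [rpow_eq_mul_rpow_sub_one hγ0]; field_simp
    rw [h5] at hb
    unfold odeSource at h1 ⊢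
    rw [abs_of_pos hγ0] at h1
    rw [abs_of_pos h]
    have h6 := mul_le_mul_of_nonneg_left hb h2.le
    nlinarith

theorem IsODEBlowupTime.exists_level (hp : 1 < p) (hμ : 0 < μ) {γ₁ γ₂ T₁ N : ℝ}
    (hγ : IsLarge p μ (γ₁ + γ₂)) (h : IsODEBlowupTime p μ γ₁ γ₂ T₁) (hN : γ₁ + γ₂ < N) :
    ∃ (a b : ℝ → ℝ) (t₀ : ℝ), 0 ≤ t₀ ∧ t₀ < T₁ ∧ ContinuousOn a (Icc 0 t₀) ∧
      ContinuousOn b (Icc 0 t₀) ∧ a 0 = γ₁ ∧ b 0 = γ₂ ∧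
      (∀ t ∈ Ioc 0 t₀, HasDerivAt a (odeSource p μ (a t + b t)) t ∧
        HasDerivAt b (odeSource p μ (a t + b t)) t) ∧
      a t₀ + b t₀ = N ∧ ∀ t ∈ Icc 0 t₀, a t + b t ∈ Icc (γ₁ + γ₂) N := by
  obtain ⟨hT, a, b, ha, hb, ha0, hb0, hd, hlim⟩ := h
  have hW : ContinuousOn (fun t => a t + b t) (Ico 0 T₁) := ha.add hb
  have hWd : ∀ t ∈ Ioo 0 T₁,
      HasDerivAt (fun t => a t + b t) (2 * odeSource p μ (a t + b t)) t := fun t ht =>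
    ((hd t ht).1.add (hd t ht).2).congr_deriv (by ring)
  have hlow : ∀ t ∈ Ico 0 T₁, γ₁ + γ₂ ≤ a t + b t := by
    intro t ht
    have hmem : ∀ z ∈ closedCone (0, t), z.2 ∈ Icc 0 t := fun z hz =>
      ⟨hz.1, by have := (abs_nonneg _).trans hz.2; simpa using this⟩
    have hc : ContinuousOn (fun z : ℝ × ℝ => a z.2 + b z.2 - (γ₁ + γ₂)) (closedCone (0, t)) :=
      (hW.comp continuous_snd.continuousOn fun z hz =>
        ⟨(hmem z hz).1, (hmem z hz).2.trans_lt ht.2⟩).sub continuousOn_const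
    have h0 : ∀ z ∈ closedCone ((0 : ℝ), t), z.2 = 0 → 0 ≤ a z.2 + b z.2 - (γ₁ + γ₂) := by
      intro z _ hz
      rw [hz, ha0, hb0, sub_self]
    have hder : ∀ z ∈ closedCone ((0 : ℝ), t), 0 < z.2 → a z.2 + b z.2 - (γ₁ + γ₂) < 0 →
        ∃ d, HasDerivAt (fun s => a (z.2 + s) + b (z.2 + s) - (γ₁ + γ₂)) d 0 ∧
          2 * (p * ((2 : ℝ) ^ (-p) * (γ₁ + γ₂) ^ (p - 1))) * (a z.2 + b z.2 - (γ₁ + γ₂)) ≤ d := by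
      intro z hz hz0 hneg
      have h1 := hWd z.2 ⟨hz0, (hmem z hz).2.trans_lt ht.2⟩
      have h2 : HasDerivAt (fun s => a (z.2 + s) + b (z.2 + s))
          (2 * odeSource p μ (a z.2 + b z.2)) 0 :=
        HasDerivAt.comp_const_add z.2 0 (by rw [add_zero]; exact h1)
      exact ⟨_, h2.sub_const _, mul_sub_le_odeSource hp hμ hγ (by linarith)⟩
    have := (nonneg_of_transport_ineq hc hc h0 h0 (fun z hz hz0 hneg _ => hder z hz hz0 hneg)
      (fun z hz hz0 hneg _ => hder z hz hz0 hneg) (self_mem_closedCone (z := (0, t)) ht.1)).1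
    simpa using this
  have hmono : MonotoneOn (fun t => a t + b t) (Ico 0 T₁) := by
    refine monotoneOn_of_deriv_nonneg (convex_Ico 0 T₁) hW ?_ ?_ <;> rw [interior_Ico]
    · exact fun t ht => (hWd t ht).differentiableAt.differentiableWithinAt
    · intro t ht
      rw [(hWd t ht).deriv]
      have := odeSource_pos hp hμ (hγ.mono hp (hlow t ⟨ht.1.le, ht.2⟩))
      positivity
  obtain ⟨t₁, ht₁, hNt⟩ : ∃ t₁ ∈ Ioo 0 T₁, N < a t₁ + b t₁ := by
    have h1 := (hlim.eventually (eventually_gt_atTop N)).and (Ioo_mem_nhdsLT hT)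
    obtain ⟨t, h2, h3⟩ := h1.exists
    exact ⟨t, h3, h2⟩
  obtain ⟨t₀, ht₀, hWt⟩ : N ∈ (fun t => a t + b t) '' Icc 0 t₁ := by
    refine intermediate_value_Icc ht₁.1.le (hW.mono fun t ht => ⟨ht.1, ht.2.trans_lt ht₁.2⟩) ?_
    exact ⟨by simp only [ha0, hb0]; exact hN.le, hNt.le⟩
  have ht₀T : t₀ < T₁ := ht₀.2.trans_lt ht₁.2
  have hsub : Icc 0 t₀ ⊆ Ico 0 T₁ := fun t ht => ⟨ht.1, ht.2.trans_lt ht₀T⟩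
  refine ⟨a, b, t₀, ht₀.1, ht₀T, ha.mono hsub, hb.mono hsub, ha0, hb0,
    fun t ht => hd t ⟨ht.1, ht.2.trans_lt ht₀T⟩, hWt, fun t ht => ⟨hlow t (hsub ht), ?_⟩⟩
  rw [← hWt]
  exact hmono (hsub ht) ⟨ht₀.1, ht₀T⟩ ht.2

end ODE

section LevelSolutions

/-- Globally defined data satisfying the size and slope conditions. -/
structure IsData (p μ k γ₁ γ₂ : ℝ) (f g : ℝ → ℝ) : Prop where
  smooth_left : ContDiff ℝ 4 f
  smooth_right : ContDiff ℝ 4 g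
  bounded : ∃ D, ∀ x, |f x| ≤ D ∧ |g x| ≤ D
  lower : ∀ x, γ₁ ≤ f x ∧ γ₂ ≤ g x
  slope : ∀ x, (1 + k) * |deriv f x| ≤ odeSource p μ (γ₁ + γ₂) ∧
    (1 + k) * |deriv g x| ≤ odeSource p μ (γ₁ + γ₂)

/-- A smooth pair `(φ, ψ)` which solves the system below the curve `t = τ x` on which
`φ + ψ = N`. -/
structure IsLevelSolution (p μ k γ₁ γ₂ T₁ : ℝ) (f g : ℝ → ℝ) (N : ℝ) (φ ψ : ℝ × ℝ → ℝ)
    (τ : ℝ → ℝ) : Prop where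
  smooth_left : ContDiff ℝ 4 φ
  smooth_right : ContDiff ℝ 4 ψ
  init_left : ∀ x, φ (x, 0) = f x
  init_right : ∀ x, ψ (x, 0) = g x
  time_pos : ∀ x, 0 < τ x
  time_lt : ∀ x, τ x < T₁
  level : ∀ x, φ (x, τ x) + ψ (x, τ x) = N
  le_level : ∀ x t, 0 ≤ t → t ≤ τ x → φ (x, t) + ψ (x, t) ≤ N
  lip : ∀ x y, k * |τ x - τ y| ≤ |x - y|
  eq_left : ∀ z : ℝ × ℝ, 0 ≤ z.2 → z.2 ≤ τ z.1 → Dminus φ z = source p μ z.2 (φ z + ψ z)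
  eq_right : ∀ z : ℝ × ℝ, 0 ≤ z.2 → z.2 ≤ τ z.1 → Dplus ψ z = source p μ z.2 (φ z + ψ z)
  cone : ∀ z : ℝ × ℝ, 0 ≤ z.2 → ∀ σ, |σ| ≤ k → 0 ≤ fderiv ℝ φ z (σ, 1) ∧ 0 ≤ fderiv ℝ ψ z (σ, 1)
  lower : ∀ z : ℝ × ℝ, 0 ≤ z.2 → γ₁ ≤ φ z ∧ γ₂ ≤ ψ z

variable {p μ k γ₁ γ₂ T₁ : ℝ} {f g : ℝ → ℝ}

theorem exists_levelSolution (hp : 1 < p) (hμ : 0 < μ) (hk : 1 ≤ k) {w₀ : ℝ}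
    (hw₀ : IsLarge p μ w₀) (hγw : w₀ < γ₁ + γ₂) (hT : IsODEBlowupTime p μ γ₁ γ₂ T₁)
    (hdata : IsData p μ k γ₁ γ₂ f g) {N : ℝ} (hN : ∀ x, f x + g x < N) :
    ∃ φ ψ τ, IsLevelSolution p μ k γ₁ γ₂ T₁ f g N φ ψ τ := by
  have hk0 : 0 < k := by linarith
  have hγ : IsLarge p μ (γ₁ + γ₂) := hw₀.mono hp hγw.le
  have hγN : γ₁ + γ₂ < N := by linarith [hN 0, (hdata.lower 0).1, (hdata.lower 0).2]
  obtain ⟨G, L, C, hL, hG, hGC, hGs⟩ := exists_truncated_source hp hμ hw₀ hγw hγN hT.1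
  obtain ⟨D, hD⟩ := hdata.bounded
  obtain ⟨φ, ψ, hφ, hψ, hφ0, hψ0, hφe, hψe⟩ := exists_classical_solution (k := 4) (by norm_num) hL
    hdata.smooth_left hdata.smooth_right (fun y => (hD y).1) (fun y => (hD y).2) hG.contDiff hGC
    hG.lip
  have hcl : IsClassical G f g φ ψ := ⟨hφ, hψ, hφ0, hψ0, hφe, hψe⟩
  have hφd : Differentiable ℝ φ := hφ.differentiable (by norm_num)
  have hψd : Differentiable ℝ ψ := hψ.differentiable (by norm_num)
  have hwd : Differentiable ℝ fun z => φ z + ψ z := hφd.add hψd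
  have hwc := hwd.continuous
  have hG0 : ∀ x, odeSource p μ (γ₁ + γ₂) ≤ G (0, f x + g x) := by
    intro x
    have h1 : γ₁ + γ₂ ≤ f x + g x := by linarith [(hdata.lower x).1, (hdata.lower x).2]
    refine le_trans ?_ (hG.mono_right 0 (γ₁ + γ₂) _ h1)
    rw [hGs 0 ⟨le_rfl, hT.1.le⟩ _ ⟨le_rfl, hγN.le⟩]
    exact odeSource_le_source hμ le_rfl hγ.1
  have hcone : ∀ z : ℝ × ℝ, 0 ≤ z.2 → ∀ σ, |σ| ≤ k →
      0 ≤ fderiv ℝ φ z (σ, 1) ∧ 0 ≤ fderiv ℝ ψ z (σ, 1) := fun z hz σ hσ =>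
    hcl.cone_condition hG (fun x => (hdata.slope x).1.trans (hG0 x))
      (fun x => (hdata.slope x).2.trans (hG0 x)) hσ hz
  have hlow : ∀ z : ℝ × ℝ, 0 ≤ z.2 → γ₁ ≤ φ z ∧ γ₂ ≤ ψ z := fun z hz =>
    hcl.lower_bound hG (fun x => (hdata.lower x).1) (fun x => (hdata.lower x).2) hz
  have hfw : ∀ z u, fderiv ℝ (fun z => φ z + ψ z) z u = fderiv ℝ φ z u + fderiv ℝ ψ z u := by
    intro z u
    have : fderiv ℝ (fun z => φ z + ψ z) z = fderiv ℝ φ z + fderiv ℝ ψ z :=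
      fderiv_add (hφd z) (hψd z)
    rw [this]; rfl
  have hwt : ∀ z : ℝ × ℝ, 0 ≤ z.2 → 0 < fderiv ℝ (fun z => φ z + ψ z) z (0, 1) := by
    intro z hz
    have h1 := (hcone z hz 1 (by simpa using hk)).1
    have h2 := (hcone z hz (-1) (by simpa using hk)).2
    have h3 : fderiv ℝ φ z (-1, 1) = G (z.2, φ z + ψ z) := hφe z
    have h4 : fderiv ℝ ψ z (1, 1) = G (z.2, φ z + ψ z) := hψe z
    have h5 : ∀ φ : ℝ × ℝ → ℝ, 2 * fderiv ℝ φ z (0, 1) =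
        fderiv ℝ φ z (-1, 1) + fderiv ℝ φ z (1, 1) := by
      intro φ
      rw [← map_add, ← smul_eq_mul, ← map_smul]
      congr 1; ext <;> norm_num
    have h6 := hG.pos (z.2, φ z + ψ z)
    have := h5 φ
    have := h5 ψ
    rw [hfw]; linarith
  have hdt : ∀ x t, HasDerivAt (fun t => φ (x, t) + ψ (x, t))
      (fderiv ℝ (fun z => φ z + ψ z) (x, t) (0, 1)) t := fun x t =>
    HasFDerivAt.comp_hasDerivAt (f := fun t => (x, t)) t (hwd (x, t)).hasFDerivAt
      ((hasDerivAt_const _ _).prodMk (hasDerivAt_id _))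
  have hmono : ∀ x, StrictMonoOn (fun t => φ (x, t) + ψ (x, t)) (Ici 0) := by
    intro x
    refine strictMonoOn_of_deriv_pos (convex_Ici 0) (Continuous.continuousOn (by fun_prop)) ?_
    intro t ht
    rw [interior_Ici] at ht
    rw [(hdt x t).deriv]
    exact hwt (x, t) (le_of_lt ht)
  obtain ⟨a, b, t₀, ht₀, ht₀T, ha, hb, ha0, hb0, hab, habN, habI⟩ := hT.exists_level hp hμ hγ hγN
  have hlevel : ∀ x, ∃ t ∈ Ioc 0 t₀, φ (x, t) + ψ (x, t) = N := by
    intro x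
    have hcomp := hcl.comparison hG (x₀ := x) ht₀ ha hb (fun x => by rw [ha0]; exact (hdata.lower x).1)
      (fun x => by rw [hb0]; exact (hdata.lower x).2) hab fun t ht => by
        have ht' := habI t ⟨ht.1.le, ht.2⟩
        rw [hGs t ⟨ht.1.le, ht.2.trans ht₀T.le⟩ _ ht']
        exact odeSource_le_source hμ ht.1.le (hγ.1.trans_le ht'.1)
    have h0 : φ (x, 0) + ψ (x, 0) < N := by rw [hφ0, hψ0]; exact hN x
    obtain ⟨t, ht, hNt⟩ : N ∈ (fun t => φ (x, t) + ψ (x, t)) '' Icc 0 t₀ :=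
      intermediate_value_Icc ht₀ (Continuous.continuousOn (by fun_prop))
        ⟨h0.le, by linarith [hcomp.1, hcomp.2]⟩
    refine ⟨t, ⟨lt_of_le_of_ne ht.1 ?_, ht.2⟩, hNt⟩
    rintro rfl
    exact h0.ne hNt
  choose τ hτ hτN using hlevel
  have hle : ∀ x t, 0 ≤ t → t ≤ τ x → φ (x, t) + ψ (x, t) ≤ N := by
    intro x t ht htτ
    rw [← hτN x]
    exact (hmono x).monotoneOn ht (hτ x).1.le htτ
  have hbox : ∀ z : ℝ × ℝ, 0 ≤ z.2 → z.2 ≤ τ z.1 →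
      G (z.2, φ z + ψ z) = source p μ z.2 (φ z + ψ z) := fun z hz hzτ =>
    hGs z.2 ⟨hz, hzτ.trans ((hτ z.1).2.trans ht₀T.le)⟩ _
      ⟨by linarith [(hlow z hz).1, (hlow z hz).2], hle z.1 z.2 hz hzτ⟩
  have hlip : ∀ x y, k * (τ y - τ x) ≤ |y - x| := by
    intro x y
    rcases eq_or_ne x y with rfl | hxy
    · simp
    have hyx : 0 < |y - x| := abs_pos.2 (sub_ne_zero.2 hxy.symm)
    set h := |y - x| / k with hh
    have hh0 : 0 < h := by positivity
    have hdir : ∀ s : ℝ, HasDerivAt (fun s => φ (x + (y - x) * s, τ x + h * s) +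
        ψ (x + (y - x) * s, τ x + h * s))
        (fderiv ℝ (fun z => φ z + ψ z) (x + (y - x) * s, τ x + h * s) (y - x, h)) s := by
      intro s
      refine HasFDerivAt.comp_hasDerivAt (f := fun s => (x + (y - x) * s, τ x + h * s)) s
        (hwd _).hasFDerivAt ?_
      have h2 := ((hasDerivAt_id s).const_mul (y - x)).const_add x
      have h3 := ((hasDerivAt_id s).const_mul h).const_add (τ x)
      simpa using h2.prodMk h3
    have hm : MonotoneOn (fun s => φ (x + (y - x) * s, τ x + h * s) +
        ψ (x + (y - x) * s, τ x + h * s)) (Icc 0 1) := by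
      refine monotoneOn_of_deriv_nonneg (convex_Icc 0 1) (Continuous.continuousOn (by fun_prop))
        (fun s _ => (hdir s).differentiableAt.differentiableWithinAt) fun s hs => ?_
      rw [interior_Icc] at hs
      rw [(hdir s).deriv]
      have h1 : ((y - x, h) : ℝ × ℝ) = h • ((y - x) / h, 1) := by
        ext
        · simp [mul_div_cancel₀ _ hh0.ne']
        · simp
      rw [h1, map_smul, smul_eq_mul, hfw]
      have h2 : 0 ≤ τ x + h * s := by have := (hτ x).1; have := hs.1; positivity
      have h3 := hcone (x + (y - x) * s, τ x + h * s) h2 ((y - x) / h) (by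
        rw [abs_div, abs_of_pos hh0, hh, div_div_cancel₀ hyx.ne'])
      exact mul_nonneg hh0.le (add_nonneg h3.1 h3.2)
    have h1 := hm (left_mem_Icc.2 zero_le_one) (right_mem_Icc.2 zero_le_one) zero_le_one
    simp only [mul_zero, add_zero, mul_one, add_sub_cancel, hτN] at h1
    have h2 : τ y ≤ τ x + h := by
      by_contra hlt
      push Not at hlt
      have h3 := hmono y (mem_Ici.2 (by have := (hτ x).1; positivity)) (hτ y).1.le hlt
      simp only [hτN] at h3
      linarith
    rw [← le_div_iff₀' hk0]
    linarith
  refine ⟨φ, ψ, τ, hφ, hψ, hφ0, hψ0, fun x => (hτ x).1, fun x => (hτ x).2.trans_lt ht₀T, hτN, hle,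
    fun x y => ?_, fun z hz hzτ => (hφe z).trans (hbox z hz hzτ),
    fun z hz hzτ => (hψe z).trans (hbox z hz hzτ), hcone, hlow⟩
  rcases abs_cases (τ x - τ y) with ⟨h1, -⟩ | ⟨h1, -⟩
  · rw [h1]; exact hlip y x
  · rw [h1, abs_sub_comm, neg_sub]; exact hlip x y

end LevelSolutions
end BlowupCurve

namespace BlowupCurve

section Gluing

variable {p μ k γ₁ γ₂ T₁ : ℝ} {f g : ℝ → ℝ}

theorem le_of_mem_closedCone {τ : ℝ → ℝ} (hk : 1 ≤ k) (hτ : ∀ x y, k * |τ x - τ y| ≤ |x - y|)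
    {z w : ℝ × ℝ} (hz : z.2 ≤ τ z.1) (hw : w ∈ closedCone z) : w.2 ≤ τ w.1 := by
  have h1 := hτ w.1 z.1
  have h2 := abs_nonneg (τ w.1 - τ z.1)
  have h3 : |τ w.1 - τ z.1| ≤ |w.1 - z.1| := by nlinarith
  have h4 := (abs_le.1 h3).1
  linarith [hw.2]

section TwoLevels

variable {N M : ℝ} {φ ψ φ' ψ' : ℝ × ℝ → ℝ} {τ τ' : ℝ → ℝ}

theorem IsLevelSolution.agree (hp : 1 < p) (hμ : 0 < μ) (hk : 1 ≤ k)
    (hγ : IsLarge p μ (γ₁ + γ₂)) (h : IsLevelSolution p μ k γ₁ γ₂ T₁ f g N φ ψ τ)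
    (h' : IsLevelSolution p μ k γ₁ γ₂ T₁ f g M φ' ψ' τ') {z : ℝ × ℝ} (hz : 0 ≤ z.2)
    (hzτ : z.2 ≤ τ z.1) (hzτ' : z.2 ≤ τ' z.1) : φ z = φ' z ∧ ψ z = ψ' z := by
  have hφd : Differentiable ℝ φ := h.smooth_left.differentiable (by norm_num)
  have hψd : Differentiable ℝ ψ := h.smooth_right.differentiable (by norm_num)
  have hφd' : Differentiable ℝ φ' := h'.smooth_left.differentiable (by norm_num)
  have hψd' : Differentiable ℝ ψ' := h'.smooth_right.differentiable (by norm_num)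
  have hτ : ∀ w ∈ closedCone z, w.2 ≤ τ w.1 := fun w hw => le_of_mem_closedCone hk h.lip hzτ hw
  have hτ' : ∀ w ∈ closedCone z, w.2 ≤ τ' w.1 := fun w hw =>
    le_of_mem_closedCone hk h'.lip hzτ' hw
  have hMN : γ₁ + γ₂ ≤ max N M := by
    have h1 := h.lower (z.1, τ z.1) (h.time_pos z.1).le
    have h2 := h.level z.1
    exact le_trans (by linarith) (le_max_left N M)
  have hL : 0 ≤ p * ((2 : ℝ) ^ (-p) * (max N M) ^ (p - 1)) := by
    have : 0 ≤ max N M := hγ.1.le.trans hMN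
    positivity
  refine eq_of_transport_eq (z₀ := z) hL (H := source p μ) hφd.continuous.continuousOn
    hψd.continuous.continuousOn hφd'.continuous.continuousOn hψd'.continuous.continuousOn ?_ ?_ ?_
    ?_ (self_mem_closedCone hz)
  · rintro ⟨x, t⟩ - (rfl : t = 0)
    exact ⟨by rw [h.init_left, h'.init_left], by rw [h.init_right, h'.init_right]⟩
  · intro w hw
    have l1 := h.lower w hw.1
    have l2 := h'.lower w hw.1
    refine abs_source_sub_le hp hμ (by linarith [hw.1]) hγ
      ⟨by linarith, (h.le_level w.1 w.2 hw.1 (hτ w hw)).trans (le_max_left _ _)⟩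
      ⟨by linarith, (h'.le_level w.1 w.2 hw.1 (hτ' w hw)).trans (le_max_right _ _)⟩
  · intro w hw _
    exact ⟨(hasDerivAt_minus (hφd w)).congr_deriv (h.eq_left w hw.1 (hτ w hw)),
      (hasDerivAt_minus (hφd' w)).congr_deriv (h'.eq_left w hw.1 (hτ' w hw))⟩
  · intro w hw _
    exact ⟨(hasDerivAt_plus (hψd w)).congr_deriv (h.eq_right w hw.1 (hτ w hw)),
      (hasDerivAt_plus (hψd' w)).congr_deriv (h'.eq_right w hw.1 (hτ' w hw))⟩

theorem IsLevelSolution.time_lt_time (hp : 1 < p) (hμ : 0 < μ) (hk : 1 ≤ k)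
    (hγ : IsLarge p μ (γ₁ + γ₂)) (h : IsLevelSolution p μ k γ₁ γ₂ T₁ f g N φ ψ τ)
    (h' : IsLevelSolution p μ k γ₁ γ₂ T₁ f g M φ' ψ' τ') (hNM : N < M) (x : ℝ) : τ x < τ' x := by
  by_contra hle
  push Not at hle
  have h1 := h.agree hp hμ hk hγ h' (z := (x, τ' x)) (h'.time_pos x).le hle le_rfl
  have h2 := h'.level x
  have h3 := h.le_level x (τ' x) (h'.time_pos x).le hle
  rw [h1.1, h1.2] at h3
  linarith

end TwoLevels

/-- The maximal solution: an increasing family of level solutions, and its limit. -/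
structure IsMaximalSolution (p μ k γ₁ γ₂ T₁ : ℝ) (f g : ℝ → ℝ) (N : ℕ → ℝ)
    (Φ Ψ : ℕ → ℝ × ℝ → ℝ) (τ : ℕ → ℝ → ℝ) (T : ℝ → ℝ) (φ ψ : ℝ × ℝ → ℝ) : Prop where
  level : ∀ n, IsLevelSolution p μ k γ₁ γ₂ T₁ f g (N n) (Φ n) (Ψ n) (τ n)
  tendsto_level : Tendsto N atTop atTop
  agree_level : ∀ n m, n ≤ m → ∀ z : ℝ × ℝ, 0 ≤ z.2 → z.2 ≤ τ n z.1 → Φ n z = Φ m z ∧ Ψ n z = Ψ m z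
  time_mono : ∀ x, StrictMono fun n => τ n x
  tendsto_time : ∀ x, Tendsto (fun n => τ n x) atTop (𝓝 (T x))
  agree : ∀ n, ∀ z : ℝ × ℝ, 0 ≤ z.2 → z.2 ≤ τ n z.1 → φ z = Φ n z ∧ ψ z = Ψ n z

theorem exists_maximalSolution (hp : 1 < p) (hμ : 0 < μ) (hk : 1 ≤ k) {w₀ : ℝ}
    (hw₀ : IsLarge p μ w₀) (hγw : w₀ < γ₁ + γ₂) (hT : IsODEBlowupTime p μ γ₁ γ₂ T₁)
    (hdata : IsData p μ k γ₁ γ₂ f g) :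
    ∃ N Φ Ψ τ T φ ψ, IsMaximalSolution p μ k γ₁ γ₂ T₁ f g N Φ Ψ τ T φ ψ := by
  have hγ : IsLarge p μ (γ₁ + γ₂) := hw₀.mono hp hγw.le
  obtain ⟨D, hD⟩ := hdata.bounded
  have hex : ∀ n : ℕ, ∃ φ ψ τ, IsLevelSolution p μ k γ₁ γ₂ T₁ f g (2 * D + 1 + n) φ ψ τ := by
    intro n
    refine exists_levelSolution hp hμ hk hw₀ hγw hT hdata fun x => ?_
    have h1 := (abs_le.1 (hD x).1).2
    have h2 := (abs_le.1 (hD x).2).2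
    have : (0 : ℝ) ≤ n := n.cast_nonneg
    linarith
  choose Φ Ψ τ hlev using hex
  have hmono : ∀ x, StrictMono fun n => τ n x := fun x => strictMono_nat_of_lt_succ fun n =>
    (hlev n).time_lt_time hp hμ hk hγ (hlev (n + 1)) (by push_cast; linarith) x
  have hagree : ∀ n m, n ≤ m → ∀ z : ℝ × ℝ, 0 ≤ z.2 → z.2 ≤ τ n z.1 →
      Φ n z = Φ m z ∧ Ψ n z = Ψ m z := fun n m hnm z hz hzn =>
    (hlev n).agree hp hμ hk hγ (hlev m) hz hzn (hzn.trans ((hmono z.1).monotone hnm))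
  have hbdd : ∀ x, BddAbove (range fun n => τ n x) := fun x =>
    ⟨T₁, by rintro _ ⟨n, rfl⟩; exact ((hlev n).time_lt x).le⟩
  classical
  refine ⟨fun n => 2 * D + 1 + n, Φ, Ψ, τ, fun x => ⨆ n, τ n x,
    fun z => if h : ∃ n, z.2 ≤ τ n z.1 then Φ (Nat.find h) z else 0,
    fun z => if h : ∃ n, z.2 ≤ τ n z.1 then Ψ (Nat.find h) z else 0, hlev,
    tendsto_atTop_add_const_left _ _ tendsto_natCast_atTop_atTop, hagree, hmono,
    fun x => tendsto_atTop_ciSup (hmono x).monotone (hbdd x), fun n z hz hzn => ?_⟩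
  have h : ∃ n, z.2 ≤ τ n z.1 := ⟨n, hzn⟩
  simp only [dif_pos h]
  exact hagree _ n (Nat.find_min' h hzn) z hz (Nat.find_spec h)

variable {N : ℕ → ℝ} {Φ Ψ : ℕ → ℝ × ℝ → ℝ} {τ : ℕ → ℝ → ℝ} {T : ℝ → ℝ} {φ ψ : ℝ × ℝ → ℝ}

theorem IsLevelSolution.continuous_time {N : ℝ} {φ ψ : ℝ × ℝ → ℝ} {τ : ℝ → ℝ} (hk : 1 ≤ k)
    (h : IsLevelSolution p μ k γ₁ γ₂ T₁ f g N φ ψ τ) : Continuous τ := by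
  refine (LipschitzWith.of_dist_le_mul (K := 1) fun x y => ?_).continuous
  rw [Real.dist_eq, Real.dist_eq, NNReal.coe_one, one_mul]
  have h1 := h.lip x y
  have h2 := abs_nonneg (τ x - τ y)
  nlinarith

namespace IsMaximalSolution

theorem time_lt (h : IsMaximalSolution p μ k γ₁ γ₂ T₁ f g N Φ Ψ τ T φ ψ) (n : ℕ) (x : ℝ) :
    τ n x < T x :=
  (h.time_mono x n.lt_succ_self).trans_le
    ((h.time_mono x).monotone.ge_of_tendsto (h.tendsto_time x) (n + 1))

theorem time_pos (h : IsMaximalSolution p μ k γ₁ γ₂ T₁ f g N Φ Ψ τ T φ ψ) (x : ℝ) : 0 < T x :=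
  ((h.level 0).time_pos x).trans (h.time_lt 0 x)

theorem time_le (h : IsMaximalSolution p μ k γ₁ γ₂ T₁ f g N Φ Ψ τ T φ ψ) (x : ℝ) : T x ≤ T₁ :=
  le_of_tendsto (h.tendsto_time x) (Eventually.of_forall fun n => ((h.level n).time_lt x).le)

theorem lip (h : IsMaximalSolution p μ k γ₁ γ₂ T₁ f g N Φ Ψ τ T φ ψ) (x y : ℝ) :
    k * |T x - T y| ≤ |x - y| :=
  le_of_tendsto ((((h.tendsto_time x).sub (h.tendsto_time y)).abs).const_mul k)
    (Eventually.of_forall fun n => (h.level n).lip x y)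

theorem continuous_time (hk : 1 ≤ k) (h : IsMaximalSolution p μ k γ₁ γ₂ T₁ f g N Φ Ψ τ T φ ψ) :
    Continuous T := by
  refine (LipschitzWith.of_dist_le_mul (K := 1) fun x y => ?_).continuous
  rw [Real.dist_eq, Real.dist_eq, NNReal.coe_one, one_mul]
  have h1 := h.lip x y
  have h2 := abs_nonneg (T x - T y)
  nlinarith

theorem exists_lt_time (h : IsMaximalSolution p μ k γ₁ γ₂ T₁ f g N Φ Ψ τ T φ ψ) {x t : ℝ}
    (ht : t < T x) : ∃ n, t < τ n x :=
  ((h.tendsto_time x).eventually (lt_mem_nhds ht)).exists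

theorem eventuallyEq (hk : 1 ≤ k) (h : IsMaximalSolution p μ k γ₁ γ₂ T₁ f g N Φ Ψ τ T φ ψ)
    {n : ℕ} {z : ℝ × ℝ} (hz : 0 < z.2) (hzn : z.2 < τ n z.1) :
    φ =ᶠ[𝓝 z] Φ n ∧ ψ =ᶠ[𝓝 z] Ψ n := by
  have hc := (h.level n).continuous_time hk
  have h1 : ∀ᶠ w : ℝ × ℝ in 𝓝 z, 0 < w.2 := continuous_snd.continuousAt.eventually (lt_mem_nhds hz)
  have h2 : ∀ᶠ w : ℝ × ℝ in 𝓝 z, w.2 < τ n w.1 :=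
    (isOpen_lt continuous_snd (hc.comp continuous_fst)).mem_nhds hzn
  constructor <;> filter_upwards [h1, h2] with w hw1 hw2
  · exact (h.agree n w hw1.le hw2.le).1
  · exact (h.agree n w hw1.le hw2.le).2

theorem level_monotone (hk : 1 ≤ k) (h : IsMaximalSolution p μ k γ₁ γ₂ T₁ f g N Φ Ψ τ T φ ψ)
    (n : ℕ) (x : ℝ) : MonotoneOn (fun t => Φ n (x, t) + Ψ n (x, t)) (Ici 0) := by
  have hφd : Differentiable ℝ (Φ n) := (h.level n).smooth_left.differentiable (by norm_num)
  have hψd : Differentiable ℝ (Ψ n) := (h.level n).smooth_right.differentiable (by norm_num)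
  have hφc := hφd.continuous
  have hψc := hψd.continuous
  have hdt : ∀ Φ : ℝ × ℝ → ℝ, Differentiable ℝ Φ → ∀ t,
      HasDerivAt (fun t => Φ (x, t)) (fderiv ℝ Φ (x, t) (0, 1)) t := fun Φ hΦ t =>
    HasFDerivAt.comp_hasDerivAt (f := fun t => (x, t)) t (hΦ (x, t)).hasFDerivAt
      ((hasDerivAt_const _ _).prodMk (hasDerivAt_id _))
  refine monotoneOn_of_deriv_nonneg (convex_Ici 0) (Continuous.continuousOn (by fun_prop))
    (fun t _ => ((hdt _ hφd t).add (hdt _ hψd t)).differentiableAt.differentiableWithinAt)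
    fun t ht => ?_
  rw [interior_Ici] at ht
  have h1 : deriv (fun t => Φ n (x, t) + Ψ n (x, t)) t = _ := ((hdt _ hφd t).add (hdt _ hψd t)).deriv
  rw [h1]
  have h2 := (h.level n).cone (x, t) (le_of_lt ht) 0 (by simp; linarith)
  exact add_nonneg h2.1 h2.2

theorem level_le (hk : 1 ≤ k) (h : IsMaximalSolution p μ k γ₁ γ₂ T₁ f g N Φ Ψ τ T φ ψ) {n : ℕ}
    {x t : ℝ} (ht : τ n x ≤ t) (htT : t < T x) : N n ≤ φ (x, t) + ψ (x, t) := by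
  obtain ⟨m, hm⟩ := h.exists_lt_time htT
  have hpos := ((h.level n).time_pos x).le
  have hnm : n ≤ m := by
    by_contra hlt
    push Not at hlt
    linarith [(h.time_mono x).monotone hlt.le]
  have h1 := h.agree m (x, t) (hpos.trans ht) hm.le
  have h2 := h.agree_level n m hnm (x, τ n x) hpos le_rfl
  rw [h1.1, h1.2, ← (h.level n).level x, h2.1, h2.2]
  exact h.level_monotone hk m x hpos (hpos.trans ht) ht

theorem tendsto_sum (hk : 1 ≤ k) (h : IsMaximalSolution p μ k γ₁ γ₂ T₁ f g N Φ Ψ τ T φ ψ)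
    (x : ℝ) : Tendsto (fun t => φ (x, t) + ψ (x, t)) (𝓝[<] (T x)) atTop := by
  refine tendsto_atTop.2 fun M => ?_
  obtain ⟨n, hn⟩ := (h.tendsto_level.eventually (eventually_ge_atTop M)).exists
  filter_upwards [Ioo_mem_nhdsLT (h.time_lt n x)] with t ht
  exact hn.trans (h.level_le hk ht.1.le ht.2)

end IsMaximalSolution

/-- Each component of a level solution controls the other. -/
theorem IsLevelSolution.component_bound (hk : 1 < k) {N : ℝ} {φ ψ : ℝ × ℝ → ℝ} {τ : ℝ → ℝ}
    (h : IsLevelSolution p μ k γ₁ γ₂ T₁ f g N φ ψ τ) {x t : ℝ} (ht : 0 ≤ t) (htτ : t ≤ τ x) :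
    (k - 1) * ψ (x, t) - 2 * k * φ (x, t) ≤ (k - 1) * g x - 2 * k * f x ∧
      (k - 1) * φ (x, t) - 2 * k * ψ (x, t) ≤ (k - 1) * f x - 2 * k * g x := by
  have hφd : Differentiable ℝ φ := h.smooth_left.differentiable (by norm_num)
  have hψd : Differentiable ℝ ψ := h.smooth_right.differentiable (by norm_num)
  have hφc := hφd.continuous
  have hψc := hψd.continuous
  have hdt : ∀ Φ : ℝ × ℝ → ℝ, Differentiable ℝ Φ → ∀ t,
      HasDerivAt (fun t => Φ (x, t)) (fderiv ℝ Φ (x, t) (0, 1)) t := fun Φ hΦ t =>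
    HasFDerivAt.comp_hasDerivAt (f := fun t => (x, t)) t (hΦ (x, t)).hasFDerivAt
      ((hasDerivAt_const _ _).prodMk (hasDerivAt_id _))
  have hkey : ∀ s ∈ Ioo 0 (τ x),
      (k - 1) * fderiv ℝ ψ (x, s) (0, 1) ≤ 2 * k * fderiv ℝ φ (x, s) (0, 1) ∧
      (k - 1) * fderiv ℝ φ (x, s) (0, 1) ≤ 2 * k * fderiv ℝ ψ (x, s) (0, 1) := by
    intro s hs
    have e1 : fderiv ℝ φ (x, s) (-1, 1) = _ := h.eq_left (x, s) hs.1.le hs.2.le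
    have e2 : fderiv ℝ ψ (x, s) (1, 1) = _ := h.eq_right (x, s) hs.1.le hs.2.le
    have c1 := h.cone (x, s) hs.1.le k (by rw [abs_of_pos]; linarith)
    have c2 := h.cone (x, s) hs.1.le (-k) (by rw [abs_neg, abs_of_pos]; linarith)
    have hlin : ∀ (Φ : ℝ × ℝ → ℝ) (σ : ℝ), fderiv ℝ Φ (x, s) (σ, 1) =
        fderiv ℝ Φ (x, s) (0, 1) + σ * fderiv ℝ Φ (x, s) (1, 0) := by
      intro Φ σ
      rw [← smul_eq_mul, ← map_smul, ← map_add]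
      congr 1; ext <;> simp
    rw [hlin φ (-1)] at e1
    rw [hlin ψ 1] at e2
    rw [hlin φ k, hlin ψ k] at c1
    rw [hlin φ (-k), hlin ψ (-k)] at c2
    have e3 := congrArg (k * ·) (e1.trans e2.symm)
    simp only [mul_add, neg_mul, one_mul, mul_neg] at e3
    have h1 : 0 ≤ (k - 1) * fderiv ℝ φ (x, s) (0, 1) := mul_nonneg (by linarith) (by linarith)
    have h2 : 0 ≤ (k - 1) * fderiv ℝ ψ (x, s) (0, 1) := mul_nonneg (by linarith) (by linarith)
    constructor <;> linarith
  have hanti : ∀ Φ Ψ : ℝ × ℝ → ℝ, Differentiable ℝ Φ → Differentiable ℝ Ψ →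
      (∀ s ∈ Ioo 0 (τ x), (k - 1) * fderiv ℝ Ψ (x, s) (0, 1) ≤ 2 * k * fderiv ℝ Φ (x, s) (0, 1)) →
      (k - 1) * Ψ (x, t) - 2 * k * Φ (x, t) ≤ (k - 1) * Ψ (x, 0) - 2 * k * Φ (x, 0) := by
    intro Φ Ψ hΦ hΨ hle
    have hΦc := hΦ.continuous
    have hΨc := hΨ.continuous
    have hd : ∀ s, HasDerivAt (fun s => (k - 1) * Ψ (x, s) - 2 * k * Φ (x, s)) _ s := fun s =>
      ((hdt Ψ hΨ s).const_mul (k - 1)).sub ((hdt Φ hΦ s).const_mul (2 * k))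
    have ha : AntitoneOn (fun s => (k - 1) * Ψ (x, s) - 2 * k * Φ (x, s)) (Icc 0 (τ x)) := by
      refine antitoneOn_of_deriv_nonpos (convex_Icc _ _) (Continuous.continuousOn (by fun_prop))
        (fun s _ => (hd s).differentiableAt.differentiableWithinAt) fun s hs => ?_
      rw [interior_Icc] at hs
      rw [(hd s).deriv]
      linarith [hle s hs]
    exact ha ⟨le_rfl, ht.trans htτ⟩ ⟨ht, htτ⟩ ht
  have h1 := hanti φ ψ hφd hψd fun s hs => (hkey s hs).1
  have h2 := hanti ψ φ hψd hφd fun s hs => (hkey s hs).2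
  rw [h.init_left, h.init_right] at h1 h2
  exact ⟨h1, h2⟩

theorem IsMaximalSolution.tendsto_components (hk : 1 < k)
    (h : IsMaximalSolution p μ k γ₁ γ₂ T₁ f g N Φ Ψ τ T φ ψ) (x : ℝ) :
    Tendsto (fun t => φ (x, t)) (𝓝[<] (T x)) atTop ∧
      Tendsto (fun t => ψ (x, t)) (𝓝[<] (T x)) atTop := by
  have hsum := h.tendsto_sum hk.le x
  have hb : ∀ t ∈ Ioo 0 (T x),
      (k - 1) * ψ (x, t) - 2 * k * φ (x, t) ≤ (k - 1) * g x - 2 * k * f x ∧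
      (k - 1) * φ (x, t) - 2 * k * ψ (x, t) ≤ (k - 1) * f x - 2 * k * g x := by
    intro t ht
    obtain ⟨n, hn⟩ := h.exists_lt_time ht.2
    have h1 := h.agree n (x, t) ht.1.le hn.le
    rw [h1.1, h1.2]
    exact (h.level n).component_bound hk ht.1.le hn.le
  have hmem := Ioo_mem_nhdsLT (h.time_pos x)
  have hk0 : 0 < 3 * k - 1 := by linarith
  have hk1 : 0 < (k - 1) / (3 * k - 1) := div_pos (by linarith) hk0
  have key : ∀ (u : ℝ → ℝ) c, (∀ t ∈ Ioo 0 (T x),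
      (k - 1) * (φ (x, t) + ψ (x, t)) - c ≤ (3 * k - 1) * u t) →
      Tendsto u (𝓝[<] (T x)) atTop := by
    intro u c hu
    have h1 : Tendsto (fun t => (k - 1) / (3 * k - 1) * (φ (x, t) + ψ (x, t)) + -c / (3 * k - 1))
        (𝓝[<] (T x)) atTop :=
      tendsto_atTop_add_const_right _ _ (hsum.const_mul_atTop hk1)
    refine tendsto_atTop_mono' _ ?_ h1
    filter_upwards [hmem] with t ht
    rw [div_mul_eq_mul_div, ← add_div, div_le_iff₀ hk0]
    linarith [hu t ht]
  refine ⟨key _ ((k - 1) * g x - 2 * k * f x) fun t ht => ?_,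
    key _ ((k - 1) * f x - 2 * k * g x) fun t ht => ?_⟩
  · linarith [(hb t ht).1]
  · linarith [(hb t ht).2]

end Gluing
end BlowupCurve

namespace BlowupCurve

section Ratios

variable {p μ : ℝ} {φ ψ : ℝ × ℝ → ℝ} {z : ℝ × ℝ}

/-- The pair `(φ, ψ)` is a twice differentiable solution of the system near the point `z`. -/
structure IsSolutionNear (p μ : ℝ) (φ ψ : ℝ × ℝ → ℝ) (z : ℝ × ℝ) : Prop where
  smooth_left : ContDiffAt ℝ 2 φ z
  smooth_right : ContDiffAt ℝ 2 ψ z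
  eq_left : Dminus φ =ᶠ[𝓝 z] fun y => source p μ y.2 (φ y + ψ y)
  eq_right : Dplus ψ =ᶠ[𝓝 z] fun y => source p μ y.2 (φ y + ψ y)
  time_nonneg : 0 ≤ z.2
  large : IsLarge p μ (φ z + ψ z)

/-- The ratio `D₊ φ / D₋ φ`. -/
noncomputable def ratioLeft (p μ : ℝ) (φ ψ : ℝ × ℝ → ℝ) (z : ℝ × ℝ) : ℝ :=
  Dplus φ z / source p μ z.2 (φ z + ψ z)

/-- The ratio `D₊ ψ / D₋ ψ`. -/
noncomputable def ratioRight (p μ : ℝ) (φ ψ : ℝ × ℝ → ℝ) (z : ℝ × ℝ) : ℝ :=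
  source p μ z.2 (φ z + ψ z) / Dminus ψ z

/-- The logarithmic derivative of the source with respect to time. -/
noncomputable def sourceDrift (p μ t w : ℝ) : ℝ := μ / (1 + t) ^ 2 * (w / 2) / source p μ t w

theorem sourceDrift_mem (hp : 1 < p) (hμ : 0 < μ) {t w : ℝ} (ht : 0 ≤ t) (hw : IsLarge p μ w) :
    sourceDrift p μ t w ∈ Icc 0 1 := by
  have h1 := source_pos hp hμ (by linarith : -(1 / 2) ≤ t) hw
  have h2 := half_le_source hp hμ ht hw
  have h3 := hw.linear_le
  have h0 := hw.1
  have h4 : μ / (1 + t) ^ 2 ≤ μ := div_le_self hμ.le (by nlinarith)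
  have h5 : 0 ≤ μ / (1 + t) ^ 2 := by positivity
  refine ⟨by unfold sourceDrift; positivity, ?_⟩
  rw [sourceDrift, div_le_one h1]
  have h6 : μ * w < μ * p * w := by nlinarith [mul_pos hμ h0]
  nlinarith

namespace IsSolutionNear

theorem source_pos (hp : 1 < p) (hμ : 0 < μ) (h : IsSolutionNear p μ φ ψ z) :
    0 < source p μ z.2 (φ z + ψ z) :=
  BlowupCurve.source_pos hp hμ (by linarith [h.time_nonneg]) h.large

theorem differentiableAt_sum (h : IsSolutionNear p μ φ ψ z) :
    DifferentiableAt ℝ (fun y => φ y + ψ y) z :=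
  (h.smooth_left.differentiableAt (by norm_num)).add (h.smooth_right.differentiableAt (by norm_num))

theorem differentiableAt_source (h : IsSolutionNear p μ φ ψ z) :
    DifferentiableAt ℝ (fun y => source p μ y.2 (φ y + ψ y)) z := by
  have h1 : DifferentiableAt ℝ (fun q : ℝ × ℝ => source p μ q.1 q.2) (z.2, φ z + ψ z) :=
    (contDiffAt_source (n := 1) (by linarith [h.time_nonneg]) h.large.1).differentiableAt
      one_ne_zero
  exact DifferentiableAt.comp (f := fun y : ℝ × ℝ => (y.2, φ y + ψ y)) z h1
    (differentiableAt_snd.prodMk h.differentiableAt_sum)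

theorem fderiv_source (h : IsSolutionNear p μ φ ψ z) (u : ℝ × ℝ) :
    fderiv ℝ (fun y => source p μ y.2 (φ y + ψ y)) z u =
      u.2 * (μ / (1 + z.2) ^ 2 * ((φ z + ψ z) / 2)) +
        (fderiv ℝ φ z u + fderiv ℝ ψ z u) * sourceSlope p μ z.2 (φ z + ψ z) := by
  have ht : -1 < z.2 := by linarith [h.time_nonneg]
  have h1 : DifferentiableAt ℝ (fun q : ℝ × ℝ => source p μ q.1 q.2) (z.2, φ z + ψ z) :=
    (contDiffAt_source (n := 1) ht h.large.1).differentiableAt one_ne_zero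
  have h2 : HasDerivAt (fun t => source p μ t (φ z + ψ z))
      (fderiv ℝ (fun q : ℝ × ℝ => source p μ q.1 q.2) (z.2, φ z + ψ z) (1, 0)) z.2 :=
    HasFDerivAt.comp_hasDerivAt (f := fun t => (t, φ z + ψ z)) z.2 h1.hasFDerivAt
      ((hasDerivAt_id _).prodMk (hasDerivAt_const _ _))
  have h3 : HasDerivAt (source p μ z.2)
      (fderiv ℝ (fun q : ℝ × ℝ => source p μ q.1 q.2) (z.2, φ z + ψ z) (0, 1)) (φ z + ψ z) :=
    HasFDerivAt.comp_hasDerivAt (f := fun w => (z.2, w)) (φ z + ψ z) h1.hasFDerivAt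
      ((hasDerivAt_const _ _).prodMk (hasDerivAt_id _))
  have h4 := fderiv_comp_source (w := fun y => φ y + ψ y) h.differentiableAt_sum h1 u
  have h5 : fderiv ℝ (fun y => φ y + ψ y) z = fderiv ℝ φ z + fderiv ℝ ψ z :=
    fderiv_add (h.smooth_left.differentiableAt (by norm_num))
      (h.smooth_right.differentiableAt (by norm_num))
  rw [h5, h2.unique (hasDerivAt_source_left ht), h3.unique (hasDerivAt_source_right h.large.1)] at h4
  exact h4

theorem hasDerivAt_ratioLeft (hp : 1 < p) (hμ : 0 < μ) (h : IsSolutionNear p μ φ ψ z)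
    (hb : Dminus ψ z ≠ 0) :
    HasDerivAt (fun s => ratioLeft p μ φ ψ (z.1 - s, z.2 + s))
      (sourceSlope p μ z.2 (φ z + ψ z) / ratioRight p μ φ ψ z *
          (ratioRight p μ φ ψ z - ratioLeft p μ φ ψ z) +
        sourceDrift p μ z.2 (φ z + ψ z) * (1 - ratioLeft p μ φ ψ z)) 0 := by
  have hF := h.source_pos hp hμ
  have h1 : HasDerivAt (fun s => Dplus φ (z.1 - s, z.2 + s)) _ 0 :=
    hasDerivAt_minus (differentiableAt_fderiv_apply h.smooth_left (1, 1))
  have h2 := hasDerivAt_minus h.differentiableAt_source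
  have h3 := h1.div h2 (by simpa using hF.ne')
  refine h3.congr_deriv ?_
  have h4 : fderiv ℝ (Dplus φ) z (-1, 1) =
      fderiv ℝ (fun y => source p μ y.2 (φ y + ψ y)) z (1, 1) := by
    rw [← h.eq_left.fderiv_eq]
    exact fderiv_fderiv_comm h.smooth_left _ _
  have e1 : fderiv ℝ φ z (-1, 1) = source p μ z.2 (φ z + ψ z) := h.eq_left.self_of_nhds
  have e2 : fderiv ℝ ψ z (1, 1) = source p μ z.2 (φ z + ψ z) := h.eq_right.self_of_nhds
  have e3 : fderiv ℝ ψ z (-1, 1) = Dminus ψ z := rfl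
  have e4 : fderiv ℝ φ z (1, 1) = Dplus φ z := rfl
  rw [h4, h.fderiv_source, h.fderiv_source, e1, e2, e3, e4]
  simp only [sub_zero, add_zero, Prod.mk.eta, ratioLeft, ratioRight, sourceDrift]
  field_simp
  ring

theorem hasDerivAt_ratioRight (hp : 1 < p) (hμ : 0 < μ) (h : IsSolutionNear p μ φ ψ z)
    (hb : Dminus ψ z ≠ 0) :
    HasDerivAt (fun s => ratioRight p μ φ ψ (z.1 + s, z.2 + s))
      (sourceSlope p μ z.2 (φ z + ψ z) * ratioRight p μ φ ψ z *
          (ratioLeft p μ φ ψ z - ratioRight p μ φ ψ z) +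
        sourceDrift p μ z.2 (φ z + ψ z) * ratioRight p μ φ ψ z * (1 - ratioRight p μ φ ψ z)) 0 := by
  have hF := h.source_pos hp hμ
  have h1 : HasDerivAt (fun s => Dminus ψ (z.1 + s, z.2 + s)) _ 0 :=
    hasDerivAt_plus (differentiableAt_fderiv_apply h.smooth_right (-1, 1))
  have h2 := hasDerivAt_plus h.differentiableAt_source
  have h3 := h2.div h1 (by simpa using hb)
  refine h3.congr_deriv ?_
  have h4 : fderiv ℝ (Dminus ψ) z (1, 1) =
      fderiv ℝ (fun y => source p μ y.2 (φ y + ψ y)) z (-1, 1) := by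
    rw [← h.eq_right.fderiv_eq]
    exact fderiv_fderiv_comm h.smooth_right _ _
  have e1 : fderiv ℝ φ z (-1, 1) = source p μ z.2 (φ z + ψ z) := h.eq_left.self_of_nhds
  have e2 : fderiv ℝ ψ z (1, 1) = source p μ z.2 (φ z + ψ z) := h.eq_right.self_of_nhds
  have e3 : fderiv ℝ ψ z (-1, 1) = Dminus ψ z := rfl
  have e4 : fderiv ℝ φ z (1, 1) = Dplus φ z := rfl
  rw [h4, h.fderiv_source, h.fderiv_source, e1, e2, e3, e4]
  simp only [add_zero, Prod.mk.eta, ratioLeft, ratioRight, sourceDrift]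
  field_simp
  ring

end IsSolutionNear

end Ratios

section Rates

variable {p μ k γ₁ γ₂ T₁ : ℝ} {f g : ℝ → ℝ} {N : ℕ → ℝ} {Φ Ψ : ℕ → ℝ × ℝ → ℝ} {τ : ℕ → ℝ → ℝ}
  {T : ℝ → ℝ} {φ ψ : ℝ × ℝ → ℝ} {z : ℝ × ℝ}

/-- The constant bounding the ratios of the characteristic derivatives. -/
noncomputable def coneRatio (k : ℝ) : ℝ := (k - 1) / (k + 1)

theorem coneRatio_pos (hk : 1 < k) : 0 < coneRatio k := div_pos (by linarith) (by linarith)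

namespace IsMaximalSolution

theorem isSolutionNear (hp : 1 < p) (hk : 1 ≤ k) (hγ : IsLarge p μ (γ₁ + γ₂))
    (h : IsMaximalSolution p μ k γ₁ γ₂ T₁ f g N Φ Ψ τ T φ ψ) (hz : 0 < z.2) (hzT : z.2 < T z.1) :
    IsSolutionNear p μ φ ψ z := by
  obtain ⟨n, hn⟩ := h.exists_lt_time hzT
  have he := h.eventuallyEq hk hz hn
  have hl := h.level n
  have ha := h.agree n z hz.le hn.le
  have hlow := hl.lower z hz.le
  have hopen : ∀ᶠ y : ℝ × ℝ in 𝓝 z, 0 < y.2 ∧ y.2 < τ n y.1 :=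
    (continuous_snd.continuousAt.eventually (lt_mem_nhds hz)).and
      ((isOpen_lt continuous_snd ((hl.continuous_time hk).comp continuous_fst)).mem_nhds hn)
  refine ⟨?_, ?_, ?_, ?_, hz.le, hγ.mono hp (by rw [ha.1, ha.2]; linarith)⟩
  · exact ((hl.smooth_left.of_le (by norm_num)).contDiffAt).congr_of_eventuallyEq he.1
  · exact ((hl.smooth_right.of_le (by norm_num)).contDiffAt).congr_of_eventuallyEq he.2
  · filter_upwards [hopen] with y hy
    have ha := h.agree n y hy.1.le hy.2.le
    rw [ha.1, ha.2, ← hl.eq_left y hy.1.le hy.2.le, Dminus, Dminus,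
      (h.eventuallyEq hk hy.1 hy.2).1.fderiv_eq]
  · filter_upwards [hopen] with y hy
    have ha := h.agree n y hy.1.le hy.2.le
    rw [ha.1, ha.2, ← hl.eq_right y hy.1.le hy.2.le, Dplus, Dplus,
      (h.eventuallyEq hk hy.1 hy.2).2.fderiv_eq]

theorem cone (hk : 1 ≤ k) (h : IsMaximalSolution p μ k γ₁ γ₂ T₁ f g N Φ Ψ τ T φ ψ)
    (hz : 0 < z.2) (hzT : z.2 < T z.1) {σ : ℝ} (hσ : |σ| ≤ k) :
    0 ≤ fderiv ℝ φ z (σ, 1) ∧ 0 ≤ fderiv ℝ ψ z (σ, 1) := by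
  obtain ⟨n, hn⟩ := h.exists_lt_time hzT
  have he := h.eventuallyEq hk hz hn
  rw [he.1.fderiv_eq, he.2.fderiv_eq]
  exact (h.level n).cone z hz.le σ hσ

theorem derivative_bounds (hp : 1 < p) (hk : 1 < k) (hγ : IsLarge p μ (γ₁ + γ₂))
    (h : IsMaximalSolution p μ k γ₁ γ₂ T₁ f g N Φ Ψ τ T φ ψ) (hz : 0 < z.2) (hzT : z.2 < T z.1) :
    (coneRatio k * source p μ z.2 (φ z + ψ z) ≤ Dplus φ z ∧
      coneRatio k * Dplus φ z ≤ source p μ z.2 (φ z + ψ z)) ∧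
    (coneRatio k * source p μ z.2 (φ z + ψ z) ≤ Dminus ψ z ∧
      coneRatio k * Dminus ψ z ≤ source p μ z.2 (φ z + ψ z)) := by
  have hs := h.isSolutionNear hp hk.le hγ hz hzT
  have e1 : fderiv ℝ φ z (-1, 1) = source p μ z.2 (φ z + ψ z) := hs.eq_left.self_of_nhds
  have e2 : fderiv ℝ ψ z (1, 1) = source p μ z.2 (φ z + ψ z) := hs.eq_right.self_of_nhds
  have c1 := h.cone hk.le hz hzT (σ := k) (by rw [abs_of_pos]; linarith)
  have c2 := h.cone hk.le hz hzT (σ := -k) (by rw [abs_neg, abs_of_pos]; linarith)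
  have hlin : ∀ (Φ : ℝ × ℝ → ℝ) (σ : ℝ), fderiv ℝ Φ z (σ, 1) =
      (1 + σ) / 2 * Dplus Φ z + (1 - σ) / 2 * fderiv ℝ Φ z (-1, 1) := by
    intro Φ σ
    unfold Dplus
    rw [← smul_eq_mul, ← smul_eq_mul, ← map_smul, ← map_smul, ← map_add]
    congr 1
    ext
    · simp; ring
    · simp; ring
  rw [hlin φ, hlin ψ] at c1 c2
  rw [← e1]
  have e3 : Dplus ψ z = fderiv ℝ φ z (-1, 1) := e2.trans e1.symm
  have e4 : fderiv ℝ ψ z (-1, 1) = Dminus ψ z := rfl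
  rw [e3, e4] at c1 c2
  have hk1 : 0 < k + 1 := by linarith
  unfold coneRatio
  simp only [div_mul_eq_mul_div, div_le_iff₀ hk1]
  refine ⟨⟨?_, ?_⟩, ?_, ?_⟩ <;> linarith

theorem ratio_mem (hp : 1 < p) (hμ : 0 < μ) (hk : 1 < k) (hγ : IsLarge p μ (γ₁ + γ₂))
    (h : IsMaximalSolution p μ k γ₁ γ₂ T₁ f g N Φ Ψ τ T φ ψ) (hz : 0 < z.2) (hzT : z.2 < T z.1) :
    0 < Dminus ψ z ∧ ratioLeft p μ φ ψ z ∈ Icc (coneRatio k) (coneRatio k)⁻¹ ∧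
      ratioRight p μ φ ψ z ∈ Icc (coneRatio k) (coneRatio k)⁻¹ := by
  obtain ⟨⟨a1, a2⟩, b1, b2⟩ := h.derivative_bounds hp hk hγ hz hzT
  have hF := (h.isSolutionNear hp hk.le hγ hz hzT).source_pos hp hμ
  have hκ := coneRatio_pos hk
  have hb : 0 < Dminus ψ z := (mul_pos hκ hF).trans_le b1
  refine ⟨hb, ⟨?_, ?_⟩, ?_, ?_⟩
  · rwa [ratioLeft, le_div_iff₀ hF]
  · rwa [ratioLeft, div_le_iff₀ hF, le_inv_mul_iff₀ hκ]
  · rwa [ratioRight, le_div_iff₀ hb]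
  · rwa [ratioRight, div_le_iff₀ hb, le_inv_mul_iff₀ hκ]

end IsMaximalSolution

end Rates
end BlowupCurve

namespace BlowupCurve

section Iteration

/-- The geometric rate at which oscillations decay. -/
noncomputable def decayRate (c C : ℝ) : ℝ := max (1 - relaxConst c C / 2) (3 / 4)

theorem decayRate_mem {c C : ℝ} (hc : 0 < c) : decayRate c C ∈ Ico 0 1 := by
  have := relaxConst_pos (C := C) hc
  exact ⟨le_max_of_le_right (by norm_num), max_lt (by linarith) (by norm_num)⟩

theorem oscillation_iterate {ρ c C E lo hi : ℝ} (hρ : 0 < ρ) (hc : 0 < c) (hE : 0 ≤ E)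
    {A B α γ : ℝ × ℝ → ℝ} (hα : ContinuousOn α (cornerSquare ρ))
    (hγ : ContinuousOn γ (cornerSquare ρ))
    (hA : ∀ w ∈ cornerSquare ρ, c ≤ A w * -(w.1 + w.2) ∧ A w * -(w.1 + w.2) ≤ C)
    (hB : ∀ w ∈ cornerSquare ρ, c ≤ B w * -(w.1 + w.2) ∧ B w * -(w.1 + w.2) ≤ C)
    (hdα : ∀ w ∈ cornerSquare ρ,
      ∃ d, HasDerivAt (fun s => α (s, w.2)) d w.1 ∧ |d - A w * (γ w - α w)| ≤ E)
    (hdγ : ∀ w ∈ cornerSquare ρ,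
      ∃ d, HasDerivAt (fun s => γ (w.1, s)) d w.2 ∧ |d - B w * (α w - γ w)| ≤ E)
    (hαb : ∀ w ∈ cornerSquare ρ, α w ∈ Icc lo hi) (hγb : ∀ w ∈ cornerSquare ρ, γ w ∈ Icc lo hi)
    (j : ℕ) :
    ∃ lo' hi', hi' - lo' ≤ (hi - lo + 8 * E * ρ) * decayRate c C ^ j ∧
      ∀ w ∈ cornerSquare (ρ / 2 ^ j), α w ∈ Icc lo' hi' ∧ γ w ∈ Icc lo' hi' := by
  have hpos : ∀ j : ℕ, 0 < ρ / 2 ^ j := fun j => by positivity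
  suffices h : ∃ lo' hi', hi' - lo' + 8 * E * (ρ / 2 ^ j) ≤
      (hi - lo + 8 * E * ρ) * decayRate c C ^ j ∧
      ∀ w ∈ cornerSquare (ρ / 2 ^ j), α w ∈ Icc lo' hi' ∧ γ w ∈ Icc lo' hi' by
    obtain ⟨lo', hi', h1, h2⟩ := h
    have := mul_nonneg hE (hpos j).le
    exact ⟨lo', hi', by linarith, h2⟩
  induction j with
  | zero =>
    refine ⟨lo, hi, by simp, fun w hw => ?_⟩
    rw [pow_zero, div_one] at hw
    exact ⟨hαb w hw, hγb w hw⟩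
  | succ j ih =>
    obtain ⟨l, h, hlh, hmem⟩ := ih
    have hsub : cornerSquare (ρ / 2 ^ j) ⊆ cornerSquare ρ :=
      cornerSquare_mono (div_le_self hρ.le (one_le_pow₀ (by norm_num)))
    obtain ⟨l', h', hlh', hmem'⟩ := oscillation_decay (hpos j) hc hE (hα.mono hsub) (hγ.mono hsub)
      (fun w hw => hA w (hsub hw)) (fun w hw => hB w (hsub hw)) (fun w hw => hdα w (hsub hw))
      (fun w hw => hdγ w (hsub hw)) (fun w hw => (hmem w hw).1) (fun w hw => (hmem w hw).2)
    have e : ρ / 2 ^ (j + 1) = ρ / 2 ^ j / 2 := by rw [pow_succ, div_div]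
    rw [e]
    refine ⟨l', h', ?_, hmem'⟩
    have hlh0 : 0 ≤ h - l := by
      have h1 : ((-(ρ / 2 ^ j), -(ρ / 2 ^ j)) : ℝ × ℝ) ∈ cornerSquare (ρ / 2 ^ j) := by
        have := hpos j
        exact ⟨⟨le_rfl, by simp only; linarith⟩, ⟨le_rfl, by simp only; linarith⟩, by
          simp only; linarith⟩
      linarith [(hmem _ h1).1.1, (hmem _ h1).1.2]
    have hEρ := mul_nonneg hE (hpos j).le
    have h1 : (1 - relaxConst c C / 2) * (h - l) ≤ decayRate c C * (h - l) :=
      mul_le_mul_of_nonneg_right (le_max_left _ _) hlh0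
    have h2 : 3 / 4 * (8 * (E * (ρ / 2 ^ j))) ≤ decayRate c C * (8 * (E * (ρ / 2 ^ j))) :=
      mul_le_mul_of_nonneg_right (le_max_right _ _) (by positivity)
    have h3 := mul_le_mul_of_nonneg_left hlh (decayRate_mem (C := C) hc).1
    rw [pow_succ]
    rw [hlh']
    linarith

end Iteration

section Rates

variable {p μ k γ₁ γ₂ T₁ : ℝ} {f g : ℝ → ℝ} {N : ℕ → ℝ} {Φ Ψ : ℕ → ℝ × ℝ → ℝ} {τ : ℕ → ℝ → ℝ}
  {T : ℝ → ℝ} {φ ψ : ℝ × ℝ → ℝ} {z : ℝ × ℝ}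

namespace IsMaximalSolution

theorem hasDerivAt_rpow_sum (hp : 1 < p) (hμ : 0 < μ) (hk : 1 < k) (hγ : IsLarge p μ (γ₁ + γ₂))
    (h : IsMaximalSolution p μ k γ₁ γ₂ T₁ f g N Φ Ψ τ T φ ψ) {x t : ℝ} (ht : 0 < t)
    (htT : t < T x) :
    ∃ d, HasDerivAt (fun t => (φ (x, t) + ψ (x, t)) ^ (1 - p)) d t ∧
      d ≤ -((p - 1) * (2 : ℝ) ^ (-p) / 2) ∧
      -((p - 1) * (2 : ℝ) ^ (-p) * (1 + (coneRatio k)⁻¹)) ≤ d := by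
  have hs := h.isSolutionNear (z := (x, t)) hp hk.le hγ ht htT
  have hw := hs.large.1
  have h1 : HasDerivAt (fun t => φ (x, t) + ψ (x, t))
      (fderiv ℝ (fun y => φ y + ψ y) (x, t) (0, 1)) t :=
    HasFDerivAt.comp_hasDerivAt (f := fun t => (x, t)) t hs.differentiableAt_sum.hasFDerivAt
      ((hasDerivAt_const _ _).prodMk (hasDerivAt_id _))
  refine ⟨_, h1.rpow_const (Or.inl hw.ne'), ?_⟩
  obtain ⟨⟨a1, a2⟩, b1, b2⟩ := h.derivative_bounds (z := (x, t)) hp hk hγ ht htT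
  have hF := hs.source_pos hp hμ
  have hκ := coneRatio_pos hk
  have l1 := half_le_source hp hμ ht.le hs.large
  have l2 := source_le (p := p) hμ (by linarith : -1 < t) hw
  have e1 : fderiv ℝ φ (x, t) (-1, 1) = source p μ t (φ (x, t) + ψ (x, t)) :=
    hs.eq_left.self_of_nhds
  have e2 : fderiv ℝ ψ (x, t) (1, 1) = source p μ t (φ (x, t) + ψ (x, t)) :=
    hs.eq_right.self_of_nhds
  have e5 : fderiv ℝ (fun y => φ y + ψ y) (x, t) = fderiv ℝ φ (x, t) + fderiv ℝ ψ (x, t) :=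
    fderiv_add (hs.smooth_left.differentiableAt (by norm_num))
      (hs.smooth_right.differentiableAt (by norm_num))
  have hlin : ∀ Φ : ℝ × ℝ → ℝ, fderiv ℝ Φ (x, t) (0, 1) =
      (fderiv ℝ Φ (x, t) (1, 1) + fderiv ℝ Φ (x, t) (-1, 1)) / 2 := by
    intro Φ
    rw [eq_div_iff two_ne_zero, mul_comm, ← smul_eq_mul, ← map_smul, ← map_add]
    congr 1
    ext <;> norm_num
  rw [e5, add_apply, hlin φ, hlin ψ, e1, e2]
  change coneRatio k * _ ≤ fderiv ℝ φ (x, t) (1, 1) at a1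
  change coneRatio k * fderiv ℝ φ (x, t) (1, 1) ≤ _ at a2
  change coneRatio k * _ ≤ fderiv ℝ ψ (x, t) (-1, 1) at b1
  change coneRatio k * fderiv ℝ ψ (x, t) (-1, 1) ≤ _ at b2
  dsimp only at a1 a2 b1 b2 hF
  rw [← le_inv_mul_iff₀ hκ] at a2 b2
  set F := source p μ t (φ (x, t) + ψ (x, t))
  set w := φ (x, t) + ψ (x, t)
  have hp' : 0 < p - 1 := by linarith
  have hcancel : w ^ (1 - p - 1) * w ^ p = 1 := by
    rw [← Real.rpow_add hw, show 1 - p - 1 + p = 0 by ring, Real.rpow_zero]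
  have hwp : 0 < w ^ (1 - p - 1) := Real.rpow_pos_of_pos hw _
  have hκF := mul_pos hκ hF
  have u1 : w ^ (1 - p - 1) * ((2 : ℝ) ^ (-p) * w ^ p / 2) ≤ w ^ (1 - p - 1) * F := by gcongr
  have u2 : w ^ (1 - p - 1) * F ≤ w ^ (1 - p - 1) * ((2 : ℝ) ^ (-p) * w ^ p) := by gcongr
  have u3 : w ^ (1 - p - 1) * ((2 : ℝ) ^ (-p) * w ^ p / 2) = (2 : ℝ) ^ (-p) / 2 := by
    linear_combination (2 : ℝ) ^ (-p) / 2 * hcancel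
  have u4 : w ^ (1 - p - 1) * ((2 : ℝ) ^ (-p) * w ^ p) = (2 : ℝ) ^ (-p) := by
    linear_combination (2 : ℝ) ^ (-p) * hcancel
  rw [u3] at u1
  rw [u4] at u2
  set a := fderiv ℝ φ (x, t) (1, 1)
  set b := fderiv ℝ ψ (x, t) (-1, 1)
  have v1 : w ^ (1 - p - 1) * F ≤ w ^ (1 - p - 1) * ((a + F) / 2 + (F + b) / 2) := by
    gcongr; linarith
  have v2 : w ^ (1 - p - 1) * ((a + F) / 2 + (F + b) / 2) ≤
      w ^ (1 - p - 1) * ((1 + (coneRatio k)⁻¹) * F) := by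
    gcongr; linarith
  have v3 : w ^ (1 - p - 1) * ((1 + (coneRatio k)⁻¹) * F) ≤
      (1 + (coneRatio k)⁻¹) * (2 : ℝ) ^ (-p) := by
    rw [mul_left_comm]
    gcongr
  have w1 := mul_le_mul_of_nonneg_left (u1.trans v1) hp'.le
  have w2 := mul_le_mul_of_nonneg_left (v2.trans v3) hp'.le
  constructor <;> linarith

theorem rate_bounds (hp : 1 < p) (hμ : 0 < μ) (hk : 1 < k) (hγ : IsLarge p μ (γ₁ + γ₂))
    (h : IsMaximalSolution p μ k γ₁ γ₂ T₁ f g N Φ Ψ τ T φ ψ) {x t : ℝ} (ht : 0 < t)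
    (htT : t < T x) :
    (p - 1) * (2 : ℝ) ^ (-p) / 2 * (T x - t) ≤ (φ (x, t) + ψ (x, t)) ^ (1 - p) ∧
      (φ (x, t) + ψ (x, t)) ^ (1 - p) ≤
        (p - 1) * (2 : ℝ) ^ (-p) * (1 + (coneRatio k)⁻¹) * (T x - t) := by
  choose! d hd hd1 hd2 using fun t (ht : t ∈ Ioo 0 (T x)) =>
    h.hasDerivAt_rpow_sum hp hμ hk hγ ht.1 ht.2
  have hlim : Tendsto (fun t => (φ (x, t) + ψ (x, t)) ^ (1 - p)) (𝓝[<] (T x)) (𝓝 0) := by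
    have := (tendsto_rpow_neg_atTop (by linarith : 0 < p - 1)).comp (h.tendsto_sum hk.le x)
    simp only [neg_sub] at this
    exact this
  have hcl : ∀ C : ℝ, Tendsto (fun s => (φ (x, s) + ψ (x, s)) ^ (1 - p) - C * (T x - s))
      (𝓝[<] (T x)) (𝓝 0) := by
    intro C
    have h1 : Tendsto (fun s => C * (T x - s)) (𝓝[<] (T x)) (𝓝 (C * (T x - T x))) :=
      (Continuous.tendsto (by fun_prop) _).mono_left nhdsWithin_le_nhds
    simpa using hlim.sub h1
  have hder : ∀ C : ℝ, ∀ s ∈ Ioo 0 (T x),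
      HasDerivAt (fun s => (φ (x, s) + ψ (x, s)) ^ (1 - p) - C * (T x - s)) (d s + C) s := by
    intro C s hs
    refine ((hd s hs).sub (((hasDerivAt_id s).const_sub (T x)).const_mul C)).congr_deriv ?_
    ring
  have hev : ∀ᶠ s in 𝓝[<] (T x), s ∈ Ioo t (T x) := Ioo_mem_nhdsLT htT
  constructor
  · have hanti : AntitoneOn (fun s => (φ (x, s) + ψ (x, s)) ^ (1 - p) -
        (p - 1) * (2 : ℝ) ^ (-p) / 2 * (T x - s)) (Ioo 0 (T x)) := by
      refine antitoneOn_of_deriv_nonpos (convex_Ioo _ _)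
        (fun s hs => (hder _ s hs).continuousAt.continuousWithinAt) ?_ ?_ <;> rw [interior_Ioo]
      · exact fun s hs => (hder _ s hs).differentiableAt.differentiableWithinAt
      · intro s hs
        rw [(hder _ s hs).deriv]
        linarith [hd1 s hs]
    have := le_of_tendsto (hcl _) (hev.mono fun s hs =>
      hanti ⟨ht, htT⟩ ⟨ht.trans hs.1, hs.2⟩ hs.1.le)
    linarith
  · have hmono : MonotoneOn (fun s => (φ (x, s) + ψ (x, s)) ^ (1 - p) -
        (p - 1) * (2 : ℝ) ^ (-p) * (1 + (coneRatio k)⁻¹) * (T x - s)) (Ioo 0 (T x)) := by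
      refine monotoneOn_of_deriv_nonneg (convex_Ioo _ _)
        (fun s hs => (hder _ s hs).continuousAt.continuousWithinAt) ?_ ?_ <;> rw [interior_Ioo]
      · exact fun s hs => (hder _ s hs).differentiableAt.differentiableWithinAt
      · intro s hs
        rw [(hder _ s hs).deriv]
        linarith [hd2 s hs]
    have := ge_of_tendsto (hcl _) (hev.mono fun s hs =>
      hmono ⟨ht, htT⟩ ⟨ht.trans hs.1, hs.2⟩ hs.1.le)
    linarith

theorem slope_bounds (hp : 1 < p) (hμ : 0 < μ) (hk : 1 < k) (hγ : IsLarge p μ (γ₁ + γ₂))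
    (h : IsMaximalSolution p μ k γ₁ γ₂ T₁ f g N Φ Ψ τ T φ ψ) (hz : 0 < z.2) (hzT : z.2 < T z.1) :
    ((p - 1) * (1 + (coneRatio k)⁻¹) * 2)⁻¹ ≤
        sourceSlope p μ z.2 (φ z + ψ z) * (T z.1 - z.2) ∧
      sourceSlope p μ z.2 (φ z + ψ z) * (T z.1 - z.2) ≤ 2 * p / (p - 1) := by
  have hs := h.isSolutionNear hp hk.le hγ hz hzT
  have hw := hs.large.1
  have hp' : 0 < p - 1 := by linarith
  have hκ := coneRatio_pos hk
  obtain ⟨r1, r2⟩ := h.rate_bounds (x := z.1) (t := z.2) hp hμ hk hγ hz hzT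
  have m1 := half_le_sourceSlope hp hμ hz.le hs.large
  have m2 := sourceSlope_le (p := p) (w := φ z + ψ z) hμ (by linarith : -1 < z.2)
  have m0 := sourceSlope_nonneg hp hμ (by linarith : -(1 / 2) ≤ z.2) hs.large
  rw [Prod.mk.eta] at r1 r2
  set m := sourceSlope p μ z.2 (φ z + ψ z)
  set w := φ z + ψ z
  have hcancel : w ^ (p - 1) * w ^ (1 - p) = 1 := by
    rw [← Real.rpow_add hw, show p - 1 + (1 - p) = 0 by ring, Real.rpow_zero]
  have hy : 0 < w ^ (1 - p) := Real.rpow_pos_of_pos hw _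
  have h2 : (0 : ℝ) < 2 ^ (-p) := by positivity
  have n1 := mul_le_mul_of_nonneg_right m1 hy.le
  have n2 := mul_le_mul_of_nonneg_right m2 hy.le
  have n3 := mul_le_mul_of_nonneg_left r1 m0
  have n4 := mul_le_mul_of_nonneg_left r2 m0
  have e1 : (2 : ℝ) ^ (-p) * w ^ (p - 1) / 2 * w ^ (1 - p) = 2 ^ (-p) / 2 := by
    linear_combination (2 : ℝ) ^ (-p) / 2 * hcancel
  have e2 : p * ((2 : ℝ) ^ (-p) * w ^ (p - 1)) * w ^ (1 - p) = p * 2 ^ (-p) := by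
    linear_combination p * (2 : ℝ) ^ (-p) * hcancel
  constructor
  · rw [inv_le_iff_one_le_mul₀ (by positivity)]
    have : (2 : ℝ) ^ (-p) * 1 ≤ 2 ^ (-p) *
        (m * (T z.1 - z.2) * ((p - 1) * (1 + (coneRatio k)⁻¹) * 2)) := by linarith
    exact le_of_mul_le_mul_left this h2
  · rw [le_div_iff₀ hp']
    have : (2 : ℝ) ^ (-p) * (m * (T z.1 - z.2) * (p - 1)) ≤ 2 ^ (-p) * (2 * p) := by linarith
    exact le_of_mul_le_mul_left this h2

end IsMaximalSolution

end Rates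
end BlowupCurve

namespace BlowupCurve

section Chart

variable {p μ k γ₁ γ₂ T₁ : ℝ} {f g : ℝ → ℝ} {N : ℕ → ℝ} {Φ Ψ : ℕ → ℝ × ℝ → ℝ} {τ : ℕ → ℝ → ℝ}
  {T : ℝ → ℝ} {φ ψ : ℝ × ℝ → ℝ} {z : ℝ × ℝ}

/-- Characteristic coordinates centred at the point `(X, θ)`. -/
def charCoord (X θ : ℝ) (w : ℝ × ℝ) : ℝ × ℝ := (X - w.1 + w.2, θ + w.1 + w.2)

theorem hasDerivAt_charCoord_left {P : ℝ × ℝ → ℝ} {X θ d : ℝ} {w : ℝ × ℝ}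
    (h : HasDerivAt (fun s => P ((charCoord X θ w).1 - s, (charCoord X θ w).2 + s)) d 0) :
    HasDerivAt (fun s => P (charCoord X θ (s, w.2))) d w.1 := by
  have h1 := HasDerivAt.comp_sub_const (f := fun s =>
    P ((charCoord X θ w).1 - s, (charCoord X θ w).2 + s)) w.1 w.1 (by rwa [sub_self])
  refine h1.congr_of_eventuallyEq (Eventually.of_forall fun s => ?_)
  simp only [charCoord]
  congr 2 <;> ring

theorem hasDerivAt_charCoord_right {P : ℝ × ℝ → ℝ} {X θ d : ℝ} {w : ℝ × ℝ}
    (h : HasDerivAt (fun s => P ((charCoord X θ w).1 + s, (charCoord X θ w).2 + s)) d 0) :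
    HasDerivAt (fun s => P (charCoord X θ (w.1, s))) d w.2 := by
  have h1 := HasDerivAt.comp_sub_const (f := fun s =>
    P ((charCoord X θ w).1 + s, (charCoord X θ w).2 + s)) w.2 w.2 (by rwa [sub_self])
  refine h1.congr_of_eventuallyEq (Eventually.of_forall fun s => ?_)
  simp only [charCoord]
  congr 2 <;> ring

namespace IsMaximalSolution

theorem charCoord_mem (hk : 1 < k) (h : IsMaximalSolution p μ k γ₁ γ₂ T₁ f g N Φ Ψ τ T φ ψ)
    {X ρ : ℝ} (hρ : 2 * ρ < T X) {w : ℝ × ℝ} (hw : w ∈ cornerSquare ρ) :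
    0 < (charCoord X (T X) w).2 ∧ (charCoord X (T X) w).2 < T (charCoord X (T X) w).1 ∧
      (k - 1) * -(w.1 + w.2) ≤ k * (T (charCoord X (T X) w).1 - (charCoord X (T X) w).2) ∧
      k * (T (charCoord X (T X) w).1 - (charCoord X (T X) w).2) ≤ (k + 1) * -(w.1 + w.2) := by
  have h1 := h.lip (charCoord X (T X) w).1 X
  have h2 : |(charCoord X (T X) w).1 - X| ≤ -(w.1 + w.2) := by
    rw [abs_le]
    constructor <;> simp only [charCoord] <;> linarith [hw.1.2, hw.2.1.2]
  have h3 : k * |T (charCoord X (T X) w).1 - T X| ≤ -(w.1 + w.2) := h1.trans h2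
  have h4 : (charCoord X (T X) w).2 = T X + w.1 + w.2 := rfl
  set A := T (charCoord X (T X) w).1
  have hs := hw.2.2
  have hk0 : 0 < k := by linarith
  have h5 : -(-(w.1 + w.2)) ≤ k * (A - T X) := by nlinarith [neg_abs_le (A - T X)]
  have h6 : k * (A - T X) ≤ -(w.1 + w.2) := by nlinarith [le_abs_self (A - T X)]
  rw [h4]
  have h7 : (k - 1) * -(w.1 + w.2) ≤ k * (A - (T X + w.1 + w.2)) := by linarith
  refine ⟨by linarith [hw.1.1, hw.2.1.1], ?_, h7, by linarith⟩
  have h8 : 0 < (k - 1) * -(w.1 + w.2) := mul_pos (by linarith) (by linarith)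
  have := pos_of_mul_pos_right (h8.trans_le h7) hk0.le
  linarith

theorem continuousAt_ratio (hp : 1 < p) (hμ : 0 < μ) (hk : 1 < k) (hγ : IsLarge p μ (γ₁ + γ₂))
    (h : IsMaximalSolution p μ k γ₁ γ₂ T₁ f g N Φ Ψ τ T φ ψ) (hz : 0 < z.2) (hzT : z.2 < T z.1) :
    ContinuousAt (ratioLeft p μ φ ψ) z ∧ ContinuousAt (ratioRight p μ φ ψ) z := by
  have hs := h.isSolutionNear hp hk.le hγ hz hzT
  have hF := hs.source_pos hp hμ
  have hb := (h.ratio_mem hp hμ hk hγ hz hzT).1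
  have c1 := hs.differentiableAt_source.continuousAt
  have c2 : ContinuousAt (Dplus φ) z :=
    (differentiableAt_fderiv_apply hs.smooth_left (1, 1)).continuousAt
  have c3 : ContinuousAt (Dminus ψ) z :=
    (differentiableAt_fderiv_apply hs.smooth_right (-1, 1)).continuousAt
  exact ⟨c2.div c1 hF.ne', c1.div c3 hb.ne'⟩

/-- Near the blow-up curve both ratios are nearly constant, uniformly along the curve. -/
theorem exists_oscillation_bound (hp : 1 < p) (hμ : 0 < μ) (hk : 1 < k)
    (hγ : IsLarge p μ (γ₁ + γ₂)) (h : IsMaximalSolution p μ k γ₁ γ₂ T₁ f g N Φ Ψ τ T φ ψ) :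
    ∃ q D : ℝ, q ∈ Ico 0 1 ∧ ∀ X ρ, 0 < ρ → 2 * ρ < T X → ∀ j : ℕ, ∃ lo hi, hi - lo ≤ D * q ^ j ∧
      ∀ w ∈ cornerSquare (ρ / 2 ^ j), ratioLeft p μ φ ψ (charCoord X (T X) w) ∈ Icc lo hi ∧
        ratioRight p μ φ ψ (charCoord X (T X) w) ∈ Icc lo hi := by
  have hκ := coneRatio_pos hk
  have hp' : 0 < p - 1 := by linarith
  have hk' : 0 < k - 1 := by linarith
  have hk0 : 0 < k := by linarith
  set κ := coneRatio k with hκd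
  set c₀ := ((p - 1) * (1 + κ⁻¹) * 2)⁻¹ with hc₀
  have hc₀0 : 0 < c₀ := by positivity
  set c := κ * (c₀ * (k / (k + 1))) with hc
  set C := κ⁻¹ * (2 * p / (p - 1) * (k / (k - 1))) with hC
  set E := κ⁻¹ * (1 + κ⁻¹) + (1 + κ⁻¹) with hE
  have hc0 : 0 < c := by positivity
  have hE0 : 0 ≤ E := by positivity
  refine ⟨decayRate c C, κ⁻¹ - κ + 8 * E * T₁, decayRate_mem hc0, fun X ρ hρ hρT j => ?_⟩
  set Z := charCoord X (T X) with hZ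
  have hmem : ∀ w ∈ cornerSquare ρ, _ := fun w hw => h.charCoord_mem hk hρT hw
  have hsol : ∀ w ∈ cornerSquare ρ, IsSolutionNear p μ φ ψ (Z w) := fun w hw =>
    h.isSolutionNear hp hk.le hγ (hmem w hw).1 (hmem w hw).2.1
  have hrat : ∀ w ∈ cornerSquare ρ, _ := fun w hw =>
    h.ratio_mem hp hμ hk hγ (hmem w hw).1 (hmem w hw).2.1
  have hZc : Continuous Z := by rw [hZ]; unfold charCoord; fun_prop
  have hslope : ∀ w ∈ cornerSquare ρ,
      0 ≤ sourceSlope p μ (Z w).2 (φ (Z w) + ψ (Z w)) * -(w.1 + w.2) ∧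
      c₀ * (k / (k + 1)) ≤ sourceSlope p μ (Z w).2 (φ (Z w) + ψ (Z w)) * -(w.1 + w.2) ∧
      sourceSlope p μ (Z w).2 (φ (Z w) + ψ (Z w)) * -(w.1 + w.2) ≤
        2 * p / (p - 1) * (k / (k - 1)) := by
    intro w hw
    obtain ⟨m1, m2, m3, m4⟩ := hmem w hw
    obtain ⟨s1, s2⟩ := h.slope_bounds hp hμ hk hγ m1 m2
    have s0 := sourceSlope_nonneg hp hμ (by linarith : -(1 / 2) ≤ (Z w).2) (hsol w hw).large
    set m := sourceSlope p μ (Z w).2 (φ (Z w) + ψ (Z w))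
    have hs := hw.2.2
    refine ⟨mul_nonneg s0 (by linarith), ?_, ?_⟩
    · rw [← mul_div_assoc, div_le_iff₀ (by linarith)]
      have := mul_le_mul_of_nonneg_left m4 s0
      have := mul_le_mul_of_nonneg_right s1 hk0.le
      linarith
    · rw [← mul_div_assoc, le_div_iff₀ hk']
      have := mul_le_mul_of_nonneg_left m3 s0
      have := mul_le_mul_of_nonneg_right s2 hk0.le
      linarith
  have hdrift : ∀ w ∈ cornerSquare ρ,
      sourceDrift p μ (Z w).2 (φ (Z w) + ψ (Z w)) ∈ Icc 0 1 := fun w hw =>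
    sourceDrift_mem hp hμ (hmem w hw).1.le (hsol w hw).large
  have hone : ∀ x ∈ Icc κ κ⁻¹, |1 - x| ≤ 1 + κ⁻¹ := fun x hx => by
    rw [abs_le]; constructor <;> linarith [hx.1, hx.2, inv_pos.2 hκ]
  have key : ∃ lo hi, hi - lo ≤ (κ⁻¹ - κ + 8 * E * ρ) * decayRate c C ^ j ∧
      ∀ w ∈ cornerSquare (ρ / 2 ^ j), ratioLeft p μ φ ψ (Z w) ∈ Icc lo hi ∧
        ratioRight p μ φ ψ (Z w) ∈ Icc lo hi := by
    refine oscillation_iterate (lo := κ) (hi := κ⁻¹) (E := E) (c := c) (C := C)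
      (A := fun w => sourceSlope p μ (Z w).2 (φ (Z w) + ψ (Z w)) / ratioRight p μ φ ψ (Z w))
      (B := fun w => sourceSlope p μ (Z w).2 (φ (Z w) + ψ (Z w)) * ratioRight p μ φ ψ (Z w))
      (α := fun w => ratioLeft p μ φ ψ (Z w)) (γ := fun w => ratioRight p μ φ ψ (Z w))
      hρ hc0 hE0
      (fun w hw => (ContinuousAt.comp (f := Z)
        (h.continuousAt_ratio hp hμ hk hγ (hmem w hw).1 (hmem w hw).2.1).1
        hZc.continuousAt).continuousWithinAt)
      (fun w hw => (ContinuousAt.comp (f := Z)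
        (h.continuousAt_ratio hp hμ hk hγ (hmem w hw).1 (hmem w hw).2.1).2
        hZc.continuousAt).continuousWithinAt)
      ?_ ?_ ?_ ?_ (fun w hw => (hrat w hw).2.1) (fun w hw => (hrat w hw).2.2) j
    · intro w hw
      obtain ⟨s0, s1, s2⟩ := hslope w hw
      obtain ⟨r1, r2⟩ := (hrat w hw).2.2
      have hr0 : 0 < ratioRight p μ φ ψ (Z w) := hκ.trans_le r1
      have i1 : κ ≤ (ratioRight p μ φ ψ (Z w))⁻¹ := by
        rw [le_inv_comm₀ hκ hr0]; exact r2
      have i2 : (ratioRight p μ φ ψ (Z w))⁻¹ ≤ κ⁻¹ := inv_anti₀ hκ r1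
      rw [div_eq_inv_mul, mul_assoc]
      constructor
      · exact mul_le_mul i1 s1 (by positivity) (by positivity)
      · exact mul_le_mul i2 s2 s0 (by positivity)
    · intro w hw
      obtain ⟨s0, s1, s2⟩ := hslope w hw
      obtain ⟨r1, r2⟩ := (hrat w hw).2.2
      have hr0 : 0 < ratioRight p μ φ ψ (Z w) := hκ.trans_le r1
      rw [mul_right_comm, mul_comm]
      constructor
      · exact mul_le_mul r1 s1 (by positivity) (by positivity)
      · exact mul_le_mul r2 s2 s0 (by positivity)
    · intro w hw
      refine ⟨_, hasDerivAt_charCoord_left (P := ratioLeft p μ φ ψ)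
        ((hsol w hw).hasDerivAt_ratioLeft hp hμ (hrat w hw).1.ne'), ?_⟩
      rw [add_sub_cancel_left, abs_mul, abs_of_nonneg (hdrift w hw).1]
      have h3 := hone _ (hrat w hw).2.1
      have h4 := mul_le_mul (hdrift w hw).2 h3 (abs_nonneg _) zero_le_one
      refine h4.trans ?_
      have : 0 ≤ κ⁻¹ * (1 + κ⁻¹) := by positivity
      rw [hE]; linarith
    · intro w hw
      refine ⟨_, hasDerivAt_charCoord_right (P := ratioRight p μ φ ψ)
        ((hsol w hw).hasDerivAt_ratioRight hp hμ (hrat w hw).1.ne'), ?_⟩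
      have hr0 : 0 < ratioRight p μ φ ψ (Z w) := hκ.trans_le (hrat w hw).2.2.1
      rw [add_sub_cancel_left, abs_mul, abs_mul, abs_of_nonneg (hdrift w hw).1, abs_of_pos hr0]
      have h3 := hone _ (hrat w hw).2.2
      have h4 := mul_le_mul (mul_le_mul (hdrift w hw).2 (hrat w hw).2.2.2 hr0.le zero_le_one) h3
        (abs_nonneg _) (by positivity)
      refine h4.trans ?_
      have : 0 ≤ κ⁻¹ := by positivity
      rw [hE]; linarith
  obtain ⟨lo, hi, h1, h2⟩ := key
  refine ⟨lo, hi, h1.trans ?_, h2⟩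
  have h3 := (decayRate_mem (C := C) hc0).1
  have h4 : ρ ≤ T₁ := by linarith [h.time_le X]
  gcongr

end IsMaximalSolution

end Chart
end BlowupCurve

namespace BlowupCurve

section Tilt

/-- The slope of a level curve of `φ + ψ` in terms of the ratios of the characteristic
derivatives. -/
noncomputable def tilt (a b : ℝ) : ℝ := (1 - a * b) / (1 + 2 * b + a * b)

theorem abs_tilt_sub_le {K lo hi a b a' b' : ℝ} (ha : a ∈ Icc 0 K) (hb : b ∈ Icc 0 K)
    (ha' : a' ∈ Icc 0 K) (hb' : b' ∈ Icc 0 K) (hal : a ∈ Icc lo hi) (hbl : b ∈ Icc lo hi)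
    (hal' : a' ∈ Icc lo hi) (hbl' : b' ∈ Icc lo hi) :
    |tilt a b - tilt a' b'| ≤ 2 * (1 + K) ^ 2 * (hi - lo) := by
  have hK : 0 ≤ K := ha.1.trans ha.2
  have p1 : 0 ≤ a * b := mul_nonneg ha.1 hb.1
  have p2 : 0 ≤ a' * b' := mul_nonneg ha'.1 hb'.1
  have d1 : 1 ≤ 1 + 2 * b + a * b := by linarith [hb.1]
  have d2 : 1 ≤ 1 + 2 * b' + a' * b' := by linarith [hb'.1]
  have hA : |a' - a| ≤ hi - lo := abs_sub_le_iff.2 ⟨by linarith [hal.1, hal'.2],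
    by linarith [hal.2, hal'.1]⟩
  have hB : |b' - b| ≤ hi - lo := abs_sub_le_iff.2 ⟨by linarith [hbl.1, hbl'.2],
    by linarith [hbl.2, hbl'.1]⟩
  have hℓ : 0 ≤ hi - lo := (abs_nonneg _).trans hA
  have e : tilt a b - tilt a' b' =
      (2 * (b' - b) + 2 * (a' * (b' - b) + b * (a' - a)) + 2 * (b * b' * (a' - a))) /
        ((1 + 2 * b + a * b) * (1 + 2 * b' + a' * b')) := by
    unfold tilt
    rw [div_sub_div _ _ (by linarith) (by linarith)]
    congr 1; ring
  have hmul : ∀ {x y M : ℝ}, 0 ≤ x → x ≤ M → |y| ≤ hi - lo → |x * y| ≤ M * (hi - lo) := by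
    intro x y M hx hxM hy
    rw [abs_mul, abs_of_nonneg hx]
    exact mul_le_mul hxM hy (abs_nonneg _) (hx.trans hxM)
  have t1 := hmul ha'.1 ha'.2 hB
  have t2 := hmul hb.1 hb.2 hA
  have t3 := hmul (mul_nonneg hb.1 hb'.1) (mul_le_mul hb.2 hb'.2 hb'.1 hK) hA
  rw [e, abs_div, abs_of_pos (mul_pos (zero_lt_one.trans_le d1) (zero_lt_one.trans_le d2))]
  refine (div_le_self (abs_nonneg _) (one_le_mul_of_one_le_of_one_le d1 d2)).trans ?_
  rw [abs_le] at *
  constructor <;> linarith [t1.1, t1.2, t2.1, t2.2, t3.1, t3.2, hB.1, hB.2]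

/-- Differentiability of a Lipschitz level curve. -/
theorem hasDerivAt_of_level {w : ℝ × ℝ → ℝ} {σ : ℝ → ℝ} {x : ℝ} {L : ℝ × ℝ →L[ℝ] ℝ}
    (hw : HasFDerivAt w L (x, σ x)) (hL : L (0, 1) ≠ 0) (hlev : ∀ y, w (y, σ y) = w (x, σ x))
    (hlip : ∀ y, |σ y - σ x| ≤ |y - x|) : HasDerivAt σ (-(L (1, 0)) / L (0, 1)) x := by
  have hcont : Tendsto (fun y => (y, σ y)) (𝓝 x) (𝓝 (x, σ x)) := by
    refine Tendsto.prodMk_nhds tendsto_id ?_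
    rw [tendsto_iff_dist_tendsto_zero]
    refine squeeze_zero (g := fun y => |y - x|) (fun _ => dist_nonneg) hlip ?_
    have : Tendsto (fun y => |y - x|) (𝓝 x) (𝓝 |x - x|) := Continuous.tendsto (by fun_prop) x
    simpa using this
  have h1 := hw.isLittleO.comp_tendsto hcont
  have h2 : (fun y => ((y, σ y) : ℝ × ℝ) - (x, σ x)) =O[𝓝 x] fun y => y - x := by
    refine Asymptotics.IsBigO.of_bound 1 (Eventually.of_forall fun y => ?_)
    rw [one_mul, Prod.mk_sub_mk, Prod.norm_mk, Real.norm_eq_abs, Real.norm_eq_abs]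
    exact max_le le_rfl (hlip y)
  have h3 := (h1.trans_isBigO h2).const_mul_left (-(L (0, 1))⁻¹)
  rw [hasDerivAt_iff_isLittleO]
  refine h3.congr_left fun y => ?_
  have h4 : L ((y, σ y) - (x, σ x)) = (y - x) * L (1, 0) + (σ y - σ x) * L (0, 1) := by
    rw [← smul_eq_mul, ← smul_eq_mul, ← map_smul, ← map_smul, ← map_add]
    congr 1; ext <;> simp
  simp only [Function.comp_apply, hlev, h4, smul_eq_mul]
  field_simp
  ring

end Tilt

section Regularity

variable {p μ k γ₁ γ₂ T₁ : ℝ} {f g : ℝ → ℝ} {N : ℕ → ℝ} {Φ Ψ : ℕ → ℝ × ℝ → ℝ} {τ : ℕ → ℝ → ℝ}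
  {T : ℝ → ℝ} {φ ψ : ℝ × ℝ → ℝ} {z : ℝ × ℝ}

namespace IsMaximalSolution

theorem hasDerivAt_levelTime (hp : 1 < p) (hμ : 0 < μ) (hk : 1 < k) (hγ : IsLarge p μ (γ₁ + γ₂))
    (h : IsMaximalSolution p μ k γ₁ γ₂ T₁ f g N Φ Ψ τ T φ ψ) (n : ℕ) (x : ℝ) :
    HasDerivAt (τ n) (tilt (ratioLeft p μ φ ψ (x, τ n x)) (ratioRight p μ φ ψ (x, τ n x))) x := by
  have ht := (h.level n).time_pos x
  have htT := h.time_lt n x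
  have hs := h.isSolutionNear (z := (x, τ n x)) hp hk.le hγ ht htT
  have hF := hs.source_pos hp hμ
  have hκ := coneRatio_pos hk
  obtain ⟨⟨a1, a2⟩, b1, b2⟩ := h.derivative_bounds (z := (x, τ n x)) hp hk hγ ht htT
  have ha : 0 < Dplus φ (x, τ n x) := (mul_pos hκ hF).trans_le a1
  have hb : 0 < Dminus ψ (x, τ n x) := (mul_pos hκ hF).trans_le b1
  have hlev : ∀ y, φ (y, τ n y) + ψ (y, τ n y) = N n := by
    intro y
    have h1 := h.agree n (y, τ n y) ((h.level n).time_pos y).le le_rfl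
    rw [h1.1, h1.2, (h.level n).level]
  have e1 : fderiv ℝ φ (x, τ n x) (-1, 1) = _ := hs.eq_left.self_of_nhds
  have e2 : fderiv ℝ ψ (x, τ n x) (1, 1) = _ := hs.eq_right.self_of_nhds
  have e3 : fderiv ℝ φ (x, τ n x) (1, 1) = Dplus φ (x, τ n x) := rfl
  have e4 : fderiv ℝ ψ (x, τ n x) (-1, 1) = Dminus ψ (x, τ n x) := rfl
  have hlin : ∀ Φ : ℝ × ℝ → ℝ, fderiv ℝ Φ (x, τ n x) (0, 1) =
      (fderiv ℝ Φ (x, τ n x) (1, 1) + fderiv ℝ Φ (x, τ n x) (-1, 1)) / 2 := by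
    intro Φ
    rw [eq_div_iff two_ne_zero, mul_comm, ← smul_eq_mul, ← map_smul, ← map_add]
    congr 1
    ext <;> norm_num
  have hlin' : ∀ Φ : ℝ × ℝ → ℝ, fderiv ℝ Φ (x, τ n x) (1, 0) =
      (fderiv ℝ Φ (x, τ n x) (1, 1) - fderiv ℝ Φ (x, τ n x) (-1, 1)) / 2 := by
    intro Φ
    rw [eq_div_iff two_ne_zero, mul_comm, ← smul_eq_mul, ← map_smul, ← map_sub]
    congr 1
    ext <;> norm_num
  have hL := (hs.smooth_left.differentiableAt (by norm_num)).hasFDerivAt.add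
    (hs.smooth_right.differentiableAt (by norm_num)).hasFDerivAt
  have v1 : (fderiv ℝ φ (x, τ n x) + fderiv ℝ ψ (x, τ n x)) (0, 1) =
      (Dplus φ (x, τ n x) + 2 * source p μ (τ n x) (φ (x, τ n x) + ψ (x, τ n x)) +
        Dminus ψ (x, τ n x)) / 2 := by
    rw [add_apply, hlin φ, hlin ψ, e1, e2, e3, e4]; ring
  have v2 : (fderiv ℝ φ (x, τ n x) + fderiv ℝ ψ (x, τ n x)) (1, 0) =
      (Dplus φ (x, τ n x) - Dminus ψ (x, τ n x)) / 2 := by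
    rw [add_apply, hlin' φ, hlin' ψ, e1, e2, e3, e4]; ring
  dsimp only at hF
  have hd := hasDerivAt_of_level hL (by rw [v1]; positivity)
    (fun y => (hlev y).trans (hlev x).symm) fun y => by
      have h1 := (h.level n).lip y x
      have h2 := abs_nonneg (τ n y - τ n x)
      nlinarith
  refine hd.congr_deriv ?_
  rw [v1, v2]
  simp only [tilt, ratioLeft, ratioRight]
  have hD : 0 < Dplus φ (x, τ n x) + 2 * source p μ (τ n x) (φ (x, τ n x) + ψ (x, τ n x)) +
        Dminus ψ (x, τ n x) := by positivity
  rw [div_eq_div_iff (by positivity) (by positivity)]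
  field_simp
  ring

theorem level_rate (hp : 1 < p) (hμ : 0 < μ) (hk : 1 < k) (hγ : IsLarge p μ (γ₁ + γ₂))
    (h : IsMaximalSolution p μ k γ₁ γ₂ T₁ f g N Φ Ψ τ T φ ψ) {ε : ℝ} (hε : 0 < ε) :
    ∃ n₀, ∀ n ≥ n₀, ∀ x, T x - τ n x ≤ ε := by
  have hp' : 0 < p - 1 := by linarith
  have hC : 0 < (p - 1) * (2 : ℝ) ^ (-p) / 2 := by positivity
  have hlim : Tendsto (fun n => N n ^ (1 - p)) atTop (𝓝 0) := by
    have := (tendsto_rpow_neg_atTop hp').comp h.tendsto_level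
    simp only [neg_sub] at this
    exact this
  obtain ⟨n₀, hn₀⟩ := eventually_atTop.1 (hlim.eventually (ge_mem_nhds (mul_pos hC hε)))
  refine ⟨n₀, fun n hn x => ?_⟩
  have h1 := (h.rate_bounds hp hμ hk hγ ((h.level n).time_pos x) (h.time_lt n x)).1
  have h2 := h.agree n (x, τ n x) ((h.level n).time_pos x).le le_rfl
  rw [h2.1, h2.2, (h.level n).level] at h1
  exact le_of_mul_le_mul_left (h1.trans (hn₀ n hn)) hC

theorem contDiffOn_time (hp : 1 < p) (hμ : 0 < μ) (hk : 1 < k) (hγ : IsLarge p μ (γ₁ + γ₂))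
    (h : IsMaximalSolution p μ k γ₁ γ₂ T₁ f g N Φ Ψ τ T φ ψ) (R : ℝ) :
    ContDiffOn ℝ 1 T (Metric.ball 0 R) := by
  rcases le_or_gt R 0 with hR | hR
  · rw [Metric.ball_eq_empty.2 hR]
    exact contDiffOn_empty
  set d : ℕ → ℝ → ℝ := fun n x =>
    tilt (ratioLeft p μ φ ψ (x, τ n x)) (ratioRight p μ φ ψ (x, τ n x)) with hd
  have hpt : ∀ n x, 0 < (x, τ n x).2 ∧ (x, τ n x).2 < T (x, τ n x).1 := fun n x =>
    ⟨(h.level n).time_pos x, h.time_lt n x⟩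
  have hκ := coneRatio_pos hk
  have hrat := fun n x => h.ratio_mem hp hμ hk hγ (hpt n x).1 (hpt n x).2
  have hcont : ∀ n, Continuous (d n) := by
    intro n
    rw [continuous_iff_continuousAt]
    intro x
    have h1 := h.continuousAt_ratio hp hμ hk hγ (hpt n x).1 (hpt n x).2
    have h2 : ContinuousAt (fun x => (x, τ n x)) x :=
      (continuous_id.prodMk ((h.level n).continuous_time hk.le)).continuousAt
    have h3 : ContinuousAt (fun x => ratioLeft p μ φ ψ (x, τ n x)) x :=
      ContinuousAt.comp (f := fun x => (x, τ n x)) h1.1 h2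
    have h4 : ContinuousAt (fun x => ratioRight p μ φ ψ (x, τ n x)) x :=
      ContinuousAt.comp (f := fun x => (x, τ n x)) h1.2 h2
    refine (continuousAt_const.sub (h3.mul h4)).div
      ((continuousAt_const.add (continuousAt_const.mul h4)).add (h3.mul h4)) ?_
    have := hκ.trans_le (hrat n x).2.1.1
    have := hκ.trans_le (hrat n x).2.2.1
    positivity
  obtain ⟨q, D, hq, hosc⟩ := h.exists_oscillation_bound hp hμ hk hγ
  obtain ⟨x₀, -, hx₀⟩ := (isCompact_closedBall (0 : ℝ) R).exists_isMinOn
    ⟨0, Metric.mem_closedBall_self hR.le⟩ (h.continuous_time hk.le).continuousOn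
  have hT₀ := h.time_pos x₀
  have hcauchy : UniformCauchySeqOn d atTop (Metric.ball 0 R) := by
    rw [Metric.uniformCauchySeqOn_iff]
    intro ε hε
    have hlim : Tendsto (fun j : ℕ => 2 * (1 + (coneRatio k)⁻¹) ^ 2 * (D * q ^ j)) atTop (𝓝 0) := by
      have := ((tendsto_pow_atTop_nhds_zero_of_lt_one hq.1 hq.2).const_mul D).const_mul
        (2 * (1 + (coneRatio k)⁻¹) ^ 2)
      simpa using this
    obtain ⟨j, hj⟩ := (hlim.eventually (gt_mem_nhds hε)).exists
    obtain ⟨n₀, hn₀⟩ := h.level_rate hp hμ hk hγ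
      (show 0 < 2 * (T x₀ / 3 / 2 ^ j) by positivity)
    refine ⟨n₀, fun m hm n hn x hx => ?_⟩
    have hTx : T x₀ ≤ T x := hx₀ (Metric.ball_subset_closedBall hx)
    obtain ⟨lo, hi, hlohi, hmem⟩ := hosc x (T x₀ / 3) (by positivity) (by linarith) j
    have hsq : ∀ n ≥ n₀, ratioLeft p μ φ ψ (x, τ n x) ∈ Icc lo hi ∧
        ratioRight p μ φ ψ (x, τ n x) ∈ Icc lo hi := by
      intro n hn
      have h1 := hn₀ n hn x
      have h2 := h.time_lt n x
      have h3 := hmem (-((T x - τ n x) / 2), -((T x - τ n x) / 2))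
        ⟨⟨by simp only; linarith, by simp only; linarith⟩,
          ⟨by simp only; linarith, by simp only; linarith⟩, by simp only; linarith⟩
      have h4 : charCoord x (T x) (-((T x - τ n x) / 2), -((T x - τ n x) / 2)) = (x, τ n x) := by
        simp only [charCoord]
        ext
        · simp
        · simp only; ring
      rwa [h4] at h3
    have hI : Icc (coneRatio k) (coneRatio k)⁻¹ ⊆ Icc 0 (coneRatio k)⁻¹ := Icc_subset_Icc_left hκ.le
    rw [Real.dist_eq]
    refine (abs_tilt_sub_le (hI (hrat m x).2.1) (hI (hrat m x).2.2) (hI (hrat n x).2.1)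
      (hI (hrat n x).2.2) (hsq m hm).1 (hsq m hm).2 (hsq n hn).1 (hsq n hn).2).trans_lt ?_
    refine lt_of_le_of_lt ?_ hj
    gcongr
  choose! d' hd' using fun x (hx : x ∈ Metric.ball (0 : ℝ) R) =>
    cauchySeq_tendsto_of_complete (hcauchy.cauchySeq hx)
  have hunif := hcauchy.tendstoUniformlyOn_of_tendsto hd'
  have hderiv : ∀ x ∈ Metric.ball (0 : ℝ) R, HasDerivAt T (d' x) x := fun x hx =>
    hasDerivAt_of_tendstoUniformlyOn Metric.isOpen_ball hunif
      (Eventually.of_forall fun n x _ => h.hasDerivAt_levelTime hp hμ hk hγ n x)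
      (fun x _ => h.tendsto_time x) hx
  have hd'c : ContinuousOn d' (Metric.ball 0 R) :=
    hunif.continuousOn (Eventually.of_forall fun n => (hcont n).continuousOn).frequently
  change ContDiffOn ℝ (0 + 1) T _
  rw [contDiffOn_succ_iff_deriv_of_isOpen Metric.isOpen_ball]
  refine ⟨fun x hx => (hderiv x hx).differentiableAt.differentiableWithinAt, by simp, ?_⟩
  rw [contDiffOn_zero]
  exact hd'c.congr fun x hx => (hderiv x hx).deriv

end IsMaximalSolution

end Regularity
end BlowupCurve

namespace BlowupCurve

section Uniqueness

variable {p μ R : ℝ} {f g : ℝ → ℝ} {T T' : ℝ → ℝ} {φ ψ φ' ψ' : ℝ × ℝ → ℝ} {z : ℝ × ℝ}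

theorem isOpen_depDomain (R : ℝ) (T : ℝ → ℝ) : IsOpen (depDomain R T) := by
  refine isOpen_biUnion fun z _ => ?_
  exact (isOpen_lt continuous_const continuous_snd).inter
    (isOpen_lt (by fun_prop : Continuous fun w : ℝ × ℝ => |w.1 - z.1|) (by fun_prop))

theorem mem_depDomain_iff : z ∈ depDomain R T ↔ ∃ y ∈ region R T, z ∈ backwardCone y := by
  simp only [depDomain, mem_iUnion, exists_prop]

theorem mem_depDomainWithBase_iff :
    z ∈ depDomainWithBase R T ↔ ∃ y ∈ region R T, z ∈ backwardConeWithBase y := by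
  simp only [depDomainWithBase, mem_iUnion, exists_prop]

theorem closedCone_subset_backwardConeWithBase {y : ℝ × ℝ} (hz : z ∈ backwardConeWithBase y) :
    closedCone z ⊆ backwardConeWithBase y := by
  intro w hw
  refine ⟨hw.1, ?_⟩
  have h1 := abs_sub_le w.1 z.1 y.1
  linarith [hw.2, hz.2]

theorem closedCone_subset_depDomainWithBase (hz : z ∈ depDomainWithBase R T) :
    closedCone z ⊆ depDomainWithBase R T := by
  obtain ⟨y, hy, hzy⟩ := mem_depDomainWithBase_iff.1 hz
  exact fun w hw => mem_depDomainWithBase_iff.2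
    ⟨y, hy, closedCone_subset_backwardConeWithBase hzy hw⟩

theorem mem_depDomain_of_pos (hz : z ∈ depDomainWithBase R T) (hz0 : 0 < z.2) :
    z ∈ depDomain R T := by
  obtain ⟨y, hy, hzy⟩ := mem_depDomainWithBase_iff.1 hz
  exact mem_depDomain_iff.2 ⟨y, hy, hz0, hzy.2⟩

theorem nonneg_of_mem_depDomainWithBase (hz : z ∈ depDomainWithBase R T) : 0 ≤ z.2 := by
  obtain ⟨y, hy, hzy⟩ := mem_depDomainWithBase_iff.1 hz
  exact hzy.1

theorem depDomain_subset_depDomainWithBase : depDomain R T ⊆ depDomainWithBase R T := by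
  intro z hz
  obtain ⟨y, hy, hzy⟩ := mem_depDomain_iff.1 hz
  exact mem_depDomainWithBase_iff.2 ⟨y, hy, hzy.1.le, hzy.2⟩

theorem region_subset_depDomain : region R T ⊆ depDomain R T := by
  intro z hz
  obtain ⟨t, h1, h2⟩ := exists_between hz.2.2
  exact mem_depDomain_iff.2 ⟨(z.1, t), ⟨hz.1, hz.2.1.trans h1, h2⟩, hz.2.1, by simpa using h1⟩

theorem abs_source_sub_le_of_abs_le (hp : 1 < p) (hμ : 0 < μ) {t M w w' : ℝ} (ht : 0 ≤ t)
    (hw : |w| ≤ M) (hw' : |w'| ≤ M) :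
    |source p μ t w - source p μ t w'| ≤ (2 ^ (-p) * (p * M ^ (p - 1)) + μ) * |w - w'| := by
  have hM : 0 ≤ M := (abs_nonneg w).trans hw
  have h1 : |(|w| ^ p - |w'| ^ p)| ≤ p * M ^ (p - 1) * |(|w| - |w'|)| := by
    refine (convex_Icc 0 M).norm_image_sub_le_of_norm_hasDerivWithin_le
      (f := fun x => x ^ p) (f' := fun x => p * x ^ (p - 1))
      (fun v _ => (Real.hasDerivAt_rpow_const (Or.inr hp.le)).hasDerivWithinAt)
      (fun v hv => ?_) ⟨abs_nonneg _, hw'⟩ ⟨abs_nonneg _, hw⟩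
    have h2 : 0 ≤ v ^ (p - 1) := Real.rpow_nonneg hv.1 _
    rw [Real.norm_eq_abs, abs_of_nonneg (by positivity)]
    have := Real.rpow_le_rpow hv.1 hv.2 (by linarith : 0 ≤ p - 1)
    gcongr
  have h3 := abs_abs_sub_abs_le w w'
  have h4 := div_one_add_le_self hμ ht
  have h5 : 0 ≤ μ / (1 + t) := by positivity
  have h6 : 0 ≤ M ^ (p - 1) := Real.rpow_nonneg hM _
  have e : source p μ t w - source p μ t w' =
      2 ^ (-p) * (|w| ^ p - |w'| ^ p) - μ / (1 + t) * ((w - w') / 2) := by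
    unfold source; ring
  rw [e]
  refine (abs_sub _ _).trans ?_
  rw [abs_mul, abs_mul, abs_of_nonneg h5, abs_div, abs_two, add_mul, mul_assoc]
  have h7 : (0 : ℝ) < 2 ^ (-p) := by positivity
  rw [abs_of_pos h7]
  have h8 : |(|w| ^ p - |w'| ^ p)| ≤ p * M ^ (p - 1) * |w - w'| := by
    refine h1.trans ?_
    gcongr
  have h9 : μ / (1 + t) * (|w - w'| / 2) ≤ μ * |w - w'| := by
    refine mul_le_mul h4 ?_ (by positivity) hμ.le
    linarith [abs_nonneg (w - w')]
  gcongr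

theorem IsSolution.agree (hp : 1 < p) (hμ : 0 < μ) (h : IsSolution p μ R f g T φ ψ)
    (h' : IsSolution p μ R f g T' φ' ψ') (hz : z ∈ depDomainWithBase R T)
    (hz' : z ∈ depDomainWithBase R T') : φ z = φ' z ∧ ψ z = ψ' z := by
  have hs := closedCone_subset_depDomainWithBase hz
  have hs' := closedCone_subset_depDomainWithBase hz'
  have c1 := h.continuous_left.mono hs
  have c2 := h.continuous_right.mono hs
  have c1' := h'.continuous_left.mono hs'
  have c2' := h'.continuous_right.mono hs'
  obtain ⟨M, hM⟩ := (isCompact_closedCone z).exists_bound_of_continuousOn (c1.add c2)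
  obtain ⟨M', hM'⟩ := (isCompact_closedCone z).exists_bound_of_continuousOn (c1'.add c2')
  have hd : ∀ {T : ℝ → ℝ} {h : ℝ × ℝ → ℝ}, IsC31On h (depDomain R T) →
      ∀ w ∈ depDomain R T, DifferentiableAt ℝ h w := fun hC w hw =>
    (hC.1.contDiffAt ((isOpen_depDomain R _).mem_nhds hw)).differentiableAt (by norm_num)
  have hmem := self_mem_closedCone (nonneg_of_mem_depDomainWithBase hz)
  have hM0 : 0 ≤ max M M' := (norm_nonneg _).trans ((hM z hmem).trans (le_max_left _ _))
  refine eq_of_transport_eq (z₀ := z) (H := source p μ)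
    (L := 2 ^ (-p) * (p * (max M M') ^ (p - 1)) + μ) (by positivity) c1 c2 c1' c2' ?_ ?_ ?_ ?_ hmem
  · rintro ⟨x, t⟩ hw (rfl : t = 0)
    rw [h.init_left x (hs hw), h.init_right x (hs hw), h'.init_left x (hs' hw),
      h'.init_right x (hs' hw)]
    exact ⟨rfl, rfl⟩
  · intro w hw
    exact abs_source_sub_le_of_abs_le hp hμ hw.1 ((hM w hw).trans (le_max_left _ _))
      ((hM' w hw).trans (le_max_right _ _))
  · intro w hw hw0
    have hm := mem_depDomain_of_pos (hs hw) hw0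
    have hm' := mem_depDomain_of_pos (hs' hw) hw0
    exact ⟨(hasDerivAt_minus (hd h.regular_left w hm)).congr_deriv (h.eq_left w hm),
      (hasDerivAt_minus (hd h'.regular_left w hm')).congr_deriv (h'.eq_left w hm')⟩
  · intro w hw hw0
    have hm := mem_depDomain_of_pos (hs hw) hw0
    have hm' := mem_depDomain_of_pos (hs' hw) hw0
    exact ⟨(hasDerivAt_plus (hd h.regular_right w hm)).congr_deriv (h.eq_right w hm),
      (hasDerivAt_plus (hd h'.regular_right w hm')).congr_deriv (h'.eq_right w hm')⟩

variable {S : ℝ}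

theorem IsBlowupSolution.time_le (hp : 1 < p) (hμ : 0 < μ)
    (h : IsBlowupSolution p μ R S f g T φ ψ) (h' : IsBlowupSolution p μ R S f g T' φ' ψ') {x : ℝ}
    (hx : x ∈ Metric.ball 0 R) : T' x ≤ T x := by
  by_contra hlt
  push Not at hlt
  have hxR : |x| < R := by rwa [mem_ball_zero_iff] at hx
  have hpos := (h.time_mem x hx).1
  have hm : (x, T x) ∈ depDomain R T' := region_subset_depDomain ⟨hxR, hpos, hlt⟩
  have hc : ContinuousAt φ' (x, T x) :=
    (h'.isSolution.regular_left.1.contDiffAt ((isOpen_depDomain R T').mem_nhds hm)).continuousAt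
  have h1 : Tendsto (fun t => φ' (x, t)) (𝓝[<] (T x)) (𝓝 (φ' (x, T x))) :=
    (ContinuousAt.comp (f := fun t => (x, t)) hc
      (Continuous.continuousAt (by fun_prop))).tendsto.mono_left nhdsWithin_le_nhds
  have h2 : (fun t => φ (x, t)) =ᶠ[𝓝[<] (T x)] fun t => φ' (x, t) := by
    filter_upwards [Ioo_mem_nhdsLT hpos] with t ht
    refine (h.isSolution.agree hp hμ h'.isSolution ?_ ?_).1 <;>
      refine depDomain_subset_depDomainWithBase (region_subset_depDomain ⟨hxR, ht.1, ?_⟩)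
    · exact ht.2
    · exact ht.2.trans hlt
  exact not_tendsto_nhds_of_tendsto_atTop (h.blowup_left x hx) _ (h1.congr' h2.symm)

theorem IsBlowupSolution.unique (hp : 1 < p) (hμ : 0 < μ)
    (h : IsBlowupSolution p μ R S f g T φ ψ) (h' : IsBlowupSolution p μ R S f g T' φ' ψ') :
    EqOn T' T (Metric.ball 0 R) ∧ EqOn φ' φ (depDomainWithBase R T) ∧
      EqOn ψ' ψ (depDomainWithBase R T) := by
  have hT : EqOn T' T (Metric.ball 0 R) := fun x hx =>
    le_antisymm (h.time_le hp hμ h' hx) (h'.time_le hp hμ h hx)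
  have hsub : depDomainWithBase R T ⊆ depDomainWithBase R T' := by
    intro z hz
    obtain ⟨y, hy, hzy⟩ := mem_depDomainWithBase_iff.1 hz
    refine mem_depDomainWithBase_iff.2 ⟨y, ⟨hy.1, hy.2.1, ?_⟩, hzy⟩
    rw [hT (by rw [mem_ball_zero_iff]; exact hy.1)]
    exact hy.2.2
  exact ⟨hT, fun z hz => (h'.isSolution.agree hp hμ h.isSolution (hsub hz) hz).1,
    fun z hz => (h'.isSolution.agree hp hμ h.isSolution (hsub hz) hz).2⟩

end Uniqueness

section Existence

variable {p μ k γ₁ γ₂ T₁ R : ℝ} {f g : ℝ → ℝ} {N : ℕ → ℝ} {Φ Ψ : ℕ → ℝ × ℝ → ℝ}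
  {τ : ℕ → ℝ → ℝ} {T : ℝ → ℝ} {φ ψ : ℝ × ℝ → ℝ} {z : ℝ × ℝ}

theorem locallyLipschitzOn_of_eventuallyEq {E F : Type*} [PseudoEMetricSpace E]
    [PseudoEMetricSpace F] {u : E → F} {s : Set E}
    (h : ∀ x ∈ s, ∃ v, LocallyLipschitz v ∧ u =ᶠ[𝓝 x] v) : LocallyLipschitzOn s u := by
  intro x hx
  obtain ⟨v, hv, huv⟩ := h x hx
  obtain ⟨K, t, ht, hK⟩ := hv x
  refine ⟨K, t ∩ {y | u y = v y}, mem_nhdsWithin_of_mem_nhds (inter_mem ht huv), ?_⟩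
  intro y hy y' hy'
  have e1 : u y = v y := hy.2
  have e2 : u y' = v y' := hy'.2
  rw [e1, e2]
  exact hK hy.1 hy'.1

theorem isC31On_of_eventuallyEq {u : ℝ × ℝ → ℝ} {s : Set (ℝ × ℝ)}
    (h : ∀ z ∈ s, ∃ v, ContDiff ℝ 4 v ∧ u =ᶠ[𝓝 z] v) : IsC31On u s := by
  refine ⟨fun z hz => ?_, locallyLipschitzOn_of_eventuallyEq fun z hz => ?_⟩
  · obtain ⟨v, hv, huv⟩ := h z hz
    exact (((hv.of_le (by norm_num)).contDiffAt).congr_of_eventuallyEq huv).contDiffWithinAt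
  · obtain ⟨v, hv, huv⟩ := h z hz
    exact ⟨_, (hv.iteratedFDeriv_right (m := 1) (i := 3) (by norm_num)).locallyLipschitz,
      huv.iteratedFDeriv ℝ 3⟩

namespace IsMaximalSolution

theorem lt_time_of_mem_closedCone (hk : 1 ≤ k)
    (h : IsMaximalSolution p μ k γ₁ γ₂ T₁ f g N Φ Ψ τ T φ ψ) {n : ℕ} {w : ℝ × ℝ}
    (hz : z.2 < τ n z.1) (hw : w ∈ closedCone z) : w.2 < τ n w.1 := by
  have h1 := (h.level n).lip w.1 z.1
  have h2 := abs_nonneg (τ n w.1 - τ n z.1)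
  have h3 : |τ n w.1 - τ n z.1| ≤ |w.1 - z.1| := by nlinarith
  have h4 := (abs_le.1 h3).1
  linarith [hw.2]

theorem backwardConeWithBase_subset_closedCone (z : ℝ × ℝ) :
    backwardConeWithBase z ⊆ closedCone z := fun _ hw => ⟨hw.1, hw.2.le⟩

theorem exists_level_of_mem (hk : 1 ≤ k)
    (h : IsMaximalSolution p μ k γ₁ γ₂ T₁ f g N Φ Ψ τ T φ ψ) (hz : z ∈ depDomainWithBase R T) :
    ∃ n, z.2 < τ n z.1 := by
  obtain ⟨y, hy, hzy⟩ := mem_depDomainWithBase_iff.1 hz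
  obtain ⟨n, hn⟩ := h.exists_lt_time hy.2.2
  exact ⟨n, h.lt_time_of_mem_closedCone hk hn (backwardConeWithBase_subset_closedCone y hzy)⟩

theorem isSolution (hk : 1 ≤ k) (h : IsMaximalSolution p μ k γ₁ γ₂ T₁ f g N Φ Ψ τ T φ ψ)
    {f' g' : ℝ → ℝ} (hff' : ∀ x, |x| ≤ R + T₁ → f x = f' x ∧ g x = g' x) :
    IsSolution p μ R f' g' T φ ψ := by
  have hdom : ∀ z ∈ depDomain R T, ∃ n, 0 < z.2 ∧ z.2 < τ n z.1 := by
    intro z hz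
    obtain ⟨n, hn⟩ := h.exists_level_of_mem hk (depDomain_subset_depDomainWithBase hz)
    obtain ⟨y, -, hzy⟩ := mem_depDomain_iff.1 hz
    exact ⟨n, hzy.1, hn⟩
  have hinit : ∀ x, (x, (0 : ℝ)) ∈ depDomainWithBase R T → |x| ≤ R + T₁ ∧
      φ (x, 0) = f x ∧ ψ (x, 0) = g x := by
    intro x hx
    obtain ⟨n, hn⟩ := h.exists_level_of_mem hk hx
    have ha := h.agree n (x, 0) le_rfl hn.le
    obtain ⟨y, hy, hxy⟩ := mem_depDomainWithBase_iff.1 hx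
    refine ⟨?_, by rw [ha.1, (h.level n).init_left], by rw [ha.2, (h.level n).init_right]⟩
    have h1 : |x - y.1| < y.2 - 0 := hxy.2
    have h2 := h.time_le y.1
    have h3 := abs_sub_abs_le_abs_sub x y.1
    linarith [hy.1, hy.2.2]
  have hcont : ∀ (u : ℝ × ℝ → ℝ) (U : ℕ → ℝ × ℝ → ℝ), (∀ n, Continuous (U n)) →
      (∀ n, ∀ z : ℝ × ℝ, 0 ≤ z.2 → z.2 ≤ τ n z.1 → u z = U n z) →
      ContinuousOn u (depDomainWithBase R T) := by
    intro u U hU huU z hz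
    obtain ⟨n, hn⟩ := h.exists_level_of_mem hk hz
    have hnear : ∀ᶠ w : ℝ × ℝ in 𝓝 z, w.2 < τ n w.1 :=
      (isOpen_lt continuous_snd (((h.level n).continuous_time hk).comp continuous_fst)).mem_nhds hn
    refine ((hU n).continuousWithinAt).congr_of_eventuallyEq ?_
      (huU n z (nonneg_of_mem_depDomainWithBase hz) hn.le)
    filter_upwards [mem_nhdsWithin_of_mem_nhds hnear, self_mem_nhdsWithin] with w hw hw'
    exact huU n w (nonneg_of_mem_depDomainWithBase hw') (le_of_lt hw)
  refine ⟨isC31On_of_eventuallyEq fun z hz => ?_, isC31On_of_eventuallyEq fun z hz => ?_,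
    hcont φ Φ (fun n => (h.level n).smooth_left.continuous) fun n z h1 h2 => (h.agree n z h1 h2).1,
    hcont ψ Ψ (fun n => (h.level n).smooth_right.continuous) fun n z h1 h2 => (h.agree n z h1 h2).2,
    fun z hz => ?_, fun z hz => ?_, fun x hx => ?_, fun x hx => ?_⟩
  · obtain ⟨n, h1, h2⟩ := hdom z hz
    exact ⟨_, (h.level n).smooth_left, (h.eventuallyEq hk h1 h2).1⟩
  · obtain ⟨n, h1, h2⟩ := hdom z hz
    exact ⟨_, (h.level n).smooth_right, (h.eventuallyEq hk h1 h2).2⟩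
  · obtain ⟨n, h1, h2⟩ := hdom z hz
    have ha := h.agree n z h1.le h2.le
    rw [ha.1, ha.2, ← (h.level n).eq_left z h1.le h2.le, Dminus, Dminus,
      (h.eventuallyEq hk h1 h2).1.fderiv_eq]
  · obtain ⟨n, h1, h2⟩ := hdom z hz
    have ha := h.agree n z h1.le h2.le
    rw [ha.1, ha.2, ← (h.level n).eq_right z h1.le h2.le, Dplus, Dplus,
      (h.eventuallyEq hk h1 h2).2.fderiv_eq]
  · obtain ⟨h1, h2, -⟩ := hinit x hx
    exact h2.trans (hff' x h1).1
  · obtain ⟨h1, -, h2⟩ := hinit x hx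
    exact h2.trans (hff' x h1).2

theorem exists_lipschitzOnWith (hk : 1 ≤ k)
    (h : IsMaximalSolution p μ k γ₁ γ₂ T₁ f g N Φ Ψ τ T φ ψ) (hz : z.2 < T z.1) :
    ∃ C : NNReal, LipschitzOnWith C (iteratedFDeriv ℝ 3 φ) (backwardCone z) ∧
      LipschitzOnWith C (iteratedFDeriv ℝ 3 ψ) (backwardCone z) := by
  obtain ⟨n, hn⟩ := h.exists_lt_time hz
  have key : ∀ u v : ℝ × ℝ → ℝ, ContDiff ℝ 4 v →
      (∀ w : ℝ × ℝ, 0 < w.2 → w.2 < τ n w.1 → u =ᶠ[𝓝 w] v) →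
      ∃ C : NNReal, LipschitzOnWith C (iteratedFDeriv ℝ 3 u) (backwardCone z) := by
    intro u v hv huv
    obtain ⟨C, hC⟩ := ((hv.iteratedFDeriv_right (m := 1) (i := 3)
      (by norm_num)).locallyLipschitz.locallyLipschitzOn
        (s := closedCone z)).exists_lipschitzOnWith_of_compact (isCompact_closedCone z)
    refine ⟨C, fun w hw w' hw' => ?_⟩
    have hmem : ∀ w ∈ backwardCone z, w ∈ closedCone z := fun w hw => ⟨hw.1.le, hw.2.le⟩
    have heq : ∀ w ∈ backwardCone z, iteratedFDeriv ℝ 3 u w = iteratedFDeriv ℝ 3 v w :=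
      fun w hw => ((huv w hw.1
        (h.lt_time_of_mem_closedCone hk hn (hmem w hw))).iteratedFDeriv ℝ 3).self_of_nhds
    rw [heq w hw, heq w' hw']
    exact hC (hmem w hw) (hmem w' hw')
  obtain ⟨C, hC⟩ := key φ (Φ n) (h.level n).smooth_left fun w h1 h2 => (h.eventuallyEq hk h1 h2).1
  obtain ⟨C', hC'⟩ := key ψ (Ψ n) (h.level n).smooth_right fun w h1 h2 =>
    (h.eventuallyEq hk h1 h2).2
  exact ⟨max C C', hC.weaken (le_max_left _ _), hC'.weaken (le_max_right _ _)⟩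

end IsMaximalSolution

end Existence
end BlowupCurve

theorem theorem3p1 (p μ : ℝ) (hp : 1 < p) (hμ : 0 < μ) (hpμ : p < 1 + 2 / μ)
    (hpow : ContDiffOn ℝ 4 (fun s : ℝ => s ^ p) (Set.Ici 0))
    (R Tstar : ℝ) (hR : 0 < R) (hTstar : 0 < Tstar)
    (γ₁ γ₂ : ℝ) (hγ₁ : 0 < γ₁) (hγ₂ : 0 < γ₂)
    (hγ : max 1 ((μ * p * (2 : ℝ) ^ p) ^ (1 / (p - 1))) < γ₁ + γ₂)
    (f g : ℝ → ℝ)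
    -- the ODE comparison system blows up before `Tstar`
    (T₁ : ℝ) (hT₁ : BlowupCurve.IsODEBlowupTime p μ γ₁ γ₂ T₁) (hA1 : T₁ < Tstar)
    -- lower bounds for the data
    (hA2 : ∀ x ∈ Metric.ball (0 : ℝ) (R + Tstar), γ₁ ≤ f x ∧ γ₂ ≤ g x)
    -- regularity of the data
    (hA3 : ContDiffOn ℝ 4 f (Metric.closedBall 0 (R + Tstar)) ∧
      ContDiffOn ℝ 4 g (Metric.closedBall 0 (R + Tstar)))
    -- smallness of the derivatives of the data
    (hA4 : ∃ ε₀ : ℝ, 0 < ε₀ ∧ ∀ x ∈ Metric.ball (0 : ℝ) (R + Tstar),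
      (2 + ε₀) * (|deriv f x| + |deriv g x|) ≤
        (2 : ℝ) ^ (-p) * (γ₁ + γ₂) ^ p - μ / 2 * (γ₁ + γ₂))
    (hA5 : ∃ ε₁ : ℝ, ε₁ ≠ -1 ∧
      0 < (2 : ℝ) ^ (-p) * (2 * p - 1) * (1 + ε₁ / (2 * (1 + ε₁))) * (1 - 1 / (2 * p))
        - (2 : ℝ) ^ (-p + 1) * p - μ ∧
      ∀ x ∈ Metric.ball (0 : ℝ) (R + Tstar),
        (2 + ε₁) * (|deriv f x| + |deriv g x|) ≤
          (2 : ℝ) ^ (-p) * (γ₁ + γ₂) ^ p - μ / 2 * (γ₁ + γ₂)) :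
    ∃ (T : ℝ → ℝ) (φ ψ : ℝ × ℝ → ℝ),
      BlowupCurve.IsBlowupSolution p μ R Tstar f g T φ ψ ∧
      -- the third derivatives are Lipschitz in each backward cone, up to the initial line
      (∀ z ∈ BlowupCurve.region R T, ∃ C : NNReal,
        LipschitzOnWith C (iteratedFDeriv ℝ 3 φ) (BlowupCurve.backwardCone z) ∧
        LipschitzOnWith C (iteratedFDeriv ℝ 3 ψ) (BlowupCurve.backwardCone z)) ∧
      -- uniqueness of the curve and of the solution
      ∀ (T' : ℝ → ℝ) (φ' ψ' : ℝ × ℝ → ℝ),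
        BlowupCurve.IsBlowupSolution p μ R Tstar f g T' φ' ψ' →
          Set.EqOn T' T (Metric.ball 0 R) ∧
          Set.EqOn φ' φ (BlowupCurve.depDomainWithBase R T) ∧
          Set.EqOn ψ' ψ (BlowupCurve.depDomainWithBase R T) := by
  obtain ⟨ε₀, hε₀, hslope⟩ := hA4
  have hw₀ : BlowupCurve.IsLarge p μ (max 1 ((μ * p * (2 : ℝ) ^ p) ^ (1 / (p - 1)))) :=
    BlowupCurve.isLarge_of_le hp hμ (lt_max_of_lt_left one_pos) (le_max_right _ _)
  have hk : 1 < 1 + ε₀ := by linarith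
  obtain ⟨θ, hθ, hext⟩ := BlowupCurve.exists_data_extension (r₁ := R + T₁) (r₂ := R + Tstar)
    (by linarith [hT₁.1]) (by linarith)
  obtain ⟨hf, ⟨Df, hDf⟩, hf'⟩ := hext f hA3.1
  obtain ⟨hg, ⟨Dg, hDg⟩, hg'⟩ := hext g hA3.2
  have hode : BlowupCurve.odeSource p μ (γ₁ + γ₂) =
      (2 : ℝ) ^ (-p) * (γ₁ + γ₂) ^ p - μ / 2 * (γ₁ + γ₂) := by
    rw [BlowupCurve.odeSource, abs_of_pos (by linarith)]
  have hdata : BlowupCurve.IsData p μ (1 + ε₀) γ₁ γ₂ (f ∘ θ) (g ∘ θ) := by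
    refine ⟨hf, hg, ⟨max Df Dg, fun x => ⟨(hDf x).trans (le_max_left _ _),
      (hDg x).trans (le_max_right _ _)⟩⟩, fun x => hA2 _ (hf' x).1, fun x => ?_⟩
    have h1 := hslope _ (hf' x).1
    have h2 := (hf' x).2
    have h3 := (hg' x).2
    have h4 := abs_nonneg (deriv f (θ x))
    have h5 := abs_nonneg (deriv g (θ x))
    rw [hode]
    constructor <;> refine le_trans ?_ h1 <;> rw [← add_assoc, one_add_one_eq_two] <;>
      refine mul_le_mul_of_nonneg_left ?_ (by linarith) <;> linarith
  obtain ⟨N, Φ, Ψ, τ, T, φ, ψ, h⟩ :=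
    BlowupCurve.exists_maximalSolution hp hμ hk.le hw₀ hγ hT₁ hdata
  have hsol : BlowupCurve.IsBlowupSolution p μ R Tstar f g T φ ψ :=
    ⟨h.contDiffOn_time hp hμ hk (hw₀.mono hp hγ.le) R,
      fun x _ => ⟨h.time_pos x, (h.time_le x).trans_lt hA1⟩,
      h.isSolution hk.le fun x hx => by simp only [Function.comp_apply, hθ x hx, and_self],
      fun x _ => (h.tendsto_components hk x).1, fun x _ => (h.tendsto_components hk x).2⟩
  exact ⟨T, φ, ψ, hsol, fun z hz => h.exists_lipschitzOnWith hk.le hz.2.2,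
    fun T' φ' ψ' h' => hsol.unique hp hμ h'⟩
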